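/- Let $\mathbb K$ be a field and let $\mathbf C$ be a $\mathbb K$-linear abelian category that is semisimple (every monomorphism splits), cocomplete, with exact filtered colimits, and that carries a $\mathbb K$-bilinear monoidal structure $(\otimes,e)$ such that $X\otimes-$ and $-\otimes X$ are exact and commute with filtered colimits for every object $X$ (for instance, $\mathbf C$ is the category of $\mathbb K$-vector spaces). Graded objects are sequences $M=(M^p)_{p\in\mathbb Z}$ of objects of $\mathbf C$, with $(M\otimes L)^n=\bigoplus_{p+q=n}M^p\otimes L^q$, and graded morphisms $f,g$ of degrees $r,s$ are tensored by $f\otimes g=(-1)^{ps}f^p\otimes g^q$ on $M^p\otimes L^q$. An $A_\infty$-structure on a graded object $A$ is a family of graded morphisms $m_i\colon A^{\otimes i}\to A$ of degree $2-i$, $i\ge1$, such that for all $n\ge1$ $$\sum_{j+k+l=n,\ k\geq 1}(-1)^{jk+l}\,m_{j+1+l}(\mathbf 1^{\otimes j}\otimes m_k\otimes\mathbf 1^{\otimes l})=0 .$$ An $A_\infty$-morphism $f\colon A\to B$ is a family of graded morphisms $f_i\colon A^{\otimes i}\to B$ of degree $1-i$, $i\ge1$, such that for all $n\ge1$ $$\sum_{j+k+l=n,\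 k\geq 1}(-1)^{jk+l}f_{j+1+l}(\mathbf 1^{\otimes j}\otimes m_k\otimes\mathbf 1^{\otimes l})=\sum_{i_1+\dots+i_r=n}(-1)^{s}\,m_r(f_{i_1}\otimes\cdots\otimes f_{i_r}),\qquad s=\sum_{2\le u\le r}(1-i_u)\sum_{v<u}i_v ;$$ the composition is $(gf)_n=\sum(-1)^s g_r(f_{i_1}\otimes\cdots\otimes f_{i_r})$ with the same sums and signs, and the identity has $f_1=\mathbf 1$ and $f_i=0$ for $i\ge2$. An $A_\infty$-quasi-isomorphism is an $A_\infty$-morphism $f$ for which $f_1\colon(A,m_1)\to(B,m_1)$ is a quasi-isomorphism of complexes. Let $A$ be an $A_\infty$-algebra, and let $H^*A$ be the homology of the complex $(A,m_1)$. (1) Let $(V,d)$ be a complex and let $g\colon(V,d)\to(A,m_1)$ be a homotopy equivalence of complexes. Then there are an $A_\infty$-structure on $V$ with $m_1^V=d$ and an $A_\infty$-morphism $f\colon V\to A$ with $f_1=g$. (2) There is an $A_\infty$-structure on $H^*A$ such that $m_1=0$, $m_2$ is induced by $m_2^A$, and there is an $A_\infty$-quasi-isomorphism $f\colon H^*A\to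 A$ lifting the identity of $H^*A$ (that is, $f_1$ sends each class to a cycle representing it). (3) This structure is unique up to isomorphism: any two $A_\infty$-structures on $H^*A$ with $m_1=0$ that admit an $A_\infty$-quasi-isomorphism to $A$ are isomorphic as $A_\infty$-algebras. (The isomorphism is not asserted to be unique.) -/

import Mathlib

open CategoryTheory MonoidalCategory Limits

universe v u

set_option linter.unusedSectionVars false

attribute [local instance 10000] CategoryStruct.toQuiver

namespace AInfinity

section Graded

variable {C : Type u} [Category.{v} C]

/-- Graded morphisms `M → L` of degree `r`: elements of `∏_p Hom(M^p, L^{p+r})`.  The component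
`M^p ⟶ L^q` is indexed by all pairs `(p, q)` with `p + r = q`. -/
def GrHom (M L : GradedObject ℤ C) (r : ℤ) : Type v :=
  ∀ x : {x : ℤ × ℤ // x.1 + r = x.2}, M x.1.1 ⟶ L x.1.2

/-- The component `M^p ⟶ L^q` of a graded morphism of degree `r = q - p`. -/
def GrHom.app {M L : GradedObject ℤ C} {r : ℤ} (f : GrHom M L r) (p q : ℤ) (h : p + r = q) :
    M p ⟶ L q :=
  f ⟨(p, q), h⟩

instance [Preadditive C] (M L : GradedObject ℤ C) (r : ℤ) : AddCommGroup (GrHom M L r) :=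
  inferInstanceAs (AddCommGroup (∀ x : {x : ℤ × ℤ // x.1 + r = x.2}, M x.1.1 ⟶ L x.1.2))

/-- Composition (first `f`, then `g`) of graded morphisms of degrees `r` and `s`. -/
def GrHom.comp {M L N : GradedObject ℤ C} {r s : ℤ} (f : GrHom M L r) (g : GrHom L N s)
    (t : ℤ) (h : r + s = t) : GrHom M N t :=
  fun x => f.app x.1.1 (x.1.1 + r) rfl ≫ g.app (x.1.1 + r) x.1.2 (by have := x.2; omega)

theorem GrHom.comp_app {M L N : GradedObject ℤ C} {r s : ℤ} (f : GrHom M L r) (g : GrHom L N s)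
    (t : ℤ) (h : r + s = t) (p p' q : ℤ) (h1 : p + r = p') (h2 : p' + s = q) :
    (f.comp g t h).app p q (by omega) = f.app p p' h1 ≫ g.app p' q h2 := by
  subst h1
  rfl

end Graded

section TensorPower

variable {C : Type u} [Category.{v} C] [MonoidalCategory C]

/-- For a word `w = [p₁, …, pₙ]` of degrees, the object `A^{p₁} ⊗ (A^{p₂} ⊗ (⋯ (A^{pₙ} ⊗ e)))`. -/
def wordObj (A : GradedObject ℤ C) : List ℤ → C
  | [] => 𝟙_ C
  | p :: w => A p ⊗ wordObj A w

/-- The identification `A^p ≅ A^p ⊗ e` with the object of a word of length one. -/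
def wordOne (A : GradedObject ℤ C) (p : ℤ) : A p ≅ wordObj A [p] :=
  (ρ_ (A p)).symm

/-- The rebracketing `A^{u ++ w} ≅ A^u ⊗ A^w`. -/
def wordSplit (A : GradedObject ℤ C) :
    ∀ u w : List ℤ, wordObj A (u ++ w) ≅ wordObj A u ⊗ wordObj A w
  | [], w => (λ_ (wordObj A w)).symm
  | p :: u, w =>
      whiskerLeftIso (A p) (wordSplit A u w) ≪≫ (α_ (A p) (wordObj A u) (wordObj A w)).symm

/-- Words of length `n` and total degree `d`. -/
abbrev Word (n : ℕ) (d : ℤ) : Type := {w : List ℤ // w.length = n ∧ w.sum = d}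

variable [HasCoproducts.{0} C]

/-- The graded tensor power: `(A^{⊗ n})^d = ⨁_{p₁ + ⋯ + pₙ = d} A^{p₁} ⊗ ⋯ ⊗ A^{pₙ}`. -/
noncomputable def tpow (A : GradedObject ℤ C) (n : ℕ) : GradedObject ℤ C :=
  fun d => ∐ fun w : Word n d => wordObj A w.1

/-- The inclusion of the summand of `A^{⊗ n}` that belongs to the word `w`. -/
noncomputable def tpowι (A : GradedObject ℤ C) {n : ℕ} {d : ℤ} (w : List ℤ)
    (hn : w.length = n) (hd : w.sum = d) : wordObj A w ⟶ tpow A n d :=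
  Sigma.ι (fun w : Word n d => wordObj A w.1) ⟨w, hn, hd⟩

/-- The morphism out of `(A^{⊗ n})^d` with prescribed restrictions to the summands. -/
noncomputable def tpowDesc {A : GradedObject ℤ C} {n : ℕ} {d : ℤ} {X : C}
    (φ : ∀ w : List ℤ, w.length = n → w.sum = d → (wordObj A w ⟶ X)) : tpow A n d ⟶ X :=
  Sigma.desc fun w : Word n d => φ w.1 w.2.1 w.2.2

theorem tpowι_desc {A : GradedObject ℤ C} {n : ℕ} {d : ℤ} {X : C}
    (φ : ∀ w : List ℤ, w.length = n → w.sum = d → (wordObj A w ⟶ X)) (w : List ℤ)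
    (hn : w.length = n) (hd : w.sum = d) : tpowι A w hn hd ≫ tpowDesc φ = φ w hn hd :=
  Sigma.ι_desc _ _

/-- The restriction of a graded morphism `φ : A^{⊗ n} → B` of degree `r` to the summand of the
word `w`. -/
noncomputable def GrHom.atWord {A B : GradedObject ℤ C} {n : ℕ} {r : ℤ}
    (φ : GrHom (tpow A n) B r) (w : List ℤ) (hn : w.length = n) (q : ℤ) (hq : w.sum + r = q) :
    wordObj A w ⟶ B q :=
  tpowι A w hn rfl ≫ φ.app w.sum q hq

theorem tpowι_app {A B : GradedObject ℤ C} {n : ℕ} {r : ℤ} (φ : GrHom (tpow A n) B r)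
    (w : List ℤ) (hn : w.length = n) (d : ℤ) (hd : w.sum = d) (q : ℤ) (hq : d + r = q) :
    tpowι A w hn hd ≫ φ.app d q hq = φ.atWord w hn q (by omega) := by
  subst hd
  rfl

/-- A graded morphism `A^{⊗ 1} → B` as a graded morphism `A → B`. -/
noncomputable def GrHom.unary {A B : GradedObject ℤ C} {r : ℤ} (φ : GrHom (tpow A 1) B r) :
    GrHom A B r :=
  fun x => (wordOne A x.1.1).hom ≫ φ.atWord [x.1.1] rfl x.1.2 (by simpa using x.2)

/-- The components `A^p ⊗ A^q ⟶ B^t` of a graded morphism `A^{⊗ 2} → B`. -/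
noncomputable def GrHom.binary {A B : GradedObject ℤ C} {r : ℤ} (φ : GrHom (tpow A 2) B r)
    (p q t : ℤ) (h : p + q + r = t) : A p ⊗ A q ⟶ B t :=
  A p ◁ (wordOne A q).hom ≫ φ.atWord [p, q] rfl t (by simpa [add_assoc] using h)

variable [Preadditive C]

/-- The component of `1 ⊗ φ ⊗ 1` on the summand of `p ++ u ++ w`, where `φ` of degree `r` is applied
to the factor `A^u`.  The Koszul sign is `(-1)^{r |p|}`. -/
noncomputable def insertWord {A : GradedObject ℤ C} {k : ℕ} {r : ℤ} (φ : GrHom (tpow A k) A r)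
    (p u w : List ℤ) (hu : u.length = k) :
    wordObj A (p ++ (u ++ w)) ⟶ wordObj A (p ++ (u.sum + r) :: w) :=
  (p.sum * r).negOnePow •
    ((wordSplit A p (u ++ w)).hom ≫
      wordObj A p ◁ ((wordSplit A u w).hom ≫ φ.atWord u hu (u.sum + r) rfl ▷ wordObj A w) ≫
      (wordSplit A p ((u.sum + r) :: w)).inv)

/-- The graded morphism `1^{⊗ j} ⊗ φ ⊗ 1^{⊗ l} : A^{⊗ n} → A^{⊗ (j + 1 + l)}`, `j + k + l = n`. -/
noncomputable def insertHom {A : GradedObject ℤ C} {k : ℕ} {r : ℤ} (φ : GrHom (tpow A k) A r)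
    (j l n : ℕ) (h : j + k + l = n) : GrHom (tpow A n) (tpow A (j + 1 + l)) r :=
  fun x => tpowDesc fun w hn hd =>
    eqToHom (by simp only [List.take_append_drop]) ≫
      insertWord φ (w.take j) ((w.drop j).take k) ((w.drop j).drop k)
        (by simp; omega) ≫
      tpowι A _ (by simp; omega) (by
        have h1 := List.sum_take_add_sum_drop w j
        have h2 := List.sum_take_add_sum_drop (w.drop j) k
        have h4 := x.2
        simp only [List.sum_append, List.sum_cons]
        omega)

theorem tpowι_insertHom {A : GradedObject ℤ C} {k : ℕ} {r : ℤ} (φ : GrHom (tpow A k) A r)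
    (j l n : ℕ) (h : j + k + l = n) (p u w : List ℤ) (hp : p.length = j) (hu : u.length = k)
    (hw : w.length = l) (d d' : ℤ) (hd : (p ++ (u ++ w)).sum = d) (hd' : d + r = d') :
    tpowι A (p ++ (u ++ w)) (by simp; omega) hd ≫ (insertHom φ j l n h).app d d' hd' =
      insertWord φ p u w hu ≫ tpowι A (p ++ (u.sum + r) :: w) (by simp; omega)
        (by simp at hd ⊢; omega) := by
  have aux : ∀ (p' u' w' : List ℤ) (_ : p' = p) (_ : u' = u) (_ : w' = w) (h1) (h2) (h3) (h4),
      eqToHom h1 ≫ insertWord φ p' u' w' h2 ≫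
        tpowι A (d := d') (p' ++ (u'.sum + r) :: w') h3 h4 =
      insertWord φ p u w hu ≫ tpowι A (n := j + 1 + l) (d := d') (p ++ (u.sum + r) :: w)
        (by simp; omega) (by simp at hd ⊢; omega) := by
    rintro _ _ _ rfl rfl rfl h1 h2 h3 h4
    exact Category.id_comp _
  simp only [GrHom.app, insertHom]
  rw [tpowι_desc]
  refine aux _ _ _ ?_ ?_ ?_ _ _ _ _
  all_goals subst hp hu; simp

/-- For blocks `u₁, …, uᵣ`, the component of `f_{i₁} ⊗ ⋯ ⊗ f_{iᵣ}`, `iₐ = |uₐ|`, on the summand of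
the concatenated word.  The sign is that of `f ⊗ g = (-1)^{p s} f^p ⊗ g^q` with `s = deg g`. -/
noncomputable def blockHom {A B : GradedObject ℤ C}
    (f : ∀ i : ℕ, GrHom (tpow A i) B (1 - (i : ℤ))) :
    ∀ L : List (List ℤ),
      wordObj A L.flatten ⟶ wordObj B (L.map fun u => u.sum + (1 - (u.length : ℤ)))
  | [] => 𝟙 (𝟙_ C)
  | u :: L =>
      (u.sum * (L.map fun x => 1 - (x.length : ℤ)).sum).negOnePow •
        ((wordSplit A u L.flatten).hom ≫
          ((f u.length).atWord u rfl (u.sum + (1 - (u.length : ℤ))) rfl ⊗ₘ blockHom f L))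

theorem sum_map_block (L : List (List ℤ)) :
    (L.map fun u => u.sum + (1 - (u.length : ℤ))).sum =
      L.flatten.sum + ((L.length : ℤ) - L.flatten.length) := by
  induction L with
  | nil => simp
  | cons u L ih =>
    simp only [List.map_cons, List.sum_cons, ih, List.flatten_cons, List.sum_append,
      List.length_append, List.length_cons]
    push_cast
    ring

theorem flatten_split {n : ℕ} (c : Composition n) (w : List ℤ) (h : w.length = n) :
    (w.splitWrtComposition c).flatten = w := by
  subst h
  exact w.flatten_splitWrtComposition c

/-- For `n = i₁ + ⋯ + iᵣ`, the graded morphism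
`f_{i₁} ⊗ ⋯ ⊗ f_{iᵣ} : A^{⊗ n} → B^{⊗ r}`, of degree `∑ (1 - iₐ) = r - n`. -/
noncomputable def tensorHom {A B : GradedObject ℤ C}
    (f : ∀ i : ℕ, GrHom (tpow A i) B (1 - (i : ℤ))) {n : ℕ} (c : Composition n) :
    GrHom (tpow A n) (tpow B c.length) ((c.length : ℤ) - n) :=
  fun x => tpowDesc fun w hn hd =>
    eqToHom (by rw [flatten_split c w hn]) ≫
      blockHom f (w.splitWrtComposition c) ≫
      tpowι B _ (by simp [List.length_splitWrtComposition]) (by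
        rw [sum_map_block, flatten_split c w hn, List.length_splitWrtComposition, hn, hd]
        exact x.2)

theorem tpowι_tensorHom {A B : GradedObject ℤ C}
    (f : ∀ i : ℕ, GrHom (tpow A i) B (1 - (i : ℤ))) {n : ℕ} (c : Composition n)
    (L : List (List ℤ)) (hL : L.map List.length = c.blocks) (d d' : ℤ) (hd : L.flatten.sum = d)
    (hd' : d + ((c.length : ℤ) - n) = d') :
    tpowι A L.flatten (by rw [List.length_flatten, hL, c.blocks_sum]) hd ≫
        (tensorHom f c).app d d' hd' =
      blockHom f L ≫ tpowι B (L.map fun u => u.sum + (1 - (u.length : ℤ)))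
        (by simpa using congrArg List.length hL) (by
          have h1 := congrArg List.length hL
          have h2 := List.length_flatten (L := L)
          rw [hL, c.blocks_sum] at h2
          rw [sum_map_block, h2, hd, ← hd', ← c.blocks_length, ← h1, List.length_map]) := by
  have aux : ∀ (L' : List (List ℤ)) (_ : L' = L) (h1) (h2) (h3) (h4) (h5),
      eqToHom h1 ≫ blockHom f L' ≫
        tpowι B (n := c.length) (d := d') (L'.map fun u => u.sum + (1 - (u.length : ℤ))) h2 h3 =
      blockHom f L ≫
        tpowι B (n := c.length) (d := d') (L.map fun u => u.sum + (1 - (u.length : ℤ))) h4 h5 := by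
    rintro _ rfl h1 h2 h3 h4 h5
    exact Category.id_comp _
  simp only [GrHom.app, tensorHom]
  rw [tpowι_desc]
  refine aux _ ?_ _ _ _ _ _
  have hn : n = L.flatten.length := by rw [List.length_flatten, hL, c.blocks_sum]
  subst hn
  exact List.splitWrtComposition_flatten L c hL

end TensorPower

section Structures

variable {C : Type u} [Category.{v} C] [Preadditive C] [MonoidalCategory C] [HasCoproducts.{0} C]

/-- Triples `(j, k, l)` of natural numbers with `j + k + l = n` and `k ≥ 1`. -/
abbrev Triple (n : ℕ) : Type :=
  {x : Fin (n + 1) × Fin (n + 1) × Fin (n + 1) //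
    (x.1 : ℕ) + (x.2.1 : ℕ) + (x.2.2 : ℕ) = n ∧ 1 ≤ (x.2.1 : ℕ)}

/-- The entries of a triple `(j, k, l)`. -/
abbrev Triple.j {n : ℕ} (x : Triple n) : ℕ := x.1.1
/-- The entries of a triple `(j, k, l)`. -/
abbrev Triple.k {n : ℕ} (x : Triple n) : ℕ := x.1.2.1
/-- The entries of a triple `(j, k, l)`. -/
abbrev Triple.l {n : ℕ} (x : Triple n) : ℕ := x.1.2.2

/-- `∑ (-1)^{jk + l} φ_{j+1+l} ∘ (1^{⊗ j} ⊗ m_k ⊗ 1^{⊗ l})` over `j + k + l = n`, `k ≥ 1`, for a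
family `φᵢ : A^{⊗ i} → B` of degrees `a - i`. -/
noncomputable def insertSum {A B : GradedObject ℤ C}
    (m : ∀ i : ℕ, GrHom (tpow A i) A (2 - (i : ℤ))) {a : ℤ}
    (φ : ∀ i : ℕ, GrHom (tpow A i) B (a - (i : ℤ))) (n : ℕ) (t : ℤ) (h : a + 1 - n = t) :
    GrHom (tpow A n) B t :=
  ∑ x : Triple n, ((x.j * x.k + x.l : ℕ) : ℤ).negOnePow •
    (insertHom (m x.k) x.j x.l n x.2.1).comp (φ (x.j + 1 + x.l)) t
      (by have h' : x.j + x.k + x.l = n := x.2.1; push_cast; omega)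

/-- The exponent `∑_α (1 - i_α) ∑_{β < α} i_β` attached to `n = i₁ + ⋯ + iᵣ`. -/
def blockSign {n : ℕ} (c : Composition n) : ℤ :=
  ∑ α : Fin c.length, (1 - (c.blocksFun α : ℤ)) * (c.sizeUpTo α : ℤ)

/-- `∑ (-1)^s φᵣ ∘ (f_{i₁} ⊗ ⋯ ⊗ f_{iᵣ})` over all `n = i₁ + ⋯ + iᵣ` with `iₐ ≥ 1`, for a family
`φᵢ : B^{⊗ i} → E` of degrees `a - i`. -/
noncomputable def blockSum {A B E : GradedObject ℤ C}
    (f : ∀ i : ℕ, GrHom (tpow A i) B (1 - (i : ℤ))) {a : ℤ}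
    (φ : ∀ i : ℕ, GrHom (tpow B i) E (a - (i : ℤ))) (n : ℕ) :
    GrHom (tpow A n) E (a - (n : ℤ)) :=
  ∑ c : Composition n, (blockSign c).negOnePow •
    (tensorHom f c).comp (φ c.length) (a - (n : ℤ)) (by omega)

/-- An `A_∞`-structure on the graded object `A`: graded morphisms `mₙ : A^{⊗ n} → A` of degree
`2 - n`, `n ≥ 1`, with `∑ (-1)^{jk + l} m_{j+1+l} (1^{⊗ j} ⊗ m_k ⊗ 1^{⊗ l}) = 0` for all `n ≥ 1`.
(The operation with index `0` is absent, that is, zero.) -/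
structure AInfStructure (A : GradedObject ℤ C) where
  m : ∀ n : ℕ, GrHom (tpow A n) A (2 - (n : ℤ))
  m_zero : m 0 = 0
  rel : ∀ n : ℕ, 1 ≤ n → insertSum m m n (3 - n) (by ring) = 0

/-- An `A_∞`-morphism: graded morphisms `fₙ : A^{⊗ n} → B` of degree `1 - n`, `n ≥ 1`, with
`∑ (-1)^{jk + l} f_{j+1+l} (1^{⊗ j} ⊗ m_k ⊗ 1^{⊗ l}) = ∑ (-1)^s mᵣ (f_{i₁} ⊗ ⋯ ⊗ f_{iᵣ})`
for all `n ≥ 1`. -/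
structure AInfHom {A B : GradedObject ℤ C} (mA : AInfStructure A) (mB : AInfStructure B) where
  f : ∀ n : ℕ, GrHom (tpow A n) B (1 - (n : ℤ))
  f_zero : f 0 = 0
  rel : ∀ n : ℕ, 1 ≤ n → insertSum mA.m f n (2 - n) (by ring) = blockSum f mB.m n

theorem wordSplit_one_hom_comp {A : GradedObject ℤ C} (p : ℤ) {q : ℤ} (g : wordObj A [p] ⟶ A q) :
    (wordSplit A [p] []).hom ≫ g ▷ 𝟙_ C = g ≫ (wordOne A q).hom := by
  have h1 : (wordSplit A [p] []).hom = (ρ_ (wordObj A [p])).inv := by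
    simp [wordSplit, wordObj]
  rw [h1]
  exact (rightUnitor_inv_naturality _).symm

theorem insertWord_one {A : GradedObject ℤ C} {r : ℤ} (φ : GrHom (tpow A 1) A r) (p : ℤ) :
    insertWord φ [] [p] [] rfl =
      φ.atWord [p] rfl ([p].sum + r) rfl ≫ (wordOne A ([p].sum + r)).hom := by
  have h0 : ((([] : List ℤ).sum * r).negOnePow : ℤˣ) = 1 := by simp
  rw [insertWord, h0, one_smul]
  refine (congrArg ((λ_ (wordObj A [p])).inv ≫ ·) (leftUnitor_naturality _)).trans ?_
  exact (Iso.inv_hom_id_assoc _ _).trans (wordSplit_one_hom_comp p _)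

theorem blockHom_one {A B : GradedObject ℤ C}
    (f : ∀ i : ℕ, GrHom (tpow A i) B (1 - (i : ℤ))) (p : ℤ) :
    blockHom f [[p]] =
      (f 1).atWord [p] rfl ([p].sum + (1 - (([p].length : ℕ) : ℤ))) rfl ≫
        (wordOne B ([p].sum + (1 - (([p].length : ℕ) : ℤ)))).hom := by
  have h0 : ((([p] : List ℤ).sum *
    (([] : List (List ℤ)).map fun x => 1 - (x.length : ℤ)).sum).negOnePow : ℤˣ) = 1 := by simp
  have h1 : (wordSplit A [p] []).hom = (ρ_ (wordObj A [p])).inv := by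
    simp [wordSplit, wordObj]
  rw [blockHom, h0, one_smul, blockHom]
  refine (congrArg (· ≫ _) h1).trans ?_
  refine (congrArg ((ρ_ (wordObj A [p])).inv ≫ ·) (tensorHom_id _ _)).trans ?_
  exact (rightUnitor_inv_naturality _).symm

theorem GrHom.unary_app {A B : GradedObject ℤ C} {r : ℤ} (φ : GrHom (tpow A 1) B r) (p q : ℤ)
    (h : p + r = q) :
    φ.unary.app p q h = (wordOne A p).hom ≫ φ.atWord [p] rfl q (by simpa using h) :=
  rfl

theorem GrHom.ext_app {M L : GradedObject ℤ C} {r : ℤ} {f g : GrHom M L r}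
    (h : ∀ p q hpq, f.app p q hpq = g.app p q hpq) : f = g :=
  funext fun x => h x.1.1 x.1.2 x.2

theorem unary_comp_insertHom {A B : GradedObject ℤ C} {r s : ℤ} (φ : GrHom (tpow A 1) A r)
    (ψ : GrHom (tpow A 1) B s) (t : ℤ) (h : r + s = t) :
    ((insertHom φ 0 0 1 rfl).comp ψ t h).unary = φ.unary.comp ψ.unary t h := by
  refine GrHom.ext_app fun p q hq => ?_
  have e : p + r = [p].sum + r := by simp
  rw [GrHom.comp_app φ.unary ψ.unary t h p ([p].sum + r) q e (by simp; omega), GrHom.unary_app,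
    GrHom.unary_app, GrHom.unary_app, GrHom.atWord,
    GrHom.comp_app _ ψ t h _ ([p].sum + r) q rfl (by simp; omega)]
  have key : tpowι A [p] rfl rfl ≫ (insertHom φ 0 0 1 rfl).app [p].sum ([p].sum + r) rfl =
      (φ.atWord [p] rfl ([p].sum + r) rfl ≫ (wordOne A ([p].sum + r)).hom) ≫
        tpowι A [[p].sum + r] rfl (by simp) :=
    (tpowι_insertHom φ 0 0 1 rfl [] [p] [] rfl rfl rfl [p].sum ([p].sum + r)
    (by simp) rfl).trans (congrArg (· ≫ _) (insertWord_one φ p))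
  rw [reassoc_of% key, tpowι_app, Category.assoc]

theorem unary_comp_tensorHom {A B E : GradedObject ℤ C}
    (f : ∀ i : ℕ, GrHom (tpow A i) B (1 - (i : ℤ))) {s : ℤ} (ψ : GrHom (tpow B 1) E s) (t : ℤ)
    (h : (((Composition.ones 1).length : ℕ) : ℤ) - (1 : ℕ) + s = t) :
    GrHom.unary ((tensorHom f (Composition.ones 1)).comp ψ t h) =
      (f 1).unary.comp ψ.unary t h := by
  refine GrHom.ext_app fun p q hq => ?_
  have h' : s = t := by rw [← h]; simp
  obtain ⟨p', hp'⟩ : ∃ p', p' = [p].sum + (1 - (([p].length : ℕ) : ℤ)) := ⟨_, rfl⟩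
  have hpp : p' = p := by simp [hp']
  rw [GrHom.comp_app (f 1).unary ψ.unary t h p p' q (by simp [hp']) (by omega), GrHom.unary_app,
    GrHom.unary_app, GrHom.unary_app, GrHom.atWord,
    GrHom.comp_app (tensorHom f (Composition.ones 1)) ψ t h _ p' q (by simp [hp']) (by omega)]
  have key : tpowι A [p] rfl rfl ≫ (tensorHom f (Composition.ones 1)).app [p].sum p'
        (by simp [hp']) =
      ((f 1).atWord [p] rfl p' hp'.symm ≫ (wordOne B p').hom) ≫ tpowι B [p'] rfl (by simp) := by
    subst hp'
    exact (tpowι_tensorHom f (Composition.ones 1) [[p]] rfl [p].sum _ (by simp)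
      (by simp)).trans (congrArg (· ≫ _) (blockHom_one f p))
  refine congrArg ((wordOne A p).hom ≫ ·) ((Category.assoc _ _ _).symm.trans
    (congrArg (· ≫ ψ.app p' q (by omega)) key)) |>.trans ?_
  simp only [Category.assoc, tpowι_app]

/-- The triple `(0, 1, 0)`. -/
def tripleOne : Triple 1 := ⟨(0, 1, 0), by decide⟩

theorem eq_tripleOne (x : Triple 1) : x = tripleOne := by
  revert x
  decide

theorem insertSum_one {A B : GradedObject ℤ C}
    (m : ∀ i : ℕ, GrHom (tpow A i) A (2 - (i : ℤ))) {a : ℤ}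
    (φ : ∀ i : ℕ, GrHom (tpow A i) B (a - (i : ℤ))) (t : ℤ) (h : a + 1 - (1 : ℕ) = t) :
    (insertSum m φ 1 t h).unary = (m 1).unary.comp (φ 1).unary t (by push_cast; omega) := by
  rw [insertSum, Fintype.sum_eq_single tripleOne (fun x hx => absurd (eq_tripleOne x) hx)]
  refine Eq.trans (congrArg GrHom.unary ?_) (unary_comp_insertHom (m 1) (φ 1) t _)
  exact one_smul ℤˣ _

theorem blockSum_one {A B E : GradedObject ℤ C}
    (f : ∀ i : ℕ, GrHom (tpow A i) B (1 - (i : ℤ))) {a : ℤ}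
    (φ : ∀ i : ℕ, GrHom (tpow B i) E (a - (i : ℤ))) :
    (blockSum f φ 1).unary = (f 1).unary.comp (φ 1).unary (a - (1 : ℕ)) (by push_cast; omega) := by
  rw [blockSum, Fintype.sum_eq_single (Composition.ones 1)
    (fun x hx => absurd (Composition.eq_ones_iff.2 fun i hi => by
      have h1 := x.one_le_blocks hi
      have h2 := List.single_le_sum (l := x.blocks) (by simp) i hi
      rw [x.blocks_sum] at h2
      omega) hx)]
  have h0 : blockSign (Composition.ones 1) = 0 := by decide
  rw [h0]
  refine Eq.trans (congrArg GrHom.unary ?_) (unary_comp_tensorHom f (φ 1) _ (by simp))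
  exact one_smul ℤˣ _

theorem AInfStructure.m_one_comp_m_one {A : GradedObject ℤ C} (mA : AInfStructure A)
    (i j k : ℤ) (hij : i + 1 = j) (hjk : j + 1 = k) :
    (mA.m 1).unary.app i j (by simpa using hij) ≫ (mA.m 1).unary.app j k (by simpa using hjk) =
      0 := by
  have h := congrArg GrHom.unary (mA.rel 1 le_rfl)
  rw [insertSum_one] at h
  rw [← GrHom.comp_app _ _ (3 - (1 : ℕ)) (by norm_num) i j k, h]
  exact (congrArg ((wordOne A i).hom ≫ ·) comp_zero).trans comp_zero

/-- The complex `(A, m₁)`. -/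
noncomputable def AInfStructure.complex {A : GradedObject ℤ C} (mA : AInfStructure A) :
    CochainComplex C ℤ where
  X := A
  d i j := if h : i + 1 = j then (mA.m 1).unary.app i j (by simpa using h) else 0
  shape i j h := dif_neg h
  d_comp_d' i j k hij hjk := by
    have hij' : i + 1 = j := hij
    have hjk' : j + 1 = k := hjk
    rw [dif_pos hij', dif_pos hjk']
    exact mA.m_one_comp_m_one i j k hij' hjk'

/-- The morphism of complexes `f₁ : (A, m₁) ⟶ (B, m₁)` of an `A_∞`-morphism `f`. -/
noncomputable def AInfHom.linear {A B : GradedObject ℤ C} {mA : AInfStructure A}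
    {mB : AInfStructure B} (f : AInfHom mA mB) : mA.complex ⟶ mB.complex where
  f i := (f.f 1).unary.app i i (by simp)
  comm' i j hij := by
    have hij' : i + 1 = j := hij
    have h := congrArg GrHom.unary (f.rel 1 le_rfl)
    rw [insertSum_one, blockSum_one] at h
    have h1 := congrArg (fun g => g.app i j (by simpa using hij')) h
    rw [GrHom.comp_app _ _ (2 - (1 : ℕ)) _ i j j (by simpa using hij') (by simp),
      GrHom.comp_app _ _ (2 - (1 : ℕ)) _ i i j (by simp) (by simpa using hij')] at h1
    simp only [AInfStructure.complex, dif_pos hij']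
    exact h1.symm

/-- `f` is an `A_∞`-quasi-isomorphism: `f₁` is a quasi-isomorphism of complexes. -/
def AInfHom.IsQuasiIso {A B : GradedObject ℤ C} [CategoryWithHomology C] {mA : AInfStructure A}
    {mB : AInfStructure B} (f : AInfHom mA mB) : Prop :=
  QuasiIso f.linear

/-- The `A_∞`-structure is minimal: `m₁ = 0`. -/
def AInfStructure.IsMinimal {A : GradedObject ℤ C} (mA : AInfStructure A) : Prop :=
  mA.m 1 = 0

/-- The components `(g f)ₙ = ∑ (-1)^s gᵣ (f_{i₁} ⊗ ⋯ ⊗ f_{iᵣ})` of the composition. -/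
noncomputable def AInfHom.compFun {A B E : GradedObject ℤ C} {mA : AInfStructure A}
    {mB : AInfStructure B} {mE : AInfStructure E} (f : AInfHom mA mB) (g : AInfHom mB mE) (n : ℕ) :
    GrHom (tpow A n) E (1 - (n : ℤ)) :=
  blockSum f.f g.f n

/-- The family `φ` consists of the components of the identity `A_∞`-morphism: `φ₁ = 1` and
`φₙ = 0` for `n ≥ 2`. -/
def IsIdentity {A : GradedObject ℤ C} (φ : ∀ n : ℕ, GrHom (tpow A n) A (1 - (n : ℤ))) : Prop :=
  (∀ p : ℤ, (φ 1).unary.app p p (by simp) = 𝟙 (A p)) ∧ ∀ n : ℕ, 2 ≤ n → φ n = 0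

/-- `f` is an isomorphism of `A_∞`-algebras: it has a two-sided inverse. -/
def AInfHom.IsIsomorphism {A B : GradedObject ℤ C} {mA : AInfStructure A} {mB : AInfStructure B}
    (f : AInfHom mA mB) : Prop :=
  ∃ g : AInfHom mB mA, IsIdentity (f.compFun g) ∧ IsIdentity (g.compFun f)

section Homology

variable [CategoryWithHomology C] {A : GradedObject ℤ C} (mA : AInfStructure A)

/-- The graded object `H^* A`, the homology of `(A, m₁)`. -/
noncomputable def AInfStructure.homology : GradedObject ℤ C :=
  fun i => mA.complex.homology i

/-- The inclusion `Z^i A → A^i` of the cycles. -/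
noncomputable def AInfStructure.cyclesι (i : ℤ) : mA.complex.cycles i ⟶ A i :=
  mA.complex.iCycles i

/-- The projection `Z^i A → H^i A`. -/
noncomputable def AInfStructure.cyclesπ (i : ℤ) : mA.complex.cycles i ⟶ mA.homology i :=
  mA.complex.homologyπ i

/-- The second operation of an `A_∞`-structure on `H^* A` is induced by `m₂` of `A`: on cycles `m₂`
takes values in cycles, and it descends to the given operation on classes. -/
def AInfStructure.InducesProduct (mH : AInfStructure mA.homology) : Prop :=
  ∀ p q : ℤ, ∃ z : mA.complex.cycles p ⊗ mA.complex.cycles q ⟶ mA.complex.cycles (p + q),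
    z ≫ mA.cyclesι (p + q) =
        (mA.cyclesι p ⊗ₘ mA.cyclesι q) ≫ (mA.m 2).binary p q (p + q) (by simp) ∧
      (mA.cyclesπ p ⊗ₘ mA.cyclesπ q) ≫ (mH.m 2).binary p q (p + q) (by simp) =
        z ≫ mA.cyclesπ (p + q)

/-- The `A_∞`-morphism `f : H^* A → A` lifts the identity of `H^* A`: `f₁` sends each class to a
cycle that represents it. -/
def AInfHom.LiftsIdentity {mA : AInfStructure A} {mH : AInfStructure mA.homology}
    (f : AInfHom mH mA) : Prop :=
  ∀ p : ℤ, ∃ z : mA.homology p ⟶ mA.complex.cycles p,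
    z ≫ mA.cyclesι p = (f.f 1).unary.app p p (by simp) ∧ z ≫ mA.cyclesπ p = 𝟙 (mA.homology p)

end Homology

end Structures

end AInfinity

/-! The proof passes to the bar construction. Let `bar A` be the sum of the objects of all words,
with deconcatenation as coproduct, graded by the sum of the letters minus the length. After a sign
twist (`shiftExp`), a family of operations becomes a single homogeneous map `bar A ⟶ tot A`. The
operations `mₙ` become a map `b` of degree 1, and the A∞-relations become `D b = 0`, where D =
`barDer b` is the coderivation that extends `b`. A family `fₙ` becomes a map `f` of degree 0, and
its relations become `D f = F b`, where F = `barHom f` is the coalgebra morphism that extends `f`.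
(Composites are written in diagrammatic order.) `hat_insertSum` and `hat_blockSum` carry this
dictionary and absorb all signs.

Coalgebra maps and coderivations are handled in the convolution ring of maps `bar A ⟶ bar B`. There
F is the geometric series (1 - f)⁻¹, and a coderivation along F, G with corestriction k is the
product F k G. Vanishing on words of length less than n defines a complete decreasing filtration of
this ring. Recursive equations are solved by a contraction argument (`exists_fixedPoint`), and an
error term vanishes once it can be pushed arbitrarily far into the filtration
(`eq_zero_of_mem_barFil`). The engine is that F ≡ 1 in positive filtration, so F k G has the same
leading term as k.

Existence (`exists_transfer`): given `g`, `p`, `h` with pg = 1 + mh + hm, write b₂ for the part of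
`b` without `m₁`. The fixed point f = g + (F b₂)h, together with c = d + (F b₂)p, defines the
morphism and the structure. The defect D f - F b satisfies a homogeneous contracting equation, so it
is zero. This gives (1) directly. For (2), semisimplicity splits (A, m₁) into homology and a
contractible part, and the transfer is applied with d = 0. That m₂ is the induced product is read
off on words with two letters.

Uniqueness (`exists_lift`, `exists_inverse`): given f and f' from two minimal structures to A, a
fixed point produces a morphism φ between the sources together with a homotopy from φ followed by f'
to f. The failure of φ to be an A∞-morphism and the failure of the homotopy equation are removed by
one simultaneous induction along the filtration. The linear part of φ is invertible. Applying the
same lifting result with zero homotopy inverts φ strictly. -/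

namespace AInfinity


/-! ### Maps out of the image of a coproduct -/

section Coproducts

variable {C : Type*} [Category* C] {D : Type*} [Category* D] {J : Type} [HasCoproductsOfShape J C]

/-- The morphism out of the image of a coproduct under a functor that preserves it. -/
noncomputable def mapSigmaDesc (F : C ⥤ D) [PreservesColimitsOfShape (Discrete J) F] (X : J → C)
    {Y : D} (φ : ∀ j, F.obj (X j) ⟶ Y) : F.obj (∐ X) ⟶ Y :=
  Cofan.IsColimit.desc (isColimitCofanMkObjOfIsColimit F X _ (coproductIsCoproduct X)) φ

theorem map_ι_mapSigmaDesc (F : C ⥤ D) [PreservesColimitsOfShape (Discrete J) F] (X : J → C)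
    {Y : D} (φ : ∀ j, F.obj (X j) ⟶ Y) (j : J) :
    F.map (Sigma.ι X j) ≫ mapSigmaDesc F X φ = φ j :=
  Cofan.IsColimit.fac (isColimitCofanMkObjOfIsColimit F X _ (coproductIsCoproduct X)) φ j

theorem mapSigma_hom_ext (F : C ⥤ D) [PreservesColimitsOfShape (Discrete J) F] (X : J → C)
    {Y : D} {f g : F.obj (∐ X) ⟶ Y}
    (h : ∀ j, F.map (Sigma.ι X j) ≫ f = F.map (Sigma.ι X j) ≫ g) : f = g :=
  Cofan.IsColimit.hom_ext (isColimitCofanMkObjOfIsColimit F X _ (coproductIsCoproduct X)) _ _ h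

end Coproducts

/-- Tensoring with an object preserves coproducts. -/
class TensorPreservesCoproducts (C : Type u) [Category.{v} C] [MonoidalCategory C] : Prop where
  left : ∀ (J : Type) (X : C), PreservesColimitsOfShape (Discrete J) (tensorLeft X)
  right : ∀ (J : Type) (X : C), PreservesColimitsOfShape (Discrete J) (tensorRight X)

attribute [instance] TensorPreservesCoproducts.left TensorPreservesCoproducts.right

/-! ### The bar construction and concatenation of words -/

section Bar

variable {C : Type u} [Category.{v} C] [MonoidalCategory C] [HasCoproducts.{0} C]

/-- The total tensor algebra `⨁ A^{⊗ n}`, the sum of the objects of all words. -/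
noncomputable def bar (A : GradedObject ℤ C) : C := ∐ fun w : List ℤ => wordObj A w

/-- The inclusion of the summand of a word. -/
noncomputable def barι (A : GradedObject ℤ C) (w : List ℤ) : wordObj A w ⟶ bar A :=
  Sigma.ι (fun w : List ℤ => wordObj A w) w

/-- The morphism out of `bar A` with given restrictions. -/
noncomputable def barDesc {A : GradedObject ℤ C} {Y : C} (φ : ∀ w, wordObj A w ⟶ Y) : bar A ⟶ Y :=
  Sigma.desc φ

@[simp]
theorem barι_barDesc {A : GradedObject ℤ C} {Y : C} (φ : ∀ w, wordObj A w ⟶ Y) (w : List ℤ) :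
    barι A w ≫ barDesc φ = φ w :=
  Sigma.ι_desc _ _

theorem bar_ext {A : GradedObject ℤ C} {Y : C} {f g : bar A ⟶ Y}
    (h : ∀ w, barι A w ≫ f = barι A w ≫ g) : f = g :=
  Sigma.hom_ext _ _ h

/-- The object of the empty word is the unit. -/
def wordNil (A : GradedObject ℤ C) : 𝟙_ C ≅ wordObj A [] := Iso.refl _

/-- The object of a word with first letter `p`. -/
def wordCons (A : GradedObject ℤ C) (p : ℤ) (w : List ℤ) :
    A p ⊗ wordObj A w ≅ wordObj A (p :: w) := Iso.refl _

/-- The inclusion of the summand of the empty word. -/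
noncomputable def nilMap (A : GradedObject ℤ C) : 𝟙_ C ⟶ bar A := (wordNil A).hom ≫ barι A []

theorem barι_nil (A : GradedObject ℤ C) : barι A [] = (wordNil A).inv ≫ nilMap A := by
  simp [nilMap]

variable [TensorPreservesCoproducts C]

theorem whiskerLeft_bar_ext {A : GradedObject ℤ C} {X Y : C} {f g : X ⊗ bar A ⟶ Y}
    (h : ∀ w, X ◁ barι A w ≫ f = X ◁ barι A w ≫ g) : f = g :=
  mapSigma_hom_ext (tensorLeft X) _ h

theorem bar_whiskerRight_ext {A : GradedObject ℤ C} {X Y : C} {f g : bar A ⊗ X ⟶ Y}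
    (h : ∀ w, barι A w ▷ X ≫ f = barι A w ▷ X ≫ g) : f = g :=
  mapSigma_hom_ext (tensorRight X) _ h

theorem whiskerLeft_bar_whiskerRight_ext {A : GradedObject ℤ C} {X X' Y : C}
    {f g : (X ⊗ bar A) ⊗ X' ⟶ Y}
    (h : ∀ w, (X ◁ barι A w) ▷ X' ≫ f = (X ◁ barι A w) ▷ X' ≫ g) : f = g :=
  mapSigma_hom_ext (tensorLeft X ⋙ tensorRight X') _ h

/-- Adding a letter in front of a word. -/
noncomputable def consMap (A : GradedObject ℤ C) (p : ℤ) : A p ⊗ bar A ⟶ bar A :=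
  mapSigmaDesc (tensorLeft (A p)) (fun w : List ℤ => wordObj A w)
    fun w => (wordCons A p w).hom ≫ barι A (p :: w)

theorem whiskerLeft_barι_consMap (A : GradedObject ℤ C) (p : ℤ) (w : List ℤ) :
    A p ◁ barι A w ≫ consMap A p = (wordCons A p w).hom ≫ barι A (p :: w) :=
  map_ι_mapSigmaDesc (tensorLeft (A p)) (fun w : List ℤ => wordObj A w) _ w

theorem barι_cons (A : GradedObject ℤ C) (p : ℤ) (w : List ℤ) :
    barι A (p :: w) = (wordCons A p w).inv ≫ A p ◁ barι A w ≫ consMap A p := by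
  simp [whiskerLeft_barι_consMap]

/-- Concatenation with a fixed word on the left. -/
noncomputable def mulWord (A : GradedObject ℤ C) : ∀ u : List ℤ, wordObj A u ⊗ bar A ⟶ bar A
  | [] => (wordNil A).inv ▷ bar A ≫ (λ_ (bar A)).hom
  | p :: u => (wordCons A p u).inv ▷ bar A ≫ (α_ (A p) (wordObj A u) (bar A)).hom ≫
      A p ◁ mulWord A u ≫ consMap A p

/-- Concatenation of words. -/
noncomputable def barMul (A : GradedObject ℤ C) : bar A ⊗ bar A ⟶ bar A :=
  mapSigmaDesc (tensorRight (bar A)) (fun w : List ℤ => wordObj A w) (mulWord A)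

@[simp]
theorem barι_whiskerRight_barMul (A : GradedObject ℤ C) (u : List ℤ) :
    barι A u ▷ bar A ≫ barMul A = mulWord A u :=
  map_ι_mapSigmaDesc (tensorRight (bar A)) (fun w : List ℤ => wordObj A w) _ u

theorem nilMap_whiskerRight_barMul (A : GradedObject ℤ C) :
    nilMap A ▷ bar A ≫ barMul A = (λ_ (bar A)).hom := by
  simp [nilMap, mulWord, hom_inv_whiskerRight_assoc]

theorem consMap_whiskerRight_barMul (A : GradedObject ℤ C) (p : ℤ) :
    consMap A p ▷ bar A ≫ barMul A =
      (α_ _ _ _).hom ≫ A p ◁ barMul A ≫ consMap A p := by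
  refine whiskerLeft_bar_whiskerRight_ext fun w => ?_
  rw [← comp_whiskerRight_assoc, whiskerLeft_barι_consMap, comp_whiskerRight_assoc,
    barι_whiskerRight_barMul, associator_naturality_middle_assoc,
    ← MonoidalCategory.whiskerLeft_comp_assoc, barι_whiskerRight_barMul, mulWord,
    hom_inv_whiskerRight_assoc]

/-- Induction on the leftmost word: prefixing a letter commutes with multiplication on the right
(`consMap_whiskerRight_barMul`), and only coherence isomorphisms remain. -/
theorem barMul_assoc (A : GradedObject ℤ C) :
    barMul A ▷ bar A ≫ barMul A = (α_ _ _ _).hom ≫ bar A ◁ barMul A ≫ barMul A := by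
  have key : ∀ u : List ℤ, mulWord A u ▷ bar A ≫ barMul A =
      (α_ _ _ _).hom ≫ wordObj A u ◁ barMul A ≫ mulWord A u := by
    intro u
    induction u with
    | nil =>
      rw [mulWord, comp_whiskerRight_assoc, whisker_exchange_assoc]
      simp
    | cons p u ih =>
      simp only [mulWord, comp_whiskerRight, Category.assoc, consMap_whiskerRight_barMul]
      rw [associator_naturality_middle_assoc, ← MonoidalCategory.whiskerLeft_comp_assoc, ih,
        whisker_exchange_assoc]
      simp
  have : ∀ w : List ℤ, (barι A w ▷ bar A) ▷ bar A ≫ barMul A ▷ bar A ≫ barMul A =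
      (barι A w ▷ bar A) ▷ bar A ≫ (α_ _ _ _).hom ≫ bar A ◁ barMul A ≫ barMul A := by
    intro w
    rw [← comp_whiskerRight_assoc, barι_whiskerRight_barMul, key, associator_naturality_left_assoc,
      ← whisker_exchange_assoc, barι_whiskerRight_barMul]
  exact mapSigma_hom_ext (tensorRight (bar A) ⋙ tensorRight (bar A)) _ this

theorem whiskerLeft_nilMap_barMul (A : GradedObject ℤ C) :
    bar A ◁ nilMap A ≫ barMul A = (ρ_ (bar A)).hom := by
  have key : ∀ u : List ℤ,
      wordObj A u ◁ nilMap A ≫ mulWord A u = (ρ_ (wordObj A u)).hom ≫ barι A u := by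
    intro u
    induction u with
    | nil =>
      rw [mulWord, whisker_exchange_assoc]
      simp [barι_nil, unitors_equal]
    | cons p u ih =>
      rw [mulWord, whisker_exchange_assoc, associator_naturality_right_assoc,
        ← MonoidalCategory.whiskerLeft_comp_assoc, ih, barι_cons]
      simp
  refine bar_whiskerRight_ext fun u => ?_
  rw [← whisker_exchange_assoc, barι_whiskerRight_barMul, key]
  simp

end Bar

/-! ### Deconcatenation, counit and coassociativity -/

section Comul

variable {C : Type u} [Category.{v} C] [MonoidalCategory C] [HasCoproducts.{0} C]
  [TensorPreservesCoproducts C] [Preadditive C]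

/-- Tensoring with the empty word on the left. -/
noncomputable def nilTensor (A : GradedObject ℤ C) (Y : C) : Y ⟶ bar A ⊗ Y :=
  (λ_ Y).inv ≫ nilMap A ▷ Y

theorem nilTensor_naturality (A : GradedObject ℤ C) {Y Z : C} (f : Y ⟶ Z) :
    nilTensor A Y ≫ bar A ◁ f = f ≫ nilTensor A Z := by
  simp [nilTensor, ← whisker_exchange]

theorem nilTensor_whiskerRight (A : GradedObject ℤ C) (Y W : C) :
    nilTensor A Y ▷ W ≫ (α_ _ _ _).hom = nilTensor A (Y ⊗ W) := by
  simp [nilTensor]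

/-- Deconcatenation on the summand of a word. -/
noncomputable def comulWord (A : GradedObject ℤ C) : ∀ w : List ℤ, wordObj A w ⟶ bar A ⊗ bar A
  | [] => barι A [] ≫ nilTensor A _
  | p :: w => barι A (p :: w) ≫ nilTensor A _ +
      (wordCons A p w).inv ≫ A p ◁ comulWord A w ≫ (α_ (A p) (bar A) (bar A)).inv ≫
        consMap A p ▷ bar A

/-- Deconcatenation of words. -/
noncomputable def barComul (A : GradedObject ℤ C) : bar A ⟶ bar A ⊗ bar A :=
  barDesc (comulWord A)

@[simp]
theorem barι_barComul (A : GradedObject ℤ C) (w : List ℤ) :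
    barι A w ≫ barComul A = comulWord A w := by
  simp [barComul]

/-- The projection to the summand of the empty word. -/
noncomputable def barCounit (A : GradedObject ℤ C) : bar A ⟶ 𝟙_ C :=
  barDesc fun w => match w with
    | [] => (wordNil A).inv
    | _ :: _ => 0

@[simp]
theorem nilMap_barCounit (A : GradedObject ℤ C) : nilMap A ≫ barCounit A = 𝟙 (𝟙_ C) := by
  simp [nilMap, barCounit]

@[simp]
theorem barι_cons_barCounit (A : GradedObject ℤ C) (p : ℤ) (w : List ℤ) :
    barι A (p :: w) ≫ barCounit A = 0 :=
  barι_barDesc _ _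

theorem nilMap_barComul (A : GradedObject ℤ C) :
    nilMap A ≫ barComul A = nilMap A ≫ nilTensor A _ := by
  rw [nilMap, Category.assoc, barι_barComul, comulWord, Category.assoc]

theorem nilTensor_barComul (A : GradedObject ℤ C) :
    nilTensor A _ ≫ barComul A ▷ bar A ≫ (α_ _ _ _).hom =
      nilTensor A _ ≫ nilTensor A _ := by
  conv_lhs => rw [nilTensor, Category.assoc, ← comp_whiskerRight_assoc, nilMap_barComul,
    comp_whiskerRight_assoc, nilTensor_whiskerRight]
  conv_rhs => rw [nilTensor, Category.assoc]

variable [MonoidalPreadditive C]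

@[simp]
theorem consMap_barCounit (A : GradedObject ℤ C) (p : ℤ) : consMap A p ≫ barCounit A = 0 :=
  whiskerLeft_bar_ext fun w => by
    rw [reassoc_of% whiskerLeft_barι_consMap]
    simp

/-- A cut of a word that begins with p lies either before p or after it. This recursion replaces the
sum over all cuts in the inductions on words. -/
theorem consMap_barComul (A : GradedObject ℤ C) (p : ℤ) :
    consMap A p ≫ barComul A = consMap A p ≫ nilTensor A _ +
      A p ◁ barComul A ≫ (α_ (A p) (bar A) (bar A)).inv ≫ consMap A p ▷ bar A := by
  refine whiskerLeft_bar_ext fun w => ?_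
  rw [reassoc_of% whiskerLeft_barι_consMap, barι_barComul, Preadditive.comp_add,
    ← MonoidalCategory.whiskerLeft_comp_assoc, barι_barComul, comulWord, barι_cons]
  simp

/-- Two morphisms out of `bar A` agree on all words if they agree on the empty word and the
equality on words is inherited from a word to its extensions. -/
theorem bar_induction {A : GradedObject ℤ C} {Y : C} {f g : bar A ⟶ Y}
    (h0 : nilMap A ≫ f = nilMap A ≫ g)
    (h : ∀ p w, barι A w ≫ f = barι A w ≫ g →
      A p ◁ barι A w ≫ consMap A p ≫ f = A p ◁ barι A w ≫ consMap A p ≫ g) : f = g := by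
  refine bar_ext fun w => ?_
  induction w with
  | nil => rw [barι_nil, Category.assoc, h0, Category.assoc]
  | cons p w ih => simp only [barι_cons, Category.assoc, h p w ih]

theorem barComul_counit_left (A : GradedObject ℤ C) :
    barComul A ≫ barCounit A ▷ bar A = (λ_ (bar A)).inv := by
  refine bar_induction ?_ fun p w _ => congrArg (A p ◁ barι A w ≫ ·) ?_
  · rw [reassoc_of% nilMap_barComul, nilTensor, Category.assoc, ← comp_whiskerRight,
      nilMap_barCounit]
    simp
  · rw [reassoc_of% consMap_barComul, Preadditive.add_comp]
    simp [nilTensor, ← comp_whiskerRight]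

theorem barComul_counit_right (A : GradedObject ℤ C) :
    barComul A ≫ bar A ◁ barCounit A = (ρ_ (bar A)).inv := by
  refine bar_induction ?_ fun p w ih => ?_
  · rw [reassoc_of% nilMap_barComul, nilTensor_naturality, reassoc_of% nilMap_barCounit]
    simp [nilTensor, unitors_inv_equal]
  · rw [reassoc_of% consMap_barComul, Preadditive.add_comp, Category.assoc,
      nilTensor_naturality, reassoc_of% consMap_barCounit, zero_comp, zero_add, Category.assoc,
      Category.assoc, ← whisker_exchange, ← associator_inv_naturality_right_assoc,
      ← MonoidalCategory.whiskerLeft_comp_assoc, ← MonoidalCategory.whiskerLeft_comp_assoc,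
      Category.assoc, ih]
    simp

/-- In the inductive step, the terms with an empty first factor agree by naturality of `nilTensor`.
The remaining ones are the induction hypothesis with a letter put in front. -/
theorem barComul_coassoc (A : GradedObject ℤ C) :
    barComul A ≫ barComul A ▷ bar A ≫ (α_ _ _ _).hom = barComul A ≫ bar A ◁ barComul A := by
  refine bar_induction ?_ fun p w ih => ?_
  · rw [reassoc_of% nilMap_barComul, nilTensor_barComul, reassoc_of% nilMap_barComul,
      nilTensor_naturality, reassoc_of% nilMap_barComul]
  · have ih' := congrArg (fun k => A p ◁ k ≫ (α_ _ _ _).inv ≫ consMap A p ▷ _) ih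
    simp only [MonoidalCategory.whiskerLeft_comp, Category.assoc] at ih'
    rw [reassoc_of% consMap_barComul, reassoc_of% consMap_barComul]
    simp only [Preadditive.add_comp, Preadditive.comp_add, Category.assoc]
    rw [← comp_whiskerRight_assoc, consMap_barComul, ← whisker_exchange,
      ← associator_inv_naturality_right_assoc, ← ih', nilTensor_barComul, nilTensor_naturality,
      reassoc_of% consMap_barComul]
    simp only [Preadditive.add_comp, Preadditive.comp_add, Category.assoc,
      MonoidalPreadditive.add_whiskerRight, comp_whiskerRight, nilTensor_whiskerRight]
    simp [add_assoc]

end Comul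

/-! ### The convolution ring -/

section Convolution

variable {C : Type u} [Category.{v} C] [MonoidalCategory C] [HasCoproducts.{0} C]
  [TensorPreservesCoproducts C] [Preadditive C] [MonoidalPreadditive C]

/-- The pairing `Δ ≫ (M ⊗ N)` of two morphisms out of `bar A`. -/
noncomputable def comulPair {A : GradedObject ℤ C} {Y Z : C} (M : bar A ⟶ Y) (N : bar A ⟶ Z) :
    bar A ⟶ Y ⊗ Z :=
  barComul A ≫ (M ⊗ₘ N)

section

variable {A : GradedObject ℤ C} {Y Z Y' Z' : C}

theorem comulPair_comp_tensor (M : bar A ⟶ Y) (N : bar A ⟶ Z) (f : Y ⟶ Y') (g : Z ⟶ Z') :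
    comulPair M N ≫ (f ⊗ₘ g) = comulPair (M ≫ f) (N ≫ g) := by
  simp [comulPair]

theorem comulPair_comp_whiskerRight (M : bar A ⟶ Y) (N : bar A ⟶ Z) (f : Y ⟶ Y') :
    comulPair M N ≫ f ▷ Z = comulPair (M ≫ f) N := by
  rw [← tensorHom_id, comulPair_comp_tensor, Category.comp_id]

theorem comulPair_comp_whiskerLeft (M : bar A ⟶ Y) (N : bar A ⟶ Z) (g : Z ⟶ Z') :
    comulPair M N ≫ Y ◁ g = comulPair M (N ≫ g) := by
  rw [← id_tensorHom, comulPair_comp_tensor, Category.comp_id]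

theorem comulPair_add_left (M M' : bar A ⟶ Y) (N : bar A ⟶ Z) :
    comulPair (M + M') N = comulPair M N + comulPair M' N := by
  simp [comulPair, MonoidalPreadditive.add_tensor]

theorem comulPair_add_right (M : bar A ⟶ Y) (N N' : bar A ⟶ Z) :
    comulPair M (N + N') = comulPair M N + comulPair M N' := by
  simp [comulPair, MonoidalPreadditive.tensor_add]

theorem comulPair_zero_left (N : bar A ⟶ Z) : comulPair (0 : bar A ⟶ Y) N = 0 := by
  simp [comulPair]

theorem comulPair_zero_right (M : bar A ⟶ Y) : comulPair M (0 : bar A ⟶ Z) = 0 := by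
  simp [comulPair]

theorem comulPair_assoc {W : C} (M : bar A ⟶ Y) (N : bar A ⟶ Z) (P : bar A ⟶ W) :
    comulPair (comulPair M N) P ≫ (α_ _ _ _).hom = comulPair M (comulPair N P) := by
  have h1 : comulPair M N ⊗ₘ P = barComul A ▷ bar A ≫ ((M ⊗ₘ N) ⊗ₘ P) := by
    rw [comulPair, ← tensorHom_id, tensorHom_comp_tensorHom, Category.id_comp]
  have h2 : M ⊗ₘ comulPair N P = bar A ◁ barComul A ≫ (M ⊗ₘ (N ⊗ₘ P)) := by
    rw [comulPair, ← id_tensorHom, tensorHom_comp_tensorHom, Category.id_comp]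
  rw [comulPair, h1, comulPair, h2, Category.assoc, Category.assoc, associator_naturality,
    reassoc_of% barComul_coassoc]

theorem comulPair_counit_left (u : 𝟙_ C ⟶ Y) (N : bar A ⟶ Z) :
    comulPair (barCounit A ≫ u) N = N ≫ (λ_ Z).inv ≫ u ▷ Z := by
  rw [comulPair, MonoidalCategory.tensorHom_def, comp_whiskerRight_assoc,
    reassoc_of% barComul_counit_left, ← whisker_exchange, ← leftUnitor_inv_naturality_assoc]

theorem comulPair_counit_right (M : bar A ⟶ Y) (u : 𝟙_ C ⟶ Z) :
    comulPair M (barCounit A ≫ u) = M ≫ (ρ_ Y).inv ≫ Y ◁ u := by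
  rw [comulPair, MonoidalCategory.tensorHom_def', MonoidalCategory.whiskerLeft_comp_assoc,
    reassoc_of% barComul_counit_right, whisker_exchange, ← rightUnitor_inv_naturality_assoc]

end

variable {A B E : GradedObject ℤ C}

/-- The convolution product of two morphisms `bar A ⟶ bar B`. -/
noncomputable instance : Mul (bar A ⟶ bar B) where
  mul M N := comulPair M N ≫ barMul B

noncomputable instance : One (bar A ⟶ bar B) where
  one := barCounit A ≫ nilMap B

theorem conv_eq (M N : bar A ⟶ bar B) : M * N = comulPair M N ≫ barMul B := rfl

theorem convOne_eq : (1 : bar A ⟶ bar B) = barCounit A ≫ nilMap B := rfl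

/-- The convolution ring of morphisms `bar A ⟶ bar B`. -/
noncomputable instance : Ring (bar A ⟶ bar B) :=
  { (inferInstance : AddCommGroup (bar A ⟶ bar B)) with
    mul_assoc := fun M N P => by
      simp only [conv_eq]
      rw [← comulPair_comp_whiskerRight, Category.assoc, barMul_assoc,
        reassoc_of% comulPair_assoc, reassoc_of% comulPair_comp_whiskerLeft]
    one_mul := fun M => by
      rw [conv_eq, convOne_eq, comulPair_counit_left, Category.assoc, Category.assoc,
        nilMap_whiskerRight_barMul, Iso.inv_hom_id, Category.comp_id]
    mul_one := fun M => by
      rw [conv_eq, convOne_eq, comulPair_counit_right, Category.assoc, Category.assoc,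
        whiskerLeft_nilMap_barMul, Iso.inv_hom_id, Category.comp_id]
    left_distrib := fun M N P => by
      simp only [conv_eq, comulPair_add_right, Preadditive.add_comp]
    right_distrib := fun M N P => by
      simp only [conv_eq, comulPair_add_left, Preadditive.add_comp]
    zero_mul := fun M => by rw [conv_eq, comulPair_zero_left, zero_comp]
    mul_zero := fun M => by rw [conv_eq, comulPair_zero_right, zero_comp] }

end Convolution

/-! ### Explicit cuts, the length filtration and fixed points -/

section Words

variable {C : Type u} [Category.{v} C] [MonoidalCategory C]

/-- The splitting of the object of a word `w = u ++ v`. -/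
def wordSplitOf (A : GradedObject ℤ C) {u v w : List ℤ} (h : u ++ v = w) :
    wordObj A w ⟶ wordObj A u ⊗ wordObj A v :=
  eqToHom (by rw [h]) ≫ (wordSplit A u v).hom

theorem wordSplit_nil_hom (A : GradedObject ℤ C) (v : List ℤ) :
    (wordSplit A [] v).hom = (λ_ _).inv ≫ (wordNil A).hom ▷ _ := by
  simp [wordSplit, wordNil, wordObj]

theorem wordSplit_cons_hom (A : GradedObject ℤ C) (p : ℤ) (u v : List ℤ) :
    (wordSplit A (p :: u) v).hom = (wordCons A p (u ++ v)).inv ≫ A p ◁ (wordSplit A u v).hom ≫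
      (α_ _ _ _).inv ≫ (wordCons A p u).hom ▷ _ := by
  simp [wordSplit, wordCons, wordObj]

theorem wordSplit_cons_inv (A : GradedObject ℤ C) (p : ℤ) (u v : List ℤ) :
    (wordSplit A (p :: u) v).inv = (wordCons A p u).inv ▷ _ ≫ (α_ _ _ _).hom ≫
      A p ◁ (wordSplit A u v).inv ≫ (wordCons A p (u ++ v)).hom := by
  simp [wordSplit, wordCons, wordObj]

theorem wordSplit_nil_inv (A : GradedObject ℤ C) (v : List ℤ) :
    (wordSplit A [] v).inv = (wordNil A).inv ▷ _ ≫ (λ_ _).hom := by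
  simp [wordSplit, wordNil, wordObj]

variable [HasCoproducts.{0} C] [TensorPreservesCoproducts C]

theorem barι_tensor_barι_barMul (A : GradedObject ℤ C) (u v : List ℤ) :
    (barι A u ⊗ₘ barι A v) ≫ barMul A = (wordSplit A u v).inv ≫ barι A (u ++ v) := by
  rw [MonoidalCategory.tensorHom_def', Category.assoc, barι_whiskerRight_barMul]
  induction u with
  | nil =>
    rw [wordSplit_nil_inv, mulWord, whisker_exchange_assoc]
    simp
  | cons p u ih =>
    rw [wordSplit_cons_inv, mulWord, whisker_exchange_assoc, associator_naturality_right_assoc,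
      ← MonoidalCategory.whiskerLeft_comp_assoc, ih]
    simp [whiskerLeft_barι_consMap]

variable [Preadditive C] [MonoidalPreadditive C]

/-- Unrolling the recursive definition of deconcatenation gives one summand for each position of the
cut. Filtration, degree and sign arguments all use this form. -/
theorem barι_barComul_eq_sum (A : GradedObject ℤ C) (w : List ℤ) :
    barι A w ≫ barComul A = ∑ i ∈ Finset.range (w.length + 1),
      wordSplitOf A (List.take_append_drop i w) ≫ (barι A (w.take i) ⊗ₘ barι A (w.drop i)) := by
  have h0 : ∀ {u v w : List ℤ} (h : u ++ v = w), u = [] →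
      wordSplitOf A h ≫ (barι A u ⊗ₘ barι A v) = barι A w ≫ nilTensor A _ := by
    rintro u v _ rfl rfl
    rw [wordSplitOf, eqToHom_refl, Category.id_comp, wordSplit_nil_hom]
    rw [nilTensor, leftUnitor_inv_naturality_assoc, barι_nil, whisker_exchange,
      MonoidalCategory.tensorHom_def, comp_whiskerRight]
    simp
  have h1 : ∀ {p : ℤ} {u u' v w : List ℤ} (h : u' ++ v = p :: w) (h' : u ++ v = w),
      u' = p :: u → wordSplitOf A h ≫ (barι A u' ⊗ₘ barι A v) =
        (wordCons A p w).inv ≫ A p ◁ (wordSplitOf A h' ≫ (barι A u ⊗ₘ barι A v)) ≫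
          (α_ _ _ _).inv ≫ consMap A p ▷ bar A := by
    rintro p u _ v _ h rfl rfl
    rw [wordSplitOf, eqToHom_refl, Category.id_comp, wordSplit_cons_hom, wordSplitOf,
      eqToHom_refl, Category.id_comp, barι_cons]
    simp only [Category.assoc, comp_whiskerRight, MonoidalCategory.tensorHom_def,
      hom_inv_whiskerRight_assoc, MonoidalCategory.whiskerLeft_comp,
      associator_inv_naturality_right_assoc, whisker_exchange]
    simp
  rw [barι_barComul]
  induction w with
  | nil => simp [h0, comulWord]
  | cons p w ih =>
    rw [comulWord, List.length_cons, Finset.sum_range_succ',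
      h0 (List.take_append_drop 0 (p :: w)) rfl, add_comm, ih]
    congr 1
    rw [whiskerLeft_sum, Preadditive.sum_comp, Preadditive.comp_sum]
    exact Finset.sum_congr rfl fun i _ => (h1 _ _ rfl).symm

theorem barι_comulPair {A : GradedObject ℤ C} {Y Z : C} (M : bar A ⟶ Y) (N : bar A ⟶ Z)
    (w : List ℤ) :
    barι A w ≫ comulPair M N = ∑ i ∈ Finset.range (w.length + 1),
      wordSplitOf A (List.take_append_drop i w) ≫
        ((barι A (w.take i) ≫ M) ⊗ₘ (barι A (w.drop i) ≫ N)) := by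
  rw [comulPair, ← Category.assoc, barι_barComul_eq_sum, Preadditive.sum_comp]
  simp

/-- The morphisms out of `bar A` that vanish on words of length less than `n`. -/
def barFil (A : GradedObject ℤ C) (Y : C) (n : ℕ) : AddSubgroup (bar A ⟶ Y) where
  carrier := {f | ∀ w : List ℤ, w.length < n → barι A w ≫ f = 0}
  zero_mem' := fun w _ => comp_zero
  add_mem' := fun {f g} hf hg w hw => by rw [Preadditive.comp_add, hf w hw, hg w hw, add_zero]
  neg_mem' := fun {f} hf w hw => by rw [Preadditive.comp_neg, hf w hw, neg_zero]

variable {A B : GradedObject ℤ C} {Y Z : C}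

theorem mem_barFil_zero (f : bar A ⟶ Y) : f ∈ barFil A Y 0 := fun _ hw => absurd hw (by simp)

theorem barFil_anti {m n : ℕ} (h : m ≤ n) : barFil A Y n ≤ barFil A Y m :=
  fun _ hf w hw => hf w (hw.trans_le h)

theorem comp_mem_barFil {n : ℕ} {f : bar A ⟶ Y} (hf : f ∈ barFil A Y n) (g : Y ⟶ Z) :
    f ≫ g ∈ barFil A Z n := fun w hw => by rw [← Category.assoc, hf w hw, zero_comp]

/-- The filtration starts with everything and is separated, since each word is finite. This is the
uniqueness principle for every recursive equation below. -/
theorem eq_zero_of_mem_barFil {f : bar A ⟶ Y} (h : ∀ n, f ∈ barFil A Y n → f ∈ barFil A Y (n + 1)) :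
    f = 0 := by
  have h' : ∀ n, f ∈ barFil A Y n := fun n => by
    induction n with
    | zero => exact mem_barFil_zero f
    | succ n ih => exact h n ih
  exact bar_ext fun w => by rw [h' (w.length + 1) w (Nat.lt_succ_self _), comp_zero]

/-- If a word has fewer than m + n letters, each cut leaves fewer than m letters on the left or
fewer than n on the right. -/
theorem comulPair_mem_barFil {m n k : ℕ} {M : bar A ⟶ Y} {N : bar A ⟶ Z} (hM : M ∈ barFil A Y m)
    (hN : N ∈ barFil A Z n) (hk : k ≤ m + n) : comulPair M N ∈ barFil A (Y ⊗ Z) k := by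
  intro w hw
  rw [barι_comulPair]
  refine Finset.sum_eq_zero fun i hi => ?_
  by_cases h : (w.take i).length < m
  · rw [hM _ h]
    simp
  · rw [hN (w.drop i) (by rw [List.length_take] at h; rw [List.length_drop]; omega)]
    simp

theorem conv_mem_barFil {m n k : ℕ} {M N : bar A ⟶ bar B} (hM : M ∈ barFil A (bar B) m)
    (hN : N ∈ barFil A (bar B) n) (hk : k ≤ m + n) : M * N ∈ barFil A (bar B) k :=
  comp_mem_barFil (comulPair_mem_barFil hM hN hk) _

/-- A contracting operator on morphisms `bar A ⟶ Y` has a fixed point, in any set of morphisms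
that is stable under the operator and defined by conditions on the words. -/
theorem exists_fixedPoint (S : Set (bar A ⟶ Y)) (Ψ : (bar A ⟶ Y) → (bar A ⟶ Y))
    (hS : S.Nonempty) (hΨ : ∀ f ∈ S, Ψ f ∈ S)
    (hloc : ∀ f, (∀ w, ∃ g ∈ S, barι A w ≫ f = barι A w ≫ g) → f ∈ S)
    (hc : ∀ f ∈ S, ∀ g ∈ S, ∀ n, f - g ∈ barFil A Y n → Ψ f - Ψ g ∈ barFil A Y (n + 1)) :
    ∃ f ∈ S, Ψ f = f := by
  obtain ⟨f0, h0⟩ := hS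
  have hmem : ∀ n, Ψ^[n] f0 ∈ S := fun n => by
    induction n with
    | zero => exact h0
    | succ n ih => rw [Function.iterate_succ_apply']; exact hΨ _ ih
  have hstep : ∀ n, Ψ^[n + 1] f0 - Ψ^[n] f0 ∈ barFil A Y n := fun n => by
    induction n with
    | zero => exact mem_barFil_zero _
    | succ n ih =>
      have := hc _ (hmem (n + 1)) _ (hmem n) n ih
      rwa [← Function.iterate_succ_apply' Ψ, ← Function.iterate_succ_apply' Ψ] at this
  have hlim : ∀ m n, m ≤ n → Ψ^[n] f0 - Ψ^[m] f0 ∈ barFil A Y m := fun m n hmn => by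
    induction n, hmn using Nat.le_induction with
    | base => rw [sub_self]; exact zero_mem _
    | succ n hn ih =>
      rw [← sub_add_sub_cancel _ (Ψ^[n] f0)]
      exact add_mem (barFil_anti hn (hstep n)) ih
  -- The limit is taken word by word: on a word of length ℓ the iterates are constant from the one
  -- with index ℓ + 1 onwards.
  let f : bar A ⟶ Y := barDesc fun w => barι A w ≫ Ψ^[w.length + 1] f0
  have hf : ∀ w, barι A w ≫ f = barι A w ≫ Ψ^[w.length + 1] f0 := fun w => barι_barDesc _ w
  have hfS : f ∈ S := hloc f fun w => ⟨_, hmem _, hf w⟩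
  have hfn : ∀ n, f - Ψ^[n] f0 ∈ barFil A Y n := fun n w hw => by
    have := hlim _ n (Nat.succ_le_of_lt hw) w (Nat.lt_succ_self _)
    rw [Preadditive.comp_sub, hf, ← neg_sub, ← Preadditive.comp_sub, this, neg_zero]
  refine ⟨f, hfS, sub_eq_zero.1 (bar_ext fun w => ?_)⟩
  have h1 := hc f hfS _ (hmem w.length) _ (hfn w.length)
  rw [← Function.iterate_succ_apply' Ψ] at h1
  have h2 := sub_mem h1 (hfn (w.length + 1))
  rw [sub_sub_sub_cancel_right] at h2
  rw [h2 w (Nat.lt_succ_self _), comp_zero]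

end Words

/-! ### Words of length one -/

section Letters

variable {C : Type u} [Category.{v} C] [HasCoproducts.{0} C]

/-- The sum `⨁ A^p` of the components of a graded object. -/
noncomputable def tot (A : GradedObject ℤ C) : C := ∐ fun p : ℤ => A p

/-- The inclusion of a component. -/
noncomputable def totι (A : GradedObject ℤ C) (p : ℤ) : A p ⟶ tot A :=
  Sigma.ι (fun p : ℤ => A p) p

/-- The morphism out of `tot A` with given restrictions. -/
noncomputable def totDesc {A : GradedObject ℤ C} {Y : C} (φ : ∀ p, A p ⟶ Y) : tot A ⟶ Y :=
  Sigma.desc φ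

@[simp]
theorem totι_totDesc {A : GradedObject ℤ C} {Y : C} (φ : ∀ p, A p ⟶ Y) (p : ℤ) :
    totι A p ≫ totDesc φ = φ p :=
  Sigma.ι_desc _ _

theorem tot_ext {A : GradedObject ℤ C} {Y : C} {f g : tot A ⟶ Y}
    (h : ∀ p, totι A p ≫ f = totι A p ≫ g) : f = g :=
  Sigma.hom_ext _ _ h

variable [MonoidalCategory C]

theorem tot_whiskerRight_ext [TensorPreservesCoproducts C] {A : GradedObject ℤ C} {X Y : C}
    {f g : tot A ⊗ X ⟶ Y} (h : ∀ p, totι A p ▷ X ≫ f = totι A p ▷ X ≫ g) : f = g :=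
  mapSigma_hom_ext (tensorRight X) _ h

/-- The inclusion of the words of length one. -/
noncomputable def letterMap (A : GradedObject ℤ C) : tot A ⟶ bar A :=
  totDesc fun p => (wordOne A p).hom ≫ barι A [p]

@[simp]
theorem totι_letterMap (A : GradedObject ℤ C) (p : ℤ) :
    totι A p ≫ letterMap A = (wordOne A p).hom ≫ barι A [p] := by
  simp [letterMap]

theorem wordOne_eq (A : GradedObject ℤ C) (p : ℤ) :
    (wordOne A p).hom = (ρ_ _).inv ≫ A p ◁ (wordNil A).hom ≫ (wordCons A p []).hom := by
  simp [wordOne, wordNil, wordCons, wordObj]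

theorem wordOne_inv_eq (A : GradedObject ℤ C) (p : ℤ) :
    (wordOne A p).inv = (wordCons A p []).inv ≫ A p ◁ (wordNil A).inv ≫ (ρ_ _).hom := by
  simp [wordOne, wordNil, wordCons, wordObj]

variable [Preadditive C]

/-- The projection to the words of length one. -/
noncomputable def letterProj (A : GradedObject ℤ C) : bar A ⟶ tot A :=
  barDesc fun w => match w with
    | [] => 0
    | [p] => (wordOne A p).inv ≫ totι A p
    | _ :: _ :: _ => 0

theorem barι_one_letterProj (A : GradedObject ℤ C) (p : ℤ) :
    barι A [p] ≫ letterProj A = (wordOne A p).inv ≫ totι A p :=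
  barι_barDesc _ _

theorem barι_letterProj_of_length_ne (A : GradedObject ℤ C) (w : List ℤ) (h : w.length ≠ 1) :
    barι A w ≫ letterProj A = 0 := by
  match w with
  | [] => exact barι_barDesc _ _
  | [p] => exact absurd rfl h
  | _ :: _ :: _ => exact barι_barDesc _ _

@[simp]
theorem letterMap_letterProj (A : GradedObject ℤ C) : letterMap A ≫ letterProj A = 𝟙 _ :=
  tot_ext fun p => by
    rw [← Category.assoc, totι_letterMap, Category.assoc, barι_one_letterProj]
    simp

theorem nilMap_letterProj (A : GradedObject ℤ C) : nilMap A ≫ letterProj A = 0 := by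
  rw [nilMap, Category.assoc, barι_letterProj_of_length_ne A [] (by simp), comp_zero]

variable [TensorPreservesCoproducts C]

/-- Adding a letter in front of a word. -/
noncomputable def letterCons (A : GradedObject ℤ C) : tot A ⊗ bar A ⟶ bar A :=
  letterMap A ▷ bar A ≫ barMul A

theorem totι_letterCons (A : GradedObject ℤ C) (p : ℤ) :
    totι A p ▷ bar A ≫ letterCons A = consMap A p := by
  have h : totι A p ≫ letterMap A = (ρ_ _).inv ≫ A p ◁ nilMap A ≫ consMap A p := by
    rw [totι_letterMap, barι_cons, wordOne_eq, nilMap]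
    simp
  rw [letterCons, ← comp_whiskerRight_assoc, h, comp_whiskerRight_assoc, comp_whiskerRight_assoc,
    consMap_whiskerRight_barMul, associator_naturality_middle_assoc,
    ← MonoidalCategory.whiskerLeft_comp_assoc, nilMap_whiskerRight_barMul]
  simp

variable [MonoidalPreadditive C]

theorem letterCons_barCounit (A : GradedObject ℤ C) : letterCons A ≫ barCounit A = 0 :=
  tot_whiskerRight_ext fun p => by
    rw [reassoc_of% totι_letterCons, consMap_barCounit, comp_zero]

theorem letterCons_barComul (A : GradedObject ℤ C) :
    letterCons A ≫ barComul A = letterCons A ≫ nilTensor A _ +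
      tot A ◁ barComul A ≫ (α_ (tot A) (bar A) (bar A)).inv ≫ letterCons A ▷ bar A :=
  tot_whiskerRight_ext fun p => by
    rw [Preadditive.comp_add, reassoc_of% totι_letterCons, reassoc_of% totι_letterCons,
      ← whisker_exchange_assoc, associator_inv_naturality_left_assoc, ← comp_whiskerRight,
      totι_letterCons, consMap_barComul]

theorem letterCons_letterProj (A : GradedObject ℤ C) :
    letterCons A ≫ letterProj A = tot A ◁ barCounit A ≫ (ρ_ _).hom :=
  tot_whiskerRight_ext fun p => by
    rw [reassoc_of% totι_letterCons, ← whisker_exchange_assoc, rightUnitor_naturality]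
    refine whiskerLeft_bar_ext fun w => ?_
    rw [reassoc_of% whiskerLeft_barι_consMap]
    cases w with
    | nil =>
      rw [barι_one_letterProj, ← MonoidalCategory.whiskerLeft_comp_assoc, barι_nil,
        Category.assoc, nilMap_barCounit, wordOne_inv_eq]
      simp
    | cons q w =>
      rw [barι_letterProj_of_length_ne _ _ (by simp), ← MonoidalCategory.whiskerLeft_comp_assoc,
        barι_cons_barCounit]
      simp

end Letters

/-! ### Coalgebra morphisms and coderivations as convolution products -/

section GroupLike

variable {C : Type u} [Category.{v} C] [MonoidalCategory C] [HasCoproducts.{0} C]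
  [TensorPreservesCoproducts C] [Preadditive C] [MonoidalPreadditive C]
  {A B E : GradedObject ℤ C} {Y Z : C}

/-- Prefixing a letter to the first factor of a tensor product. -/
noncomputable def letterPair (f : bar A ⟶ tot B) (y : bar A ⟶ bar B ⊗ Y) : bar A ⟶ bar B ⊗ Y :=
  comulPair f y ≫ (α_ _ _ _).inv ≫ letterCons B ▷ Y

theorem letterMap_conv (f : bar A ⟶ tot B) (M : bar A ⟶ bar B) :
    (f ≫ letterMap B) * M = comulPair f M ≫ letterCons B := by
  rw [conv_eq, ← comulPair_comp_whiskerRight, Category.assoc, letterCons]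

theorem letterPair_comulPair (f : bar A ⟶ tot B) (M : bar A ⟶ bar B) (N : bar A ⟶ Y) :
    letterPair f (comulPair M N) = comulPair ((f ≫ letterMap B) * M) N := by
  rw [letterPair, ← comulPair_assoc, Category.assoc, Iso.hom_inv_id_assoc,
    comulPair_comp_whiskerRight, letterMap_conv]

theorem letterPair_add (f : bar A ⟶ tot B) (y y' : bar A ⟶ bar B ⊗ Y) :
    letterPair f (y + y') = letterPair f y + letterPair f y' := by
  simp [letterPair, comulPair_add_right]

theorem letterPair_sub (f : bar A ⟶ tot B) (y y' : bar A ⟶ bar B ⊗ Y) :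
    letterPair f (y - y') = letterPair f y - letterPair f y' := by
  rw [eq_sub_iff_add_eq, ← letterPair_add, sub_add_cancel]

/-- An equation `y = a + f · y` in which `f` vanishes on the empty word has at most one solution. -/
theorem letterPair_unique {f : bar A ⟶ tot B} (hf : f ∈ barFil A _ 1)
    {a y y' : bar A ⟶ bar B ⊗ Y} (hy : y = a + letterPair f y) (hy' : y' = a + letterPair f y') :
    y = y' := by
  refine sub_eq_zero.1 (eq_zero_of_mem_barFil fun n hn => ?_)
  have h : y - y' = letterPair f (y - y') := by
    rw [letterPair_sub]
    conv_lhs => rw [hy, hy']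
    abel
  rw [h]
  exact comp_mem_barFil (comulPair_mem_barFil hf hn (by omega)) _

theorem comulPair_one_left (N : bar A ⟶ Y) :
    comulPair (1 : bar A ⟶ bar B) N = N ≫ nilTensor B Y := by
  rw [convOne_eq, comulPair_counit_left, nilTensor]

theorem letterMap_conv_comp_barComul (f : bar A ⟶ tot B) (M : bar A ⟶ bar B) :
    ((f ≫ letterMap B) * M) ≫ barComul B =
      comulPair 1 ((f ≫ letterMap B) * M) + letterPair f (M ≫ barComul B) := by
  rw [comulPair_one_left, letterMap_conv, Category.assoc, letterCons_barComul,
    Preadditive.comp_add, ← Category.assoc, ← Category.assoc, comulPair_comp_whiskerLeft,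
    letterPair]

theorem one_comp_barComul : (1 : bar A ⟶ bar B) ≫ barComul B = comulPair 1 1 := by
  rw [comulPair_one_left, convOne_eq, Category.assoc, nilMap_barComul, Category.assoc]

/-- A morphism of coalgebras `bar A ⟶ bar B` that preserves the empty word. -/
structure IsGroupLike (F : bar A ⟶ bar B) : Prop where
  comp_barComul : F ≫ barComul B = comulPair F F
  comp_barCounit : F ≫ barCounit B = barCounit A
  nilMap_comp : nilMap A ≫ F = nilMap B

/-- A coderivation `bar A ⟶ bar B` along two morphisms of coalgebras. -/
def IsCoderivation (F G L : bar A ⟶ bar B) : Prop :=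
  L ≫ barComul B = comulPair L G + comulPair F L

theorem IsGroupLike.comp_comulPair {F : bar A ⟶ bar B} (hF : IsGroupLike F) (M : bar B ⟶ Y)
    (N : bar B ⟶ Z) : F ≫ comulPair M N = comulPair (F ≫ M) (F ≫ N) := by
  rw [comulPair, ← Category.assoc, hF.comp_barComul, comulPair_comp_tensor]

theorem IsGroupLike.comp_mul {F : bar A ⟶ bar B} (hF : IsGroupLike F) (M N : bar B ⟶ bar E) :
    F ≫ (M * N) = (F ≫ M) * (F ≫ N) := by
  rw [conv_eq, ← Category.assoc, hF.comp_comulPair, conv_eq]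

theorem IsGroupLike.comp_one {F : bar A ⟶ bar B} (hF : IsGroupLike F) :
    F ≫ (1 : bar B ⟶ bar E) = 1 := by
  rw [convOne_eq, ← Category.assoc, hF.comp_barCounit, convOne_eq]

theorem IsGroupLike.comp {F : bar A ⟶ bar B} {G : bar B ⟶ bar E} (hF : IsGroupLike F)
    (hG : IsGroupLike G) : IsGroupLike (F ≫ G) where
  comp_barComul := by rw [Category.assoc, hG.comp_barComul, hF.comp_comulPair]
  comp_barCounit := by rw [Category.assoc, hG.comp_barCounit, hF.comp_barCounit]
  nilMap_comp := by rw [← Category.assoc, hF.nilMap_comp, hG.nilMap_comp]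

theorem isGroupLike_id (A : GradedObject ℤ C) : IsGroupLike (𝟙 (bar A)) where
  comp_barComul := by rw [comulPair, id_tensorHom_id, Category.id_comp, Category.comp_id]
  comp_barCounit := Category.id_comp _
  nilMap_comp := Category.comp_id _

theorem IsCoderivation.comp_comulPair {F G L : bar A ⟶ bar B} (hL : IsCoderivation F G L)
    (M : bar B ⟶ Y) (N : bar B ⟶ Z) :
    L ≫ comulPair M N = comulPair (L ≫ M) (G ≫ N) + comulPair (F ≫ M) (L ≫ N) := by
  rw [comulPair, ← Category.assoc, hL, Preadditive.add_comp, comulPair_comp_tensor,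
    comulPair_comp_tensor]

theorem IsCoderivation.comp_mul {F G L : bar A ⟶ bar B} (hL : IsCoderivation F G L)
    (M N : bar B ⟶ bar E) :
    L ≫ (M * N) = (L ≫ M) * (G ≫ N) + (F ≫ M) * (L ≫ N) := by
  rw [conv_eq, ← Category.assoc, hL.comp_comulPair, Preadditive.add_comp, conv_eq, conv_eq]

theorem mem_barFil_one {f : bar A ⟶ Y} : f ∈ barFil A Y 1 ↔ nilMap A ≫ f = 0 := by
  constructor
  · intro h
    rw [nilMap, Category.assoc, h [] (by simp), comp_zero]
  · intro h w hw
    obtain rfl : w = [] := List.eq_nil_of_length_eq_zero (by omega)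
    rw [barι_nil, Category.assoc, h, comp_zero]

/-- The geometric series `∑ fⁿ` in the convolution ring. -/
noncomputable def barHom (f : bar A ⟶ tot B) : bar A ⟶ bar B :=
  barDesc fun w => barι A w ≫ ∑ i ∈ Finset.range (w.length + 1), (f ≫ letterMap B) ^ i

theorem pow_mem_barFil {x : bar A ⟶ bar B} (hx : x ∈ barFil A _ 1) (n : ℕ) :
    x ^ n ∈ barFil A _ n := by
  induction n with
  | zero => exact mem_barFil_zero _
  | succ n ih => rw [pow_succ]; exact conv_mem_barFil ih hx le_rfl

theorem eq_of_forall_sub_mem_barFil {f g : bar A ⟶ Y} (h : ∀ n, f - g ∈ barFil A Y n) : f = g :=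
  sub_eq_zero.1 (eq_zero_of_mem_barFil fun n _ => h (n + 1))

/-- The i-th power of a map that kills the empty word kills all words of length less than i, so the
series is a finite sum on each word. -/
theorem barHom_sub_geomSum_mem {f : bar A ⟶ tot B} (hf : f ∈ barFil A _ 1) (n : ℕ) :
    barHom f - ∑ i ∈ Finset.range n, (f ≫ letterMap B) ^ i ∈ barFil A _ n := by
  intro w hw
  rw [Preadditive.comp_sub, barHom, barι_barDesc, ← Preadditive.comp_sub,
    ← neg_sub, Finset.sum_range_sub_sum_range hw, Preadditive.comp_neg, Preadditive.comp_sum,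
    Finset.sum_eq_zero, neg_zero]
  intro i hi
  rw [Finset.mem_filter] at hi
  exact pow_mem_barFil (comp_mem_barFil hf _) i w hi.2

/-- The partial sums telescope to 1 - fⁿ, and both fⁿ and the tail of the series lie in filtration
n. -/
theorem mul_barHom {f : bar A ⟶ tot B} (hf : f ∈ barFil A _ 1) :
    (1 - f ≫ letterMap B) * barHom f = 1 := by
  refine eq_of_forall_sub_mem_barFil fun n => ?_
  have h := mul_neg_geom_sum (f ≫ letterMap B) n
  rw [← sub_add_cancel (barHom f) (∑ i ∈ Finset.range n, (f ≫ letterMap B) ^ i), mul_add, h,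
    add_sub_assoc, sub_sub_cancel_left]
  exact add_mem (conv_mem_barFil (mem_barFil_zero _) (barHom_sub_geomSum_mem hf n) (by omega))
    (neg_mem (pow_mem_barFil (comp_mem_barFil hf _) n))

theorem barHom_mul {f : bar A ⟶ tot B} (hf : f ∈ barFil A _ 1) :
    barHom f * (1 - f ≫ letterMap B) = 1 := by
  refine eq_of_forall_sub_mem_barFil fun n => ?_
  have h := geom_sum_mul_neg (f ≫ letterMap B) n
  rw [← sub_add_cancel (barHom f) (∑ i ∈ Finset.range n, (f ≫ letterMap B) ^ i), add_mul, h,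
    add_sub_assoc, sub_sub_cancel_left]
  exact add_mem (conv_mem_barFil (barHom_sub_geomSum_mem hf n) (mem_barFil_zero _) (by omega))
    (neg_mem (pow_mem_barFil (comp_mem_barFil hf _) n))

theorem barHom_eq {f : bar A ⟶ tot B} (hf : f ∈ barFil A _ 1) :
    barHom f = 1 + (f ≫ letterMap B) * barHom f := by
  have h := mul_barHom hf
  rw [sub_mul, one_mul] at h
  exact sub_eq_iff_eq_add.1 h

theorem eq_barHom_of_eq {f : bar A ⟶ tot B} (hf : f ∈ barFil A _ 1) {F : bar A ⟶ bar B}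
    (h : F = 1 + (f ≫ letterMap B) * F) : F = barHom f := by
  have h1 : (1 - f ≫ letterMap B) * F = 1 := by
    rw [sub_mul, one_mul, sub_eq_iff_eq_add]
    exact h
  rw [← one_mul F, ← barHom_mul hf, mul_assoc, h1, mul_one]

theorem one_mem_of_nilMap {f : bar A ⟶ tot B} (M : bar A ⟶ bar B) (hf : f ∈ barFil A _ 1) :
    nilMap A ≫ ((f ≫ letterMap B) * M) = 0 :=
  mem_barFil_one.1 (conv_mem_barFil (comp_mem_barFil hf _) (mem_barFil_zero M) le_rfl)

theorem nilMap_comp_one : nilMap A ≫ (1 : bar A ⟶ bar B) = nilMap B := by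
  rw [convOne_eq, ← Category.assoc, nilMap_barCounit, Category.id_comp]

theorem one_comp_barCounit : (1 : bar A ⟶ bar B) ≫ barCounit B = barCounit A := by
  rw [convOne_eq, Category.assoc, nilMap_barCounit, Category.comp_id]

theorem one_comp_letterProj : (1 : bar A ⟶ bar B) ≫ letterProj B = 0 := by
  rw [convOne_eq, Category.assoc, nilMap_letterProj, comp_zero]

theorem letterMap_conv_comp_barCounit (f : bar A ⟶ tot B) (M : bar A ⟶ bar B) :
    ((f ≫ letterMap B) * M) ≫ barCounit B = 0 := by
  rw [letterMap_conv, Category.assoc, letterCons_barCounit, comp_zero]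

theorem letterMap_conv_comp_letterProj (f : bar A ⟶ tot B) (M : bar A ⟶ bar B) :
    ((f ≫ letterMap B) * M) ≫ letterProj B = comulPair f (M ≫ barCounit B) ≫ (ρ_ _).hom := by
  rw [letterMap_conv, Category.assoc, letterCons_letterProj, ← Category.assoc,
    comulPair_comp_whiskerLeft]

theorem letterMap_conv_comp_letterProj_of_counit (f : bar A ⟶ tot B) {M : bar A ⟶ bar B}
    (hM : M ≫ barCounit B = barCounit A) : ((f ≫ letterMap B) * M) ≫ letterProj B = f := by
  rw [letterMap_conv_comp_letterProj, hM, ← Category.comp_id (barCounit A),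
    comulPair_counit_right]
  simp

theorem letterMap_conv_comp_letterProj_eq_zero (f : bar A ⟶ tot B) {M : bar A ⟶ bar B}
    (hM : M ≫ barCounit B = 0) : ((f ≫ letterMap B) * M) ≫ letterProj B = 0 := by
  rw [letterMap_conv_comp_letterProj, hM, comulPair_zero_right, zero_comp]

/-- From F = 1 + fF, both FΔ and F ⊗ F solve the equation y = 1 ⊗ F + f·y, which has at most one
solution. -/
theorem isGroupLike_barHom {f : bar A ⟶ tot B} (hf : f ∈ barFil A _ 1) :
    IsGroupLike (barHom f) where
  comp_barComul := by
    refine letterPair_unique (a := comulPair 1 (barHom f)) hf ?_ ?_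
    · conv_lhs => rw [barHom_eq hf]
      rw [Preadditive.add_comp, one_comp_barComul, letterMap_conv_comp_barComul, ← add_assoc,
        ← comulPair_add_right, ← barHom_eq hf]
    · rw [letterPair_comulPair, ← comulPair_add_left, ← barHom_eq hf]
  comp_barCounit := by
    rw [barHom_eq hf, Preadditive.add_comp, one_comp_barCounit, letterMap_conv_comp_barCounit,
      add_zero]
  nilMap_comp := by
    rw [barHom_eq hf, Preadditive.comp_add, nilMap_comp_one, one_mem_of_nilMap _ hf, add_zero]

theorem barHom_letterProj {f : bar A ⟶ tot B} (hf : f ∈ barFil A _ 1) :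
    barHom f ≫ letterProj B = f := by
  conv_lhs => rw [barHom_eq hf]
  rw [Preadditive.add_comp, one_comp_letterProj, zero_add,
    letterMap_conv_comp_letterProj_of_counit _ (isGroupLike_barHom hf).comp_barCounit]

theorem letterProj_mem (A : GradedObject ℤ C) : letterProj A ∈ barFil A _ 1 :=
  mem_barFil_one.2 (nilMap_letterProj A)

/-- Cutting off the first letter of a nonempty word and multiplying it back gives the word, so id =
1 + π·id in the convolution ring. Composing this identity with a coalgebra map or a coderivation
gives the two classification results `IsGroupLike.eq_barHom` and `IsCoderivation.eq_conv`. -/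
theorem barHom_letterProj_self (A : GradedObject ℤ C) : 𝟙 (bar A) = barHom (letterProj A) := by
  refine eq_barHom_of_eq (letterProj_mem A)
    (bar_induction ?_ fun p w _ => congrArg (A p ◁ barι A w ≫ ·) ?_)
  · rw [Preadditive.comp_add, nilMap_comp_one, one_mem_of_nilMap _ (letterProj_mem A), add_zero,
      Category.comp_id]
  · have h1 : nilTensor A (bar A) ≫ letterProj A ▷ bar A = 0 := by
      rw [nilTensor, Category.assoc, ← comp_whiskerRight, nilMap_letterProj]
      simp
    have h2 : consMap A p ≫ letterProj A = A p ◁ barCounit A ≫ (ρ_ _).hom ≫ totι A p := by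
      rw [← totι_letterCons, Category.assoc, letterCons_letterProj, ← whisker_exchange_assoc,
        rightUnitor_naturality]
    rw [Preadditive.comp_add, convOne_eq, ← Category.assoc (consMap A p), consMap_barCounit,
      zero_comp, zero_add, letterMap_conv, comulPair, tensorHom_id, Category.assoc,
      reassoc_of% consMap_barComul, Preadditive.add_comp, Category.assoc, reassoc_of% h1,
      zero_comp, comp_zero, zero_add, Category.assoc, Category.assoc, ← comp_whiskerRight_assoc,
      h2, comp_whiskerRight_assoc, comp_whiskerRight_assoc,
      ← associator_inv_naturality_middle_assoc, ← MonoidalCategory.whiskerLeft_comp_assoc,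
      barComul_counit_left, totι_letterCons]
    simp

theorem IsGroupLike.letterProj_mem {F : bar A ⟶ bar B} (hF : IsGroupLike F) :
    F ≫ letterProj B ∈ barFil A _ 1 := by
  rw [mem_barFil_one, ← Category.assoc, hF.nilMap_comp, nilMap_letterProj]

theorem IsGroupLike.eq_barHom {F : bar A ⟶ bar B} (hF : IsGroupLike F) :
    F = barHom (F ≫ letterProj B) := by
  refine eq_barHom_of_eq hF.letterProj_mem ?_
  have h := barHom_eq (AInfinity.letterProj_mem B)
  rw [← barHom_letterProj_self] at h
  conv_lhs => rw [← Category.comp_id F, h, Preadditive.comp_add, hF.comp_one, hF.comp_mul,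
    Category.comp_id, ← Category.assoc]

theorem barHom_comp_barHom {f : bar A ⟶ tot B} {g : bar B ⟶ tot E} (hf : f ∈ barFil A _ 1)
    (hg : g ∈ barFil B _ 1) : barHom f ≫ barHom g = barHom (barHom f ≫ g) := by
  rw [((isGroupLike_barHom hf).comp (isGroupLike_barHom hg)).eq_barHom, Category.assoc,
    barHom_letterProj hg]

/-- For L = FkG, the equation F = 1 + fF gives L = kG + fL. Both sides of the coderivation identity
then solve y = 1 ⊗ L + kG ⊗ G + f·y. -/
theorem IsGroupLike.isCoderivation {F G : bar A ⟶ bar B} (hF : IsGroupLike F)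
    (hG : IsGroupLike G) (k : bar A ⟶ tot B) : IsCoderivation F G (F * (k ≫ letterMap B) * G) := by
  have h0 : ((k ≫ letterMap B) * G) ≫ barComul B = comulPair 1 ((k ≫ letterMap B) * G) +
      comulPair ((k ≫ letterMap B) * G) G := by
    rw [letterMap_conv_comp_barComul, hG.comp_barComul, letterPair_comulPair]
  have hf := hF.letterProj_mem
  have hF' : F = 1 + ((F ≫ letterProj B) ≫ letterMap B) * F := by
    have := barHom_eq hf
    rwa [← hF.eq_barHom] at this
  have hL : F * (k ≫ letterMap B) * G = (k ≫ letterMap B) * G +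
      ((F ≫ letterProj B) ≫ letterMap B) * (F * (k ≫ letterMap B) * G) := by
    conv_lhs => rw [hF']
    noncomm_ring
  generalize F * (k ≫ letterMap B) * G = L at hL
  generalize (k ≫ letterMap B) * G = L0 at *
  refine letterPair_unique (a := comulPair 1 L + comulPair L0 G) hf ?_ ?_
  · conv_lhs => rw [hL]
    rw [Preadditive.add_comp, h0, letterMap_conv_comp_barComul]
    conv_rhs => rw [hL, comulPair_add_right, ← hL]
    abel
  · have e1 := congrArg (comulPair · G) hL
    have e2 := congrArg (comulPair · L) hF'
    simp only [comulPair_add_left] at e1 e2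
    rw [letterPair_add, letterPair_comulPair, letterPair_comulPair]
    conv_lhs => rw [e1, e2]
    abel

/-- In FkG = kG + fFkG, a single letter survives in the first term only where G contributes its
counit. In the second term it never does, because FkG has zero counit. -/
theorem IsGroupLike.conv_comp_letterProj {F G : bar A ⟶ bar B} (hF : IsGroupLike F)
    (hG : IsGroupLike G) (k : bar A ⟶ tot B) :
    (F * (k ≫ letterMap B) * G) ≫ letterProj B = k := by
  have hF' := barHom_eq hF.letterProj_mem
  rw [← hF.eq_barHom] at hF'
  have h0 : (F * ((k ≫ letterMap B) * G)) ≫ barCounit B = 0 := by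
    rw [hF', add_mul, one_mul, mul_assoc, Preadditive.add_comp, letterMap_conv_comp_barCounit,
      letterMap_conv_comp_barCounit, add_zero]
  rw [mul_assoc]
  conv_lhs => rw [hF', add_mul, one_mul, mul_assoc]
  rw [Preadditive.add_comp, letterMap_conv_comp_letterProj_of_counit _ hG.comp_barCounit,
    letterMap_conv_comp_letterProj_eq_zero _ h0, add_zero]

/-- Composing L with id = 1 + π·id gives (1 - Fπ)L = (Lπ)G, and F is the inverse of 1 - Fπ. The term
coming from 1 vanishes because its product with the invertible element G is zero. A coderivation is
therefore determined by its corestriction. -/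
theorem IsCoderivation.eq_conv {F G L : bar A ⟶ bar B} (hF : IsGroupLike F) (hG : IsGroupLike G)
    (hL : IsCoderivation F G L) : L = F * ((L ≫ letterProj B) ≫ letterMap B) * G := by
  have hG' := mul_barHom hG.letterProj_mem
  have hG'' := barHom_mul hG.letterProj_mem
  have hF' := barHom_mul hF.letterProj_mem
  rw [← hG.eq_barHom] at hG' hG''
  rw [← hF.eq_barHom] at hF'
  have h1 : L ≫ (1 : bar B ⟶ bar B) = 0 := by
    have h := hL.comp_mul (1 : bar B ⟶ bar B) (𝟙 (bar B))
    rw [one_mul, hF.comp_one, one_mul, Category.comp_id, Category.comp_id] at h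
    have h2 : (L ≫ (1 : bar B ⟶ bar B)) * G = 0 := by simpa using h.symm
    rw [← mul_one (L ≫ (1 : bar B ⟶ bar B)), ← hG'', ← mul_assoc, h2, zero_mul]
  have h := barHom_eq (AInfinity.letterProj_mem B)
  rw [← barHom_letterProj_self] at h
  have h3 : L = ((L ≫ letterProj B) ≫ letterMap B) * G +
      ((F ≫ letterProj B) ≫ letterMap B) * L := by
    conv_lhs => rw [← Category.comp_id L, h, Preadditive.comp_add, h1, zero_add, hL.comp_mul,
      Category.comp_id, Category.comp_id, ← Category.assoc, ← Category.assoc]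
  have h4 : (1 - (F ≫ letterProj B) ≫ letterMap B) * L =
      ((L ≫ letterProj B) ≫ letterMap B) * G := by
    rw [sub_mul, one_mul, sub_eq_iff_eq_add]
    exact h3
  rw [mul_assoc, ← h4, ← mul_assoc, hF', one_mul]

end GroupLike

/-! ### Shifted degree, signs and the bar differential -/

section Grading

variable {C : Type u} [Category.{v} C]

/-- An object with a family of projections onto its homogeneous parts. -/
class HasGrading (X : C) where
  proj : ℤ → (X ⟶ X)

open HasGrading

/-- A morphism of degree `r`. -/
def HasDegree {X Y : C} [HasGrading X] [HasGrading Y] (r : ℤ) (f : X ⟶ Y) : Prop :=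
  ∀ d e : ℤ, d + r = e → (proj d ≫ f) ≫ proj e = proj d ≫ f

section

variable {X Y Z : C} [HasGrading X] [HasGrading Y] [HasGrading Z] {r s t : ℤ}

theorem HasDegree.comp {f : X ⟶ Y} {g : Y ⟶ Z} (hf : HasDegree r f) (hg : HasDegree s g)
    (h : r + s = t) : HasDegree t (f ≫ g) := fun d e hde => by
  rw [← Category.assoc, ← hf d _ rfl, Category.assoc _ _ g, Category.assoc,
    hg (d + r) e (by omega)]

variable [Preadditive C]

theorem hasDegree_zero (r : ℤ) : HasDegree r (0 : X ⟶ Y) := fun _ _ _ => by simp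

theorem HasDegree.add {f g : X ⟶ Y} (hf : HasDegree r f) (hg : HasDegree r g) :
    HasDegree r (f + g) := fun d e h => by
  rw [Preadditive.comp_add, Preadditive.add_comp, hf d e h, hg d e h]

theorem HasDegree.neg {f : X ⟶ Y} (hf : HasDegree r f) : HasDegree r (-f) := fun d e h => by
  rw [Preadditive.comp_neg, Preadditive.neg_comp, hf d e h]

theorem HasDegree.sub {f g : X ⟶ Y} (hf : HasDegree r f) (hg : HasDegree r g) :
    HasDegree r (f - g) := by
  rw [sub_eq_add_neg]
  exact hf.add hg.neg

end

variable [Preadditive C] [HasCoproducts.{0} C]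

/-- The components of `A` in the grading of `tot A`, shifted by one. -/
noncomputable instance (A : GradedObject ℤ C) : HasGrading (tot A) where
  proj d := totDesc fun p => if p - 1 = d then totι A p else 0

theorem totι_proj (A : GradedObject ℤ C) (p d : ℤ) (h : p - 1 = d) :
    totι A p ≫ proj d = totι A p := by
  subst h
  exact (totι_totDesc _ p).trans (if_pos rfl)

theorem totι_proj_ne (A : GradedObject ℤ C) (p d : ℤ) (h : p - 1 ≠ d) :
    totι A p ≫ proj d = 0 :=
  (totι_totDesc _ p).trans (if_neg h)

/-- A morphism out of `tot A` is homogeneous if its restrictions to the components are. -/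
theorem hasDegree_tot_iff {A : GradedObject ℤ C} {Y : C} [HasGrading Y] {r : ℤ} {f : tot A ⟶ Y} :
    HasDegree r f ↔ ∀ p d, p - 1 + r = d → (totι A p ≫ f) ≫ proj d = totι A p ≫ f := by
  constructor
  · intro hf p d h
    have := totι A p ≫= hf (p - 1) d h
    simpa only [Category.assoc, reassoc_of% totι_proj A p _ rfl] using this
  · intro hf d e h
    refine tot_ext fun p => ?_
    by_cases hp : p - 1 = d
    · have := hf p e (by omega)
      simpa only [Category.assoc, reassoc_of% totι_proj A p _ hp] using this
    · simp only [Category.assoc, reassoc_of% totι_proj_ne A p _ hp, zero_comp]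

variable [MonoidalCategory C]

/-- The degree of a word in the shifted grading. -/
def wordDeg (w : List ℤ) : ℤ := w.sum - w.length

@[simp]
theorem wordDeg_nil : wordDeg [] = 0 := rfl

theorem wordDeg_cons (p : ℤ) (w : List ℤ) : wordDeg (p :: w) = p - 1 + wordDeg w := by
  simp [wordDeg]
  ring

theorem wordDeg_append (u v : List ℤ) : wordDeg (u ++ v) = wordDeg u + wordDeg v := by
  simp [wordDeg]
  ring

/-- The grading of `bar A` by the shifted degree of words. -/
noncomputable instance (A : GradedObject ℤ C) : HasGrading (bar A) where
  proj d := barDesc fun w => if wordDeg w = d then barι A w else 0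

theorem barι_proj (A : GradedObject ℤ C) (w : List ℤ) (d : ℤ) (h : wordDeg w = d) :
    barι A w ≫ proj d = barι A w := by
  subst h
  exact (barι_barDesc _ w).trans (if_pos rfl)

theorem barι_proj_ne (A : GradedObject ℤ C) (w : List ℤ) (d : ℤ) (h : wordDeg w ≠ d) :
    barι A w ≫ proj d = 0 :=
  (barι_barDesc _ w).trans (if_neg h)

/-- The operator `(-1)^d` on the summands of degree `d`. -/
noncomputable def barSign (A : GradedObject ℤ C) : bar A ⟶ bar A :=
  barDesc fun w => (wordDeg w).negOnePow • barι A w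

theorem barι_sign (A : GradedObject ℤ C) (w : List ℤ) :
    barι A w ≫ barSign A = (wordDeg w).negOnePow • barι A w :=
  barι_barDesc _ w

theorem proj_barSign (A : GradedObject ℤ C) (d : ℤ) :
    (proj d : bar A ⟶ bar A) ≫ barSign A = d.negOnePow • proj d := by
  refine bar_ext fun w => ?_
  rw [← Category.assoc, Linear.comp_units_smul]
  by_cases h : wordDeg w = d
  · rw [barι_proj A w d h, barι_sign, h]
  · rw [barι_proj_ne A w d h, zero_comp, smul_zero]

/-- A morphism out of `bar A` is homogeneous if its restrictions to the words are. -/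
theorem hasDegree_bar_iff {A : GradedObject ℤ C} {Y : C} [HasGrading Y] {r : ℤ} {f : bar A ⟶ Y} :
    HasDegree r f ↔ ∀ w d, wordDeg w + r = d → (barι A w ≫ f) ≫ proj d = barι A w ≫ f := by
  constructor
  · intro hf w d h
    have := barι A w ≫= hf (wordDeg w) d h
    simpa only [Category.assoc, reassoc_of% barι_proj A w _ rfl] using this
  · intro hf d e h
    refine bar_ext fun w => ?_
    by_cases hp : wordDeg w = d
    · have := hf w e (by omega)
      simpa only [Category.assoc, reassoc_of% barι_proj A w _ hp] using this
    · simp only [Category.assoc, reassoc_of% barι_proj_ne A w _ hp, zero_comp]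

variable {A B E : GradedObject ℤ C}

/-- A morphism of degree `r` commutes with the sign operators up to `(-1)^r`. -/
theorem HasDegree.sign_comp {r : ℤ} {f : bar A ⟶ bar B} (hf : HasDegree r f) :
    barSign A ≫ f = r.negOnePow • (f ≫ barSign B) := by
  refine bar_ext fun w => ?_
  have h := hasDegree_bar_iff.1 hf w _ rfl
  rw [← Category.assoc, barι_sign, Linear.comp_units_smul, ← Category.assoc (barι A w), ← h,
    Category.assoc _ _ (barSign B), proj_barSign, Linear.comp_units_smul, h,
    Linear.units_smul_comp, smul_smul, ← Int.negOnePow_add, add_comm, add_assoc,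
    Int.negOnePow_add, ← two_mul, Int.negOnePow_two_mul, mul_one]

theorem sign_sign (A : GradedObject ℤ C) : barSign A ≫ barSign A = 𝟙 _ := by
  refine bar_ext fun w => ?_
  rw [← Category.assoc, barι_sign, Linear.units_smul_comp, barι_sign, smul_smul,
    ← Int.negOnePow_add, Int.negOnePow_even _ ⟨_, rfl⟩, one_smul, Category.comp_id]

theorem hasDegree_id (A : GradedObject ℤ C) : HasDegree 0 (𝟙 (bar A)) :=
  hasDegree_bar_iff.2 fun w d h => by
    rw [Category.comp_id, barι_proj A w d (by omega)]

theorem hasDegree_sign (A : GradedObject ℤ C) : HasDegree 0 (barSign A) :=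
  hasDegree_bar_iff.2 fun w d h => by
    rw [barι_sign, Linear.units_smul_comp, barι_proj A w d (by omega)]

theorem hasDegree_letterMap (A : GradedObject ℤ C) : HasDegree 0 (letterMap A) :=
  hasDegree_tot_iff.2 fun p d h => by
    rw [totι_letterMap, Category.assoc, barι_proj A [p] d (by simp [wordDeg]; omega)]

theorem hasDegree_letterProj (A : GradedObject ℤ C) : HasDegree 0 (letterProj A) :=
  hasDegree_bar_iff.2 fun w d h => by
    by_cases hw : w.length = 1
    · obtain ⟨p, rfl⟩ := List.length_eq_one_iff.1 hw
      rw [barι_one_letterProj, Category.assoc,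
        totι_proj A p d (by simp [wordDeg] at h; omega)]
    · rw [barι_letterProj_of_length_ne A w hw, zero_comp]

variable [TensorPreservesCoproducts C] [MonoidalPreadditive C]

theorem bar_tensor_ext {Y : C} {f g : bar A ⊗ bar B ⟶ Y}
    (h : ∀ u v, (barι A u ⊗ₘ barι B v) ≫ f = (barι A u ⊗ₘ barι B v) ≫ g) : f = g :=
  bar_whiskerRight_ext fun u => whiskerLeft_bar_ext fun v => by
    simpa only [MonoidalCategory.tensorHom_def', Category.assoc] using h u v

theorem whiskerLeft_units_smul {X Y Z : C} (e : ℤˣ) (f : Y ⟶ Z) : X ◁ (e • f) = e • (X ◁ f) := by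
  rcases Int.units_eq_one_or e with rfl | rfl
  · simp
  · rw [Units.neg_smul, Units.neg_smul, one_smul, one_smul, eq_neg_iff_add_eq_zero,
      ← MonoidalPreadditive.whiskerLeft_add, neg_add_cancel, MonoidalPreadditive.whiskerLeft_zero]

theorem units_smul_whiskerRight {X Y Z : C} (e : ℤˣ) (f : Y ⟶ Z) : (e • f) ▷ X = e • (f ▷ X) := by
  rcases Int.units_eq_one_or e with rfl | rfl
  · simp
  · rw [Units.neg_smul, Units.neg_smul, one_smul, one_smul, eq_neg_iff_add_eq_zero,
      ← MonoidalPreadditive.add_whiskerRight, neg_add_cancel,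
      MonoidalPreadditive.zero_whiskerRight]

theorem units_smul_tensor {X Y Z W : C} (e : ℤˣ) (f : Y ⟶ Z) (g : X ⟶ W) :
    (e • f) ⊗ₘ g = e • (f ⊗ₘ g) := by
  rw [MonoidalCategory.tensorHom_def, MonoidalCategory.tensorHom_def, units_smul_whiskerRight,
    Linear.units_smul_comp]

theorem tensor_units_smul {X Y Z W : C} (e : ℤˣ) (f : Y ⟶ Z) (g : X ⟶ W) :
    f ⊗ₘ (e • g) = e • (f ⊗ₘ g) := by
  rw [MonoidalCategory.tensorHom_def, MonoidalCategory.tensorHom_def, whiskerLeft_units_smul,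
    Linear.comp_units_smul]

theorem proj_tensor_proj_barMul (A : GradedObject ℤ C) (d e f : ℤ) (h : d + e = f) :
    (((proj d : bar A ⟶ bar A) ⊗ₘ (proj e : bar A ⟶ bar A)) ≫ barMul A) ≫ proj f =
      (proj d ⊗ₘ proj e) ≫ barMul A := by
  refine bar_tensor_ext fun u v => ?_
  simp only [← Category.assoc, tensorHom_comp_tensorHom]
  by_cases hu : wordDeg u = d
  · by_cases hv : wordDeg v = e
    · rw [barι_proj _ _ _ hu, barι_proj _ _ _ hv, barι_tensor_barι_barMul, Category.assoc,
        barι_proj _ _ _ (by rw [wordDeg_append]; omega)]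
    · simp [barι_proj_ne _ _ _ hv]
  · simp [barι_proj_ne _ _ _ hu]

theorem HasDegree.mul {M N : bar A ⟶ bar B} {r s t : ℤ} (hM : HasDegree r M) (hN : HasDegree s N)
    (h : r + s = t) : HasDegree t (M * N) := by
  refine hasDegree_bar_iff.2 fun w d hd => ?_
  rw [conv_eq, ← Category.assoc, barι_comulPair, Preadditive.sum_comp, Preadditive.sum_comp]
  refine Finset.sum_congr rfl fun i _ => ?_
  have h1 := hasDegree_bar_iff.1 hM (w.take i) _ rfl
  have h2 := hasDegree_bar_iff.1 hN (w.drop i) _ rfl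
  have h3 := wordDeg_append (w.take i) (w.drop i)
  rw [List.take_append_drop] at h3
  rw [← h1, ← h2, ← tensorHom_comp_tensorHom]
  simp only [Category.assoc]
  have h4 := proj_tensor_proj_barMul B (wordDeg (w.take i) + r) (wordDeg (w.drop i) + s) d
    (by omega)
  rw [Category.assoc] at h4
  rw [h4]

theorem hasDegree_one : HasDegree 0 (1 : bar A ⟶ bar B) :=
  hasDegree_bar_iff.2 fun w d h => by
    rw [convOne_eq]
    cases w with
    | nil => rw [Category.assoc, Category.assoc, nilMap, Category.assoc,
        barι_proj B [] d (by simpa using h)]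
    | cons p w => rw [← Category.assoc, barι_cons_barCounit]; simp

theorem HasDegree.pow {M : bar A ⟶ bar B} (hM : HasDegree 0 M) (n : ℕ) : HasDegree 0 (M ^ n) := by
  induction n with
  | zero => rw [pow_zero]; exact hasDegree_one
  | succ n ih => rw [pow_succ]; exact ih.mul hM rfl

theorem HasDegree.sum {X Y : C} [HasGrading X] [HasGrading Y] {ι : Type*} {s : Finset ι} {r : ℤ}
    {f : ι → (X ⟶ Y)} (h : ∀ i ∈ s, HasDegree r (f i)) : HasDegree r (∑ i ∈ s, f i) := by
  intro d e hde
  rw [Preadditive.comp_sum, Preadditive.sum_comp]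
  exact Finset.sum_congr rfl fun i hi => h i hi d e hde

theorem HasDegree.barHom {f : bar A ⟶ tot B} (hf : HasDegree 0 f) :
    HasDegree 0 (AInfinity.barHom f) := by
  refine hasDegree_bar_iff.2 fun w d h => ?_
  rw [AInfinity.barHom, barι_barDesc]
  exact hasDegree_bar_iff.1 (HasDegree.sum fun i _ =>
    (hf.comp (hasDegree_letterMap _) rfl).pow i) w d h

/-- The degree is additive under concatenation. Since the convolution product carries no Koszul
signs, an odd map is treated as a coderivation along `barSign` and the identity. -/
theorem isGroupLike_sign (A : GradedObject ℤ C) : IsGroupLike (barSign A) where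
  nilMap_comp := by
    rw [nilMap, Category.assoc, barι_sign, wordDeg_nil, Int.negOnePow_zero, one_smul]
  comp_barCounit := by
    refine bar_ext fun w => ?_
    rw [← Category.assoc, barι_sign]
    cases w with
    | nil => simp
    | cons p w => rw [Linear.units_smul_comp, barι_cons_barCounit, smul_zero]
  comp_barComul := by
    have h : ∀ {u v w : List ℤ}, u ++ v = w → 
        ((wordDeg w).negOnePow : ℤˣ) = (wordDeg u).negOnePow * (wordDeg v).negOnePow := by
      rintro u v _ rfl
      rw [wordDeg_append, Int.negOnePow_add]
    refine bar_ext fun w => ?_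
    rw [barι_comulPair, ← Category.assoc, barι_sign, Linear.units_smul_comp, barι_barComul_eq_sum,
      Finset.smul_sum]
    refine Finset.sum_congr rfl fun i _ => ?_
    rw [barι_sign, barι_sign, units_smul_tensor, tensor_units_smul, smul_smul,
      ← h (List.take_append_drop i w), Linear.comp_units_smul]

theorem barHom_sign {f : bar A ⟶ tot B} (hd : HasDegree 0 f) :
    barSign A ≫ barHom f = barHom f ≫ barSign B := by
  rw [hd.barHom.sign_comp, Int.negOnePow_zero, one_smul]

/-- The coderivation of `bar A` with a given corestriction. -/
noncomputable def barDer (b : bar A ⟶ tot A) : bar A ⟶ bar A :=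
  barSign A * (b ≫ letterMap A) * 𝟙 (bar A)

theorem isCoderivation_barDer (b : bar A ⟶ tot A) :
    IsCoderivation (barSign A) (𝟙 (bar A)) (barDer b) :=
  (isGroupLike_sign _).isCoderivation (isGroupLike_id A) b

theorem barDer_letterProj (b : bar A ⟶ tot A) : barDer b ≫ letterProj A = b :=
  (isGroupLike_sign _).conv_comp_letterProj (isGroupLike_id A) b

theorem HasDegree.barDer {b : bar A ⟶ tot A} {r : ℤ} (hb : HasDegree r b) :
    HasDegree r (AInfinity.barDer b) :=
  ((hasDegree_sign A).mul (hb.comp (hasDegree_letterMap _) (add_zero r)) (zero_add r)).mul (hasDegree_id A)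
    (add_zero r)

theorem IsCoderivation.comp_isGroupLike {F G L : bar A ⟶ bar B} (hL : IsCoderivation F G L)
    {H : bar B ⟶ bar E} (hH : IsGroupLike H) : IsCoderivation (F ≫ H) (G ≫ H) (L ≫ H) := by
  rw [IsCoderivation, Category.assoc, hH.comp_barComul, hL.comp_comulPair]

theorem IsGroupLike.comp_isCoderivation {F G L : bar B ⟶ bar E} {H : bar A ⟶ bar B}
    (hH : IsGroupLike H) (hL : IsCoderivation F G L) :
    IsCoderivation (H ≫ F) (H ≫ G) (H ≫ L) := by
  rw [IsCoderivation, Category.assoc, hL, Preadditive.comp_add, hH.comp_comulPair,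
    hH.comp_comulPair]

theorem IsCoderivation.sub {F G L L' : bar A ⟶ bar B} (hL : IsCoderivation F G L)
    (hL' : IsCoderivation F G L') : IsCoderivation F G (L - L') := by
  rw [IsCoderivation, Preadditive.sub_comp, hL, hL']
  have h1 := comulPair_add_left (L - L') L' G
  have h2 := comulPair_add_right F (L - L') L'
  rw [sub_add_cancel] at h1 h2
  rw [h1, h2]
  abel

/-- Both composites are coderivations along the same pair, because F has degree 0 and commutes with
the sign operators. Their difference is therefore determined by its corestriction, so the failure to
be a chain map is governed by D f - F b alone. -/
theorem barDer_comp_barHom_sub {f : bar A ⟶ tot B} (hf : f ∈ barFil A _ 1) (hd : HasDegree 0 f)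
    (a : bar A ⟶ tot A) (b : bar B ⟶ tot B) :
    barDer a ≫ barHom f - barHom f ≫ barDer b =
      (barSign A ≫ barHom f) * ((barDer a ≫ f - barHom f ≫ b) ≫ letterMap B) * barHom f := by
  have hF := isGroupLike_barHom hf
  have h1 := (isCoderivation_barDer a).comp_isGroupLike hF
  have h2 := hF.comp_isCoderivation (isCoderivation_barDer b)
  rw [Category.id_comp] at h1
  rw [Category.comp_id, ← barHom_sign hd] at h2
  have h := (h1.sub h2).eq_conv ((isGroupLike_sign _).comp hF) hF
  rwa [Preadditive.sub_comp, Category.assoc, Category.assoc, barHom_letterProj hf,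
    barDer_letterProj] at h

/-- In D² the two orders of applying `b` at disjoint places cancel, since D anticommutes with
`barSign`. The nested applications add up to D b = 0. -/
theorem barDer_comp_barDer {b : bar A ⟶ tot A} (hb : HasDegree 1 b) (h : barDer b ≫ b = 0) :
    barDer b ≫ barDer b = 0 := by
  have hs : barDer b ≫ barSign A = - (barSign A ≫ barDer b) := by
    rw [hb.barDer.sign_comp]
    simp
  have hE : barSign A ≫ barDer b = 𝟙 _ * (barSign A ≫ b ≫ letterMap A) * barSign A := by
    rw [barDer, (isGroupLike_sign _).comp_mul, (isGroupLike_sign _).comp_mul, sign_sign,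
      Category.comp_id]
  have h1 : barDer b ≫ (barSign A * (b ≫ letterMap A)) =
      - ((barSign A ≫ barDer b) * (b ≫ letterMap A)) := by
    rw [(isCoderivation_barDer b).comp_mul, hs, reassoc_of% h, zero_comp, mul_zero, add_zero,
      Category.id_comp, neg_mul]
  have h2 : barSign A ≫ (barSign A * (b ≫ letterMap A)) =
      𝟙 _ * (barSign A ≫ b ≫ letterMap A) := by
    rw [(isGroupLike_sign _).comp_mul, sign_sign]
  have h3 : barDer b ≫ (barSign A * (b ≫ letterMap A) * 𝟙 (bar A)) = 0 := by
    rw [(isCoderivation_barDer b).comp_mul, h1, h2, hE, Category.comp_id, Category.comp_id, barDer]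
    noncomm_ring
  exact h3

/-- The projection to the words of length less than `n`. -/
noncomputable def barTrunc (A : GradedObject ℤ C) (n : ℕ) : bar A ⟶ bar A :=
  barDesc fun w => if w.length < n then barι A w else 0

theorem barι_trunc (A : GradedObject ℤ C) (w : List ℤ) (n : ℕ) (h : w.length < n) :
    barι A w ≫ barTrunc A n = barι A w :=
  (barι_barDesc _ w).trans (if_pos h)

theorem barι_trunc_ge (A : GradedObject ℤ C) (w : List ℤ) (n : ℕ) (h : n ≤ w.length) :
    barι A w ≫ barTrunc A n = 0 :=
  (barι_barDesc _ w).trans (if_neg h.not_gt)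

theorem barTrunc_comp {n : ℕ} {Y : C} {f : bar A ⟶ Y} (hf : f ∈ barFil A Y n) :
    barTrunc A n ≫ f = 0 := by
  refine bar_ext fun w => ?_
  rw [← Category.assoc, comp_zero]
  rcases lt_or_ge w.length n with h | h
  · rw [barι_trunc A w n h, hf w h]
  · rw [barι_trunc_ge A w n h, zero_comp]

theorem letterMap_trunc (A : GradedObject ℤ C) : letterMap A ≫ barTrunc A 2 = letterMap A :=
  tot_ext fun p => by
    rw [← Category.assoc, totι_letterMap, Category.assoc, barι_trunc A [p] 2 (by simp)]

/-- Words of lengths at most m - 1 and n - 1 concatenate to length at most m + n - 2, which is less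
than k. This bounds the length of the output, whereas `barFil` controls the length of the input. -/
theorem trunc_tensor_trunc_barMul (A : GradedObject ℤ C) (m n k : ℕ) (h : m + n ≤ k + 1) :
    (barTrunc A m ⊗ₘ barTrunc A n) ≫ barMul A ≫ barTrunc A k =
      (barTrunc A m ⊗ₘ barTrunc A n) ≫ barMul A := by
  refine bar_tensor_ext fun u v => ?_
  simp only [tensorHom_comp_tensorHom_assoc]
  rcases lt_or_ge u.length m with hu | hu
  · rcases lt_or_ge v.length n with hv | hv
    · rw [barι_trunc _ _ _ hu, barι_trunc _ _ _ hv, ← Category.assoc, barι_tensor_barι_barMul,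
        Category.assoc, barι_trunc _ _ _ (by rw [List.length_append]; omega)]
    · simp [barι_trunc_ge _ _ _ hv]
  · simp [barι_trunc_ge _ _ _ hu]

/-- A coderivation whose corestriction vanishes on words of length one shortens words. -/
theorem barDer_comp_mem_barFil {a : bar A ⟶ tot A} (ha : a ∈ barFil A _ 2) {n : ℕ} {Y : C}
    {f : bar A ⟶ Y} (hf : f ∈ barFil A Y n) : barDer a ≫ f ∈ barFil A Y (n + 1) := by
  -- Here `a` consumes at least two letters and returns one, so every surviving term has fewer
  -- letters than w.
  have h1 : ∀ w : List ℤ, (barι A w ≫ ((a ≫ letterMap A) * 𝟙 (bar A))) ≫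
      barTrunc A (max 1 w.length) = barι A w ≫ ((a ≫ letterMap A) * 𝟙 (bar A)) := by
    intro w
    rw [conv_eq, ← Category.assoc, barι_comulPair, Preadditive.sum_comp, Preadditive.sum_comp]
    refine Finset.sum_congr rfl fun i hi => ?_
    rcases lt_or_ge (w.take i).length 2 with h | h
    · simp only [← Category.assoc, ha _ h, zero_comp]
      simp
    · rw [List.length_take] at h
      rw [Category.comp_id, ← barι_trunc A (w.drop i) (w.length - i + 1) (by simp),
        ← letterMap_trunc, ← Category.assoc, ← Category.assoc, ← tensorHom_comp_tensorHom]
      simp only [Category.assoc]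
      rw [trunc_tensor_trunc_barMul]
      omega
  intro w hw
  rw [barDer, mul_assoc, conv_eq, ← Category.assoc, ← Category.assoc, barι_comulPair,
    Preadditive.sum_comp, Preadditive.sum_comp]
  refine Finset.sum_eq_zero fun i hi => ?_
  rw [barι_sign, ← h1, units_smul_tensor, ← barι_trunc A (w.take i) ((w.take i).length + 1)
    (Nat.lt_succ_self _), ← tensorHom_comp_tensorHom]
  rcases lt_or_ge (w.drop i).length 2 with h | h
  · have h2 : barι A (w.drop i) ≫ ((a ≫ letterMap A) * 𝟙 (bar A)) = 0 :=
      conv_mem_barFil (comp_mem_barFil ha _) (mem_barFil_zero _) (by omega) _ h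
    rw [h2]
    simp
  · have h2 := trunc_tensor_trunc_barMul A ((w.take i).length + 1)
      (max 1 (w.drop i).length) n (by simp at h ⊢; omega)
    simp only [Linear.units_smul_comp, Linear.comp_units_smul, Category.assoc]
    rw [← reassoc_of% h2, barTrunc_comp hf]
    simp

end Grading

/-! ### Homotopy transfer on the bar construction -/

section Transfer

variable {C : Type u} [Category.{v} C] [MonoidalCategory C] [HasCoproducts.{0} C]
  [TensorPreservesCoproducts C] [Preadditive C] [MonoidalPreadditive C]
  {A B V E : GradedObject ℤ C} {Y : C}

theorem IsGroupLike.sub_one_mem {F : bar A ⟶ bar B} (hF : IsGroupLike F) :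
    F - 1 ∈ barFil A _ 1 := by
  rw [mem_barFil_one, Preadditive.comp_sub, hF.nilMap_comp, nilMap_comp_one, sub_self]

/-- Both F - 1 and G - 1 have filtration 1, so multiplying by F and G does not change the leading
term of x. All contraction estimates rest on this. -/
theorem IsGroupLike.conv_sub_mem {F G : bar A ⟶ bar B} (hF : IsGroupLike F) (hG : IsGroupLike G)
    {x : bar A ⟶ bar B} {n : ℕ} (hx : x ∈ barFil A _ n) : F * x * G - x ∈ barFil A _ (n + 1) := by
  have h : F * x * G - x = (F - 1) * (x * G) + x * (G - 1) := by noncomm_ring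
  rw [h]
  exact add_mem (conv_mem_barFil hF.sub_one_mem
    (conv_mem_barFil hx (mem_barFil_zero _) le_rfl) (by omega))
    (conv_mem_barFil hx hG.sub_one_mem le_rfl)

theorem IsGroupLike.conv_comp_sub_mem {F G : bar A ⟶ bar B} (hF : IsGroupLike F)
    (hG : IsGroupLike G) {k : bar A ⟶ tot B} {n : ℕ} (hk : k ∈ barFil A _ n) (φ : bar B ⟶ Y) :
    (F * (k ≫ letterMap B) * G) ≫ φ - k ≫ letterMap B ≫ φ ∈ barFil A _ (n + 1) := by
  rw [← Category.assoc k, ← Preadditive.sub_comp]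
  exact comp_mem_barFil (hF.conv_sub_mem hG (comp_mem_barFil hk _)) _

/-- The resolvent identity u⁻¹ - v⁻¹ = u⁻¹(v - u)v⁻¹ for u = 1 - f and v = 1 - f'. -/
theorem barHom_sub_barHom {f f' : bar A ⟶ tot B} (hf : f ∈ barFil A _ 1)
    (hf' : f' ∈ barFil A _ 1) :
    barHom f - barHom f' = barHom f * ((f - f') ≫ letterMap B) * barHom f' := by
  have h1 := barHom_mul hf
  have h2 := mul_barHom hf'
  have h3 : (f - f') ≫ letterMap B = (1 - f' ≫ letterMap B) - (1 - f ≫ letterMap B) := by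
    rw [Preadditive.sub_comp]
    abel
  rw [h3, mul_sub, sub_mul, mul_assoc, h2, h1, mul_one, one_mul]

theorem mem_barFil_two {f : bar A ⟶ Y} (h1 : f ∈ barFil A _ 1) (h2 : letterMap A ≫ f = 0) :
    f ∈ barFil A _ 2 := by
  intro w hw
  rcases Nat.lt_or_ge w.length 1 with h | h
  · exact h1 w h
  · obtain ⟨p, rfl⟩ := List.length_eq_one_iff.1 (by omega : w.length = 1)
    have := totι A p ≫= h2
    rw [← Category.assoc, totι_letterMap, Category.assoc, comp_zero] at this
    rw [← cancel_epi (wordOne A p).hom, this, comp_zero]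

theorem letterMap_comp_eq_zero {f : bar A ⟶ Y} (h : f ∈ barFil A _ 2) : letterMap A ≫ f = 0 :=
  tot_ext fun p => by
    rw [← Category.assoc, totι_letterMap, Category.assoc, h [p] (by simp), comp_zero, comp_zero]

/-- Degree and vanishing on short words are tested one word at a time. This is the locality that
`exists_fixedPoint` asks of its set of candidates. -/
theorem hasDegree_mem_local {Y : C} [HasGrading Y] {r : ℤ} {n : ℕ} {f : bar A ⟶ Y}
    (h : ∀ w, ∃ g ∈ {g : bar A ⟶ Y | HasDegree r g ∧ g ∈ barFil A _ n},
      barι A w ≫ f = barι A w ≫ g) : f ∈ {g : bar A ⟶ Y | HasDegree r g ∧ g ∈ barFil A _ n} := by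
  constructor
  · refine hasDegree_bar_iff.2 fun w d hd => ?_
    obtain ⟨g, hg, e⟩ := h w
    rw [e]
    exact hasDegree_bar_iff.1 hg.1 w d hd
  · intro w hw
    obtain ⟨g, hg, e⟩ := h w
    rw [e]
    exact hg.2 w hw

/-- Transfer of a codifferential along a morphism of complexes `g` with a one-sided homotopy
inverse `p`. -/
theorem exists_transfer {b : bar A ⟶ tot A} (hb : HasDegree 1 b) (hb1 : b ∈ barFil A _ 1)
    (hbb : barDer b ≫ b = 0) {m : tot A ⟶ tot A} (hm : letterMap A ≫ b = m) (hmm : m ≫ m = 0)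
    {d : tot V ⟶ tot V} {g : tot V ⟶ tot A} {p : tot A ⟶ tot V} {h : tot A ⟶ tot A}
    (hd : HasDegree 1 d) (hg : HasDegree 0 g) (hp : HasDegree 0 p) (hh : HasDegree (-1) h)
    (hdd : d ≫ d = 0) (hdg : d ≫ g = g ≫ m) (hmp : m ≫ p = p ≫ d)
    (hpg : p ≫ g = 𝟙 _ + m ≫ h + h ≫ m) :
    ∃ (c : bar V ⟶ tot V) (f : bar V ⟶ tot A), HasDegree 1 c ∧ c ∈ barFil V _ 1 ∧
      barDer c ≫ c = 0 ∧ letterMap V ≫ c = d ∧ HasDegree 0 f ∧ f ∈ barFil V _ 1 ∧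
      barDer c ≫ f = barHom f ≫ b ∧ letterMap V ≫ f = g ∧
      c = letterProj V ≫ d + barHom f ≫ (b - letterProj A ≫ m) ≫ p := by
  have hmd : HasDegree 1 m := hm ▸ (hasDegree_letterMap A).comp hb (zero_add 1)
  obtain ⟨b2, hb2⟩ : ∃ b2, b2 = b - letterProj A ≫ m := ⟨_, rfl⟩
  have hb2d : HasDegree 1 b2 := hb2 ▸ hb.sub ((hasDegree_letterProj A).comp hmd (zero_add 1))
  have hηb2 : letterMap A ≫ b2 = 0 := by
    rw [hb2, Preadditive.comp_sub, hm, ← Category.assoc, letterMap_letterProj, Category.id_comp,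
      sub_self]
  have hb21 : b2 ∈ barFil A _ 1 :=
    hb2 ▸ sub_mem hb1 (comp_mem_barFil (letterProj_mem A) m)
  have hF1 : ∀ {f : bar V ⟶ tot A}, f ∈ barFil V _ 1 → ∀ {Y : C} {φ : bar A ⟶ Y},
      φ ∈ barFil A _ 1 → barHom f ≫ φ ∈ barFil V _ 1 := by
    intro f hf Y φ hφ
    rw [mem_barFil_one, ← Category.assoc, (isGroupLike_barHom hf).nilMap_comp]
    exact mem_barFil_one.1 hφ
  -- Unrolling this equation gives the sum over planar trees with `g` at the leaves, `b2` at the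
  -- vertices and `h` on the inner edges and at the root.
  obtain ⟨f, ⟨hf0, hf1⟩, hf⟩ := exists_fixedPoint
    {f : bar V ⟶ tot A | HasDegree 0 f ∧ f ∈ barFil V _ 1}
    (fun f => letterProj V ≫ g + (barHom f ≫ b2) ≫ h)
    ⟨0, hasDegree_zero 0, zero_mem _⟩
    (fun f hf => ⟨((hasDegree_letterProj V).comp hg (zero_add 0)).add
      ((hf.1.barHom.comp hb2d (zero_add 1)).comp hh (by norm_num)),
      add_mem (comp_mem_barFil (letterProj_mem V) g) (comp_mem_barFil (hF1 hf.2 hb21) h)⟩)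
    (fun f hf => hasDegree_mem_local hf)
    (fun f hf f' hf' n hn => by
      -- By the resolvent identity the leading term of the difference is (f - f') followed by `b2`
      -- on single letters, which is zero. This gains one step of the filtration.
      have h1 := (isGroupLike_barHom hf.2).conv_comp_sub_mem (isGroupLike_barHom hf'.2) hn b2
      rw [hηb2, comp_zero, sub_zero, ← barHom_sub_barHom hf.2 hf'.2, Preadditive.sub_comp] at h1
      rw [add_sub_add_left_eq_sub, ← Preadditive.sub_comp]
      exact comp_mem_barFil h1 h)
  obtain ⟨X, hX⟩ : ∃ X, X = barHom f ≫ b2 := ⟨_, rfl⟩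
  rw [← hX] at hf
  obtain ⟨c, hc⟩ : ∃ c, c = letterProj V ≫ d + X ≫ p := ⟨_, rfl⟩
  have hFf := isGroupLike_barHom hf1
  -- The same estimate with f compared to 0: the series of 0 is 1, and `b2` kills the empty word.
  have hX1 : X ∈ barFil V _ 2 := by
    have h0 := isGroupLike_barHom (zero_mem (barFil V (tot A) 1))
    have h1 := hFf.conv_comp_sub_mem h0 hf1 b2
    have h2 := barHom_sub_barHom hf1 (zero_mem (barFil V (tot A) 1))
    have h3 := barHom_mul (zero_mem (barFil V (tot A) 1))
    rw [zero_comp, sub_zero, mul_one] at h3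
    rw [sub_zero] at h2
    rwa [hηb2, comp_zero, sub_zero, ← h2, Preadditive.sub_comp, h3, convOne_eq, Category.assoc,
      mem_barFil_one.1 hb21, comp_zero, sub_zero, ← hX] at h1
  have hfT : barHom f ≫ b = f ≫ m + X := by
    rw [hX, hb2, Preadditive.comp_sub, ← Category.assoc, barHom_letterProj hf1]
    abel
  obtain ⟨Z, hZ⟩ : ∃ Z, Z = barDer c ≫ f - barHom f ≫ b := ⟨_, rfl⟩
  have hΘ := barDer_comp_barHom_sub hf1 hf0 c b
  rw [← hZ] at hΘ
  -- Commute D past F at the cost of the defect term in Z, then use D b = 0 and m² = 0.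
  have hDX : barDer c ≫ X = - X ≫ m +
      ((barSign V ≫ barHom f) * (Z ≫ letterMap A) * barHom f) ≫ b2 := by
    have h1 : barDer b ≫ b2 = - b ≫ m := by
      rw [hb2, Preadditive.comp_sub, hbb, ← Category.assoc, barDer_letterProj, zero_sub]
    rw [← hΘ, Preadditive.sub_comp, Category.assoc, Category.assoc, ← hX, h1,
      Preadditive.comp_neg, ← Category.assoc, hfT,
      Preadditive.add_comp, Category.assoc, hmm, comp_zero]
    abel
  -- Expanding D f with pg = 1 + mh + hm reproduces F b, except for the defect term of `hDX`
  -- followed by `h`. The resulting equation is homogeneous in Z and contracting.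
  have hZeq : Z = (((barSign V ≫ barHom f) * (Z ≫ letterMap A) * barHom f) ≫ b2) ≫ h := by
    obtain ⟨W, hW⟩ : ∃ W, W = ((barSign V ≫ barHom f) * (Z ≫ letterMap A) * barHom f) ≫ b2 :=
      ⟨_, rfl⟩
    rw [← hW] at hDX ⊢
    have h1 : barDer c ≫ f = c ≫ g + (barDer c ≫ X) ≫ h := by
      conv_lhs => rw [← hf]
      rw [Preadditive.comp_add, ← Category.assoc, barDer_letterProj, Category.assoc]
    conv_lhs => rw [hZ, h1, hfT, hDX, hc, ← hf]
    simp only [Preadditive.add_comp, Preadditive.neg_comp, Category.assoc, hdg, hpg,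
      Preadditive.comp_add, Category.comp_id]
    abel
  have hZ0 : Z = 0 := eq_zero_of_mem_barFil fun n hn => by
    have h1 := ((isGroupLike_sign V).comp hFf).conv_comp_sub_mem hFf hn b2
    rw [hηb2, comp_zero, sub_zero] at h1
    rw [hZeq]
    exact comp_mem_barFil h1 h
  -- Once Z = 0, D X = -Xm, and the two remaining terms X p d and -X m p cancel because p is a chain
  -- map.
  have hcc : barDer c ≫ c = 0 := by
    rw [hZ0, zero_comp, mul_zero, zero_mul, zero_comp, add_zero] at hDX
    refine (congrArg (barDer c ≫ ·) hc).trans ?_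
    rw [Preadditive.comp_add, ← Category.assoc, barDer_letterProj, ← Category.assoc, hDX, hc]
    simp only [Preadditive.add_comp, Category.assoc, hdd, Preadditive.neg_comp, hmp, comp_zero]
    abel
  refine ⟨c, f, ?_, ?_, hcc, ?_, hf0, hf1, ?_, ?_, ?_⟩
  · rw [hc]
    exact ((hasDegree_letterProj V).comp hd (zero_add 1)).add
      ((hX ▸ hf0.barHom.comp hb2d (zero_add 1)).comp hp (add_zero 1))
  · rw [hc]
    exact add_mem (comp_mem_barFil (letterProj_mem V) d)
      (comp_mem_barFil (barFil_anti one_le_two hX1) p)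
  · rw [hc, Preadditive.comp_add, ← Category.assoc, letterMap_letterProj, Category.id_comp,
      ← Category.assoc, letterMap_comp_eq_zero hX1, zero_comp, add_zero]
  · rwa [hZ, sub_eq_zero] at hZ0
  · rw [← hf, Preadditive.comp_add, ← Category.assoc, letterMap_letterProj, Category.id_comp,
      ← Category.assoc, letterMap_comp_eq_zero hX1, zero_comp, add_zero]
  · rw [hc, hX, hb2, Category.assoc]

end Transfer

/-! ### Homotopies between coalgebra morphisms -/

section Lifting

variable {C : Type u} [Category.{v} C] [MonoidalCategory C] [HasCoproducts.{0} C]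
  [TensorPreservesCoproducts C] [Preadditive C] [MonoidalPreadditive C]
  {A B H H' E : GradedObject ℤ C} {Y : C}

theorem barHom_comp_mem_one {f : bar A ⟶ tot B} (hf : f ∈ barFil A _ 1) {φ : bar B ⟶ Y}
    (hφ : φ ∈ barFil B _ 1) : barHom f ≫ φ ∈ barFil A _ 1 := by
  rw [mem_barFil_one, ← Category.assoc, (isGroupLike_barHom hf).nilMap_comp]
  exact mem_barFil_one.1 hφ

theorem barHom_comp_mem_two {f : bar A ⟶ tot B} (hf : f ∈ barFil A _ 1) {φ : bar B ⟶ Y}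
    (hφ : φ ∈ barFil B _ 1) (hηφ : letterMap B ≫ φ = 0) : barHom f ≫ φ ∈ barFil A _ 2 := by
  have h0 := zero_mem (barFil A (tot B) 1)
  have h1 := (isGroupLike_barHom hf).conv_comp_sub_mem (isGroupLike_barHom h0) hf φ
  have h2 := barHom_sub_barHom hf h0
  have h3 := barHom_mul h0
  rw [zero_comp, sub_zero, mul_one] at h3
  rw [sub_zero] at h2
  rwa [hηφ, comp_zero, sub_zero, ← h2, Preadditive.sub_comp, h3, convOne_eq, Category.assoc,
    mem_barFil_one.1 hφ, comp_zero, sub_zero] at h1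

theorem barSign_comp_mem {f : bar A ⟶ Y} {n : ℕ} (hf : f ∈ barFil A _ n) :
    barSign A ≫ f ∈ barFil A _ n := fun w hw => by
  rw [← Category.assoc, barι_sign, Linear.units_smul_comp, hf w hw, smul_zero]

/-- The coderivation rule applied to 1 · 1 = 1 gives x = x + x. -/
theorem IsCoderivation.comp_one {F G L : bar A ⟶ bar B} (hL : IsCoderivation F G L)
    (hF : IsGroupLike F) (hG : IsGroupLike G) : L ≫ (1 : bar B ⟶ bar E) = 0 := by
  have h := hL.comp_mul (1 : bar B ⟶ bar E) 1
  rw [hF.comp_one, hG.comp_one, mul_one, mul_one, one_mul] at h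
  simpa using h

theorem barDer_comp_barHom {a : bar A ⟶ tot A} {b : bar B ⟶ tot B} {f : bar A ⟶ tot B}
    (hf : f ∈ barFil A _ 1) (hd : HasDegree 0 f) (h : barDer a ≫ f = barHom f ≫ b) :
    barDer a ≫ barHom f = barHom f ≫ barDer b := by
  rw [← sub_eq_zero, barDer_comp_barHom_sub hf hd, h, sub_self, zero_comp, mul_zero, zero_mul]

/-- The homotopy between `barHom ψ` and `barHom f` with corestriction `k`. -/
noncomputable def barHtpy (ψ f k : bar A ⟶ tot B) : bar A ⟶ bar B :=
  (barSign A ≫ barHom ψ) * (k ≫ letterMap B) * barHom f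

theorem barHtpy_letterProj {ψ f : bar A ⟶ tot B} (hψ : ψ ∈ barFil A _ 1) (hf : f ∈ barFil A _ 1)
    (k : bar A ⟶ tot B) : barHtpy ψ f k ≫ letterProj B = k :=
  ((isGroupLike_sign _).comp (isGroupLike_barHom hψ)).conv_comp_letterProj (isGroupLike_barHom hf) k

theorem isCoderivation_barHtpy {ψ f : bar A ⟶ tot B} (hψ : ψ ∈ barFil A _ 1)
    (hf : f ∈ barFil A _ 1) (k : bar A ⟶ tot B) :
    IsCoderivation (barSign A ≫ barHom ψ) (barHom f) (barHtpy ψ f k) :=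
  ((isGroupLike_sign _).comp (isGroupLike_barHom hψ)).isCoderivation (isGroupLike_barHom hf) k

theorem barHtpy_mem {ψ f k : bar A ⟶ tot B} {n : ℕ} (hk : k ∈ barFil A _ n) :
    barHtpy ψ f k ∈ barFil A _ n :=
  conv_mem_barFil (conv_mem_barFil (mem_barFil_zero _) (comp_mem_barFil hk _) (zero_add n).ge)
    (mem_barFil_zero _) le_rfl

theorem barHtpy_comp_sub_mem {ψ f : bar A ⟶ tot B} (hψ : ψ ∈ barFil A _ 1) (hf : f ∈ barFil A _ 1)
    {k : bar A ⟶ tot B} {n : ℕ} (hk : k ∈ barFil A _ n) (φ : bar B ⟶ Y) :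
    barHtpy ψ f k ≫ φ - k ≫ letterMap B ≫ φ ∈ barFil A _ (n + 1) :=
  ((isGroupLike_sign _).comp (isGroupLike_barHom hψ)).conv_comp_sub_mem (isGroupLike_barHom hf) hk φ

theorem HasDegree.barHtpy {ψ f k : bar A ⟶ tot B} (hψ : HasDegree 0 ψ) (hf : HasDegree 0 f) {r : ℤ}
    (hk : HasDegree r k) : HasDegree r (barHtpy ψ f k) :=
  (((hasDegree_sign A).comp hψ.barHom (add_zero 0)).mul
    (hk.comp (hasDegree_letterMap B) (add_zero r)) (zero_add r)).mul hf.barHom (add_zero r)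

/-- The boundary of the homotopy `barHtpy ψ f k`. -/
theorem barHtpy_boundary {a : bar A ⟶ tot A} {b : bar B ⟶ tot B} {ψ f k : bar A ⟶ tot B}
    (ha : HasDegree 1 a)
    (hψ : ψ ∈ barFil A _ 1) (hf : f ∈ barFil A _ 1) (hf0 : HasDegree 0 f)
    (hψ0 : HasDegree 0 ψ) (hk : HasDegree (-1) k) (haf : barDer a ≫ f = barHom f ≫ b) :
    barHtpy ψ f k ≫ barDer b + barDer a ≫ barHtpy ψ f k + barHom ψ - barHom f =
      barHom ψ * ((barHtpy ψ f k ≫ b + barDer a ≫ k + ψ - f) ≫ letterMap B) * barHom f -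
        (barSign A ≫ (barDer a ≫ barHom ψ - barHom ψ ≫ barDer b)) * (k ≫ letterMap B) *
          barHom f := by
  have hK := isCoderivation_barHtpy hψ hf k
  have hKπ := barHtpy_letterProj hψ hf k
  have hKE := (hψ0.barHtpy hf0 hk).sign_comp
  obtain ⟨K, hK'⟩ : ∃ K, K = barHtpy ψ f k := ⟨_, rfl⟩
  rw [← hK'] at hK hKπ hKE ⊢
  have hF := isGroupLike_barHom hf
  have hP := isGroupLike_barHom hψ
  have hS := isGroupLike_sign A
  have hDf := barDer_comp_barHom hf hf0 haf
  have hDE : barDer a ≫ barSign A = - (barSign A ≫ barDer a) := by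
    rw [ha.barDer.sign_comp]; simp
  have hKE' : barSign A ≫ K = - (K ≫ barSign B) := by rw [hKE]; simp
  have hDa := isCoderivation_barDer a
  have hDb := isCoderivation_barDer b
  -- The series of ψ is not assumed to commute with the differentials, so R is a coderivation only
  -- up to a term in its defect. Allowing this defect lets the formula be used before the lift is
  -- known to be a morphism.
  obtain ⟨R, hR⟩ : ∃ R, R = K ≫ barDer b + barDer a ≫ K + barHom ψ - barHom f := ⟨_, rfl⟩
  have hR1 : R ≫ (1 : bar B ⟶ bar B) = 0 := by
    rw [hR]
    simp only [Preadditive.add_comp, Preadditive.sub_comp, Category.assoc]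
    rw [hDb.comp_one (isGroupLike_sign _) (isGroupLike_id _),
      hK.comp_one (hS.comp hP) hF, hP.comp_one, hF.comp_one]
    simp
  have hRπ : R ≫ letterProj B = K ≫ b + barDer a ≫ k + ψ - f := by
    rw [hR]
    simp only [Preadditive.add_comp, Preadditive.sub_comp, Category.assoc]
    rw [hKπ, barHom_letterProj hf, barHom_letterProj hψ, barDer_letterProj]
  have hRmul : ∀ M N : bar B ⟶ bar B, R ≫ (M * N) =
      (barHom ψ ≫ M) * (R ≫ N) + (R ≫ M) * (barHom f ≫ N) -
      ((barSign A ≫ (barDer a ≫ barHom ψ - barHom ψ ≫ barDer b)) ≫ M) * (K ≫ N) := by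
    intro M N
    have e1 : K ≫ barDer b ≫ (M * N) = (barSign A ≫ barHom ψ ≫ barSign B ≫ M) * (K ≫ barDer b ≫ N)
        + (K ≫ barSign B ≫ M) * (barHom f ≫ barDer b ≫ N)
        + (barSign A ≫ barHom ψ ≫ barDer b ≫ M) * (K ≫ N)
        + (K ≫ barDer b ≫ M) * (barHom f ≫ N) := by
      rw [hDb.comp_mul, Preadditive.comp_add, hK.comp_mul, hK.comp_mul]
      simp only [Category.assoc, Category.id_comp]
      abel
    have e2 : barDer a ≫ K ≫ (M * N) = (barSign A ≫ barSign A ≫ barHom ψ ≫ M) * (barDer a ≫ K ≫ N)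
        + (barDer a ≫ barSign A ≫ barHom ψ ≫ M) * (K ≫ N)
        + (barSign A ≫ K ≫ M) * (barDer a ≫ barHom f ≫ N)
        + (barDer a ≫ K ≫ M) * (barHom f ≫ N) := by
      rw [hK.comp_mul, Preadditive.comp_add, hDa.comp_mul, hDa.comp_mul]
      simp only [Category.assoc, Category.id_comp]
      abel
    rw [← reassoc_of% barHom_sign hψ0, reassoc_of% sign_sign] at e1
    rw [reassoc_of% sign_sign, reassoc_of% hDE, reassoc_of% hKE', reassoc_of% hDf] at e2
    rw [hR]
    simp only [Preadditive.add_comp, Preadditive.sub_comp, Preadditive.comp_sub, Category.assoc]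
    rw [e1, e2, hP.comp_mul, hF.comp_mul]
    simp only [Preadditive.neg_comp, Category.assoc]
    noncomm_ring
  -- The product id · (1 - π) is 1, which R kills. The product rule thus becomes a linear equation
  -- for R · (1 - f), solved by multiplying with the inverse of 1 - f.
  have hmain := hRmul (𝟙 _) (1 - letterProj B ≫ letterMap B)
  have h1 := barHom_mul (letterProj_mem B)
  have h2 := barHom_mul hf
  have h3 := mul_barHom hf
  rw [← barHom_letterProj_self] at h1
  rw [h1, hR1] at hmain
  simp only [Preadditive.comp_sub, Category.comp_id, hR1, hF.comp_one,
    hK.comp_one (hS.comp hP) hF, ← Category.assoc, hRπ, hKπ, barHom_letterProj hf] at hmain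
  simp only [Category.assoc] at hmain
  have h4 : R * (1 - f ≫ letterMap B) = barHom ψ * ((K ≫ b + barDer a ≫ k + ψ - f) ≫ letterMap B)
      - (barSign A ≫ (barDer a ≫ barHom ψ - barHom ψ ≫ barDer b)) * (k ≫ letterMap B) := by
    rw [← sub_eq_zero, hmain]
    simp only [Preadditive.comp_sub]
    noncomm_ring
  have h5 : R = (R * (1 - f ≫ letterMap B)) * barHom f := by
    rw [mul_assoc, h3, mul_one]
  rw [← hR, h5, h4, sub_mul]

end Lifting

/-! ### Lifting along a minimal model, and inverses -/

section Lifting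

variable {C : Type u} [Category.{v} C] [MonoidalCategory C] [HasCoproducts.{0} C]
  [TensorPreservesCoproducts C] [Preadditive C] [MonoidalPreadditive C]
  {A B H H' E : GradedObject ℤ C} {Y : C}

/-- Lifting a morphism `f : H → A` from a minimal object along a morphism `f' : H' → A` from
another minimal object whose linear part is part of a deformation retract. -/
theorem exists_lift {a : bar H ⟶ tot H} (ha : HasDegree 1 a) (ha2 : a ∈ barFil H _ 2)
    (haa : barDer a ≫ a = 0) {a' : bar H' ⟶ tot H'}
    {b : bar A ⟶ tot A} (hb : HasDegree 1 b) (hbb : barDer b ≫ b = 0)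
    {f : bar H ⟶ tot A} (hf0 : HasDegree 0 f) (hf1 : f ∈ barFil H _ 1)
    (haf : barDer a ≫ f = barHom f ≫ b)
    {f' : bar H' ⟶ tot A} (hf'0 : HasDegree 0 f') (hf'1 : f' ∈ barFil H' _ 1)
    (haf' : barDer a' ≫ f' = barHom f' ≫ b)
    {g : tot H' ⟶ tot A} (hg : letterMap H' ≫ f' = g) {m : tot A ⟶ tot A}
    (hm : letterMap A ≫ b = m) {p : tot A ⟶ tot H'} {h : tot A ⟶ tot A}
    (hp : HasDegree 0 p) (hh : HasDegree (-1) h) (hmm : m ≫ m = 0) (hgm : g ≫ m = 0)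
    (hmp : m ≫ p = 0) (hgp : g ≫ p = 𝟙 _) (hpg : p ≫ g = 𝟙 _ + m ≫ h + h ≫ m) :
    ∃ φ : bar H ⟶ tot H', HasDegree 0 φ ∧ φ ∈ barFil H _ 1 ∧
      barDer a ≫ φ = barHom φ ≫ a' ∧ letterMap H ≫ φ = (letterMap H ≫ f) ≫ p ∧
      (h = 0 → barHom φ ≫ f' = f) := by
  have hmd : HasDegree 1 m := hm ▸ (hasDegree_letterMap A).comp hb (zero_add 1)
  have hgd : HasDegree 0 g := hg ▸ (hasDegree_letterMap H').comp hf'0 (zero_add 0)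
  obtain ⟨b2, hb2⟩ : ∃ b2, b2 = b - letterProj A ≫ m := ⟨_, rfl⟩
  obtain ⟨f2, hf2⟩ : ∃ f2, f2 = f' - letterProj H' ≫ g := ⟨_, rfl⟩
  have hb2d : HasDegree 1 b2 := hb2 ▸ hb.sub ((hasDegree_letterProj A).comp hmd (zero_add 1))
  have hf2d : HasDegree 0 f2 := hf2 ▸ hf'0.sub ((hasDegree_letterProj H').comp hgd (zero_add 0))
  have hηb2 : letterMap A ≫ b2 = 0 := by
    rw [hb2, Preadditive.comp_sub, hm, ← Category.assoc, letterMap_letterProj, Category.id_comp,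
      sub_self]
  have hηf2 : letterMap H' ≫ f2 = 0 := by
    rw [hf2, Preadditive.comp_sub, hg, ← Category.assoc, letterMap_letterProj, Category.id_comp,
      sub_self]
  have hf21 : f2 ∈ barFil H' _ 1 :=
    hf2 ▸ sub_mem hf'1 (comp_mem_barFil (letterProj_mem H') g)
  have hψ1 : ∀ {φ : bar H ⟶ tot H'}, φ ∈ barFil H _ 1 → barHom φ ≫ f' ∈ barFil H _ 1 :=
    fun hφ => barHom_comp_mem_one hφ hf'1
  have hTψ : ∀ {φ : bar H ⟶ tot H'}, φ ∈ barFil H _ 1 →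
      barHom (barHom φ ≫ f') = barHom φ ≫ barHom f' := fun hφ => (barHom_comp_barHom hφ hf'1).symm
  -- One unknown Q encodes both the lift φ = Qp and the homotopy k = -Qh. The homotopy equation is K
  -- b + D k + ψ - f = 0, whose linear part is φg + km. Solving for Q moves everything else to the
  -- right, and pg = 1 + mh + hm gives Q = φg + km - Qmh. Hence the equation holds up to Qmh, which
  -- is shown to vanish afterwards.
  obtain ⟨Q, ⟨hQ0, hQ1⟩, hQ⟩ := exists_fixedPoint
    {Q : bar H ⟶ tot A | HasDegree 0 Q ∧ Q ∈ barFil H _ 1}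
    (fun Q => f - barHom (Q ≫ p) ≫ f2 - barHtpy (barHom (Q ≫ p) ≫ f') f (-(Q ≫ h)) ≫ b2 -
      barDer a ≫ (-(Q ≫ h)))
    ⟨0, hasDegree_zero 0, zero_mem _⟩
    (fun Q hQ => by
      have hφ0 := hQ.1.comp hp (zero_add 0)
      have hk0 := (hQ.1.comp hh (zero_add (-1))).neg
      have hφ1 := comp_mem_barFil hQ.2 p
      have hk1 := neg_mem (comp_mem_barFil hQ.2 h)
      exact ⟨((hf0.sub (hφ0.barHom.comp hf2d (zero_add 0))).sub
        (((hφ0.barHom.comp hf'0 (zero_add 0)).barHtpy hf0 hk0).comp hb2d (by norm_num))).sub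
          (ha.barDer.comp hk0 (by norm_num)),
        sub_mem (sub_mem (sub_mem hf1 (barHom_comp_mem_one hφ1 hf21))
          (comp_mem_barFil (barHtpy_mem hk1) _))
          (barFil_anti one_le_two (barDer_comp_mem_barFil ha2 hk1))⟩)
    (fun Q hQ => hasDegree_mem_local hQ)
    (fun Q hQ Q' hQ' n hn => by
      have hφ1 := comp_mem_barFil hQ.2 p
      have hk1 := neg_mem (comp_mem_barFil hQ.2 h)
      have hφ1' := comp_mem_barFil hQ'.2 p
      have hφn : Q ≫ p - Q' ≫ p ∈ barFil H _ n := by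
        rw [← Preadditive.sub_comp]
        exact comp_mem_barFil hn p
      have hkn : -(Q ≫ h) - -(Q' ≫ h) ∈ barFil H _ n := by
        rw [← neg_sub_neg, neg_neg, neg_neg, ← neg_sub, ← Preadditive.sub_comp]
        exact neg_mem (comp_mem_barFil hn h)
      have e1 : barHom (Q ≫ p) - barHom (Q' ≫ p) ∈ barFil H _ n := by
        rw [barHom_sub_barHom hφ1 hφ1']
        exact conv_mem_barFil (conv_mem_barFil (mem_barFil_zero _) (comp_mem_barFil hφn _)
          (zero_add n).ge) (mem_barFil_zero _) le_rfl
      have e2 : barHom (Q ≫ p) ≫ f2 - barHom (Q' ≫ p) ≫ f2 ∈ barFil H _ (n + 1) := by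
        have := (isGroupLike_barHom hφ1).conv_comp_sub_mem (isGroupLike_barHom hφ1') hφn f2
        rwa [hηf2, comp_zero, sub_zero, ← barHom_sub_barHom hφ1 hφ1', Preadditive.sub_comp] at this
      have e3 : barHtpy (barHom (Q ≫ p) ≫ f') f (-(Q ≫ h)) ≫ b2 -
          barHtpy (barHom (Q' ≫ p) ≫ f') f (-(Q' ≫ h)) ≫ b2 ∈ barFil H _ (n + 1) := by
        -- The difference is split by varying φ and k separately. The first part gains a step
        -- because k itself has filtration 1, the second because `b2` kills single letters.
        have e4 : barHtpy (barHom (Q ≫ p) ≫ f') f (-(Q ≫ h)) -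
            barHtpy (barHom (Q' ≫ p) ≫ f') f (-(Q' ≫ h)) =
            (barSign H ≫ (barHom (Q ≫ p) - barHom (Q' ≫ p)) ≫ barHom f') *
              ((-(Q ≫ h)) ≫ letterMap A) * barHom f +
            barHtpy (barHom (Q' ≫ p) ≫ f') f (-(Q ≫ h) - -(Q' ≫ h)) := by
          simp only [barHtpy, hTψ hφ1, hTψ hφ1', Preadditive.sub_comp, Preadditive.comp_sub]
          noncomm_ring
        rw [← Preadditive.sub_comp, e4, Preadditive.add_comp]
        refine add_mem (comp_mem_barFil (conv_mem_barFil (conv_mem_barFil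
          (barSign_comp_mem (comp_mem_barFil e1 _)) (comp_mem_barFil hk1 _) le_rfl)
          (mem_barFil_zero _) le_rfl) _) ?_
        have := barHtpy_comp_sub_mem (hψ1 hφ1') hf1 hkn b2
        rwa [hηb2, comp_zero, sub_zero] at this
      have e5 : barDer a ≫ (-(Q ≫ h)) - barDer a ≫ (-(Q' ≫ h)) ∈ barFil H _ (n + 1) := by
        rw [← Preadditive.comp_sub]
        exact barDer_comp_mem_barFil ha2 hkn
      convert sub_mem (sub_mem (neg_mem e2) e3) e5 using 1
      abel)
  obtain ⟨φ, hφ⟩ : ∃ φ, φ = Q ≫ p := ⟨_, rfl⟩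
  obtain ⟨k, hk⟩ : ∃ k, k = -(Q ≫ h) := ⟨_, rfl⟩
  have hφ0 : HasDegree 0 φ := hφ ▸ hQ0.comp hp (zero_add 0)
  have hk0 : HasDegree (-1) k := hk ▸ (hQ0.comp hh (zero_add (-1))).neg
  have hφ1 : φ ∈ barFil H _ 1 := hφ ▸ comp_mem_barFil hQ1 p
  have hk1 : k ∈ barFil H _ 1 := hk ▸ neg_mem (comp_mem_barFil hQ1 h)
  rw [← hφ, ← hk] at hQ
  obtain ⟨ψ, hψ⟩ : ∃ ψ, ψ = barHom φ ≫ f' := ⟨_, rfl⟩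
  have hψd : HasDegree 0 ψ := hψ ▸ hφ0.barHom.comp hf'0 (zero_add 0)
  have hψm : ψ ∈ barFil H _ 1 := hψ ▸ hψ1 hφ1
  have hTψ' := hTψ hφ1
  rw [← hψ] at hQ hTψ'
  obtain ⟨K, hK⟩ : ∃ K, K = barHtpy ψ f k := ⟨_, rfl⟩
  have hbd := barHtpy_boundary ha hψm hf1 hf0 hψd hk0 haf
  rw [← hK] at hQ hbd
  obtain ⟨e, he⟩ : ∃ e, e = K ≫ b + barDer a ≫ k + ψ - f := ⟨_, rfl⟩
  obtain ⟨Φ, hΦ⟩ : ∃ Φ, Φ = barDer a ≫ φ - barHom φ ≫ a' := ⟨_, rfl⟩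
  have hKπ : K ≫ letterProj A = k := hK ▸ barHtpy_letterProj hψm hf1 k
  have he1 : e = k ≫ m + φ ≫ g - Q := by
    have h1 : K ≫ b = K ≫ b2 + k ≫ m := by
      rw [hb2, Preadditive.comp_sub, ← Category.assoc, hKπ, sub_add_cancel]
    have h2 : ψ = barHom φ ≫ f2 + φ ≫ g := by
      rw [hf2, Preadditive.comp_sub, ← Category.assoc, barHom_letterProj hφ1, sub_add_cancel, hψ]
    rw [he, h1]
    nth_rw 1 [← hQ]
    conv_lhs => rw [h2]
    abel
  have he2 : e = Q ≫ m ≫ h := by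
    rw [he1, hk, hφ, Category.assoc, hpg]
    simp only [Preadditive.comp_add, Preadditive.neg_comp, Category.comp_id, Category.assoc]
    abel
  have he3 : e ≫ m = - (Q ≫ m) := by
    rw [he1]
    simp only [Preadditive.add_comp, Preadditive.sub_comp, Category.assoc, hmm, hgm, comp_zero]
    abel
  -- The error is recovered from its boundary, so it suffices to control e followed by m.
  have he4 : e = - ((e ≫ m) ≫ h) := by
    rw [he3, he2, Preadditive.neg_comp, neg_neg, Category.assoc]
  have hΞ : barDer a ≫ barHom ψ - barHom ψ ≫ barDer b =
      ((barSign H ≫ barHom φ) * (Φ ≫ letterMap H') * barHom φ) ≫ barHom f' := by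
    rw [hΦ, ← barDer_comp_barHom_sub hφ1 hφ0, hTψ', Preadditive.sub_comp, Category.assoc,
      Category.assoc, Category.assoc, barDer_comp_barHom hf'1 hf'0 haf']
  obtain ⟨Θ, hΘ⟩ : ∃ Θ, Θ = (barSign H ≫ barHom φ) * (Φ ≫ letterMap H') * barHom φ := ⟨_, rfl⟩
  rw [← hΘ] at hΞ
  have hDb : barDer b ≫ b = 0 := hbb
  rw [← he, hΞ] at hbd
  -- Compose the boundary formula with `b` and use that both bar differentials square to zero.
  have hDe : barDer a ≫ e - Θ ≫ f' = (barHom ψ * (e ≫ letterMap A) * barHom f) ≫ b -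
      ((barSign H ≫ Θ ≫ barHom f') * (k ≫ letterMap A) * barHom f) ≫ b := by
    rw [← Preadditive.sub_comp, ← hbd]
    have h1 := hΞ =≫ letterProj A
    rw [Preadditive.sub_comp, Category.assoc, Category.assoc, Category.assoc,
      barHom_letterProj hψm, barDer_letterProj, barHom_letterProj hf'1] at h1
    rw [← h1, he]
    simp only [Preadditive.add_comp, Preadditive.sub_comp, Preadditive.comp_add,
      Preadditive.comp_sub, Category.assoc, hbb, comp_zero, ← haf]
    rw [← Category.assoc (barDer a) (barDer a), barDer_comp_barDer ha haa, zero_comp]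
    abel
  -- Modulo filtration n + 1, `hDe` reads Φg + em = 0, because H is minimal and so D raises the
  -- filtration. Composing with p (gp = 1, mp = 0) isolates Φ. This leaves em, and `he4` then gives
  -- e.
  have hstep : ∀ n, e ∈ barFil H _ n → Φ ∈ barFil H _ n →
      e ∈ barFil H _ (n + 1) ∧ Φ ∈ barFil H _ (n + 1) := by
    intro n hen hΦn
    have h1 := barDer_comp_mem_barFil ha2 hen
    have h2 : Θ ≫ f' - Φ ≫ g ∈ barFil H _ (n + 1) := by
      have := ((isGroupLike_sign _).comp (isGroupLike_barHom hφ1)).conv_comp_sub_mem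
        (isGroupLike_barHom hφ1) hΦn f'
      rwa [hg, ← hΘ] at this
    have h3 : (barHom ψ * (e ≫ letterMap A) * barHom f) ≫ b - e ≫ m ∈ barFil H _ (n + 1) := by
      have := (isGroupLike_barHom hψm).conv_comp_sub_mem (isGroupLike_barHom hf1) hen b
      rwa [hm] at this
    have hΘn : Θ ∈ barFil H _ n := hΘ ▸ conv_mem_barFil (conv_mem_barFil (mem_barFil_zero _)
      (comp_mem_barFil hΦn _) (zero_add n).ge) (mem_barFil_zero _) le_rfl
    have h4 : ((barSign H ≫ Θ ≫ barHom f') * (k ≫ letterMap A) * barHom f) ≫ b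
        ∈ barFil H _ (n + 1) :=
      comp_mem_barFil (conv_mem_barFil (conv_mem_barFil
        (barSign_comp_mem (comp_mem_barFil hΘn _)) (comp_mem_barFil hk1 _) le_rfl)
        (mem_barFil_zero _) le_rfl) _
    have h5 : Φ ≫ g + e ≫ m ∈ barFil H _ (n + 1) := by
      have := sub_mem (sub_mem h1 h2) (sub_mem h3 h4)
      convert this using 1
      have := eq_add_of_sub_eq hDe
      rw [this]
      abel
    have h6 : Φ ∈ barFil H _ (n + 1) := by
      have := comp_mem_barFil h5 p
      rwa [Preadditive.add_comp, Category.assoc, Category.assoc, hgp, hmp, comp_zero, add_zero,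
        Category.comp_id] at this
    have h7 : e ≫ m ∈ barFil H _ (n + 1) := by
      have := sub_mem h5 (comp_mem_barFil h6 g)
      rwa [add_sub_cancel_left] at this
    refine ⟨?_, h6⟩
    rw [he4]
    exact neg_mem (comp_mem_barFil h7 h)
  have hall : ∀ n, e ∈ barFil H _ n ∧ Φ ∈ barFil H _ n := by
    intro n
    induction n with
    | zero => exact ⟨mem_barFil_zero _, mem_barFil_zero _⟩
    | succ n ih => exact hstep n ih.1 ih.2
  have he0 : e = 0 := eq_zero_of_mem_barFil fun n _ => (hall (n + 1)).1
  have hΦ0 : Φ = 0 := eq_zero_of_mem_barFil fun n _ => (hall (n + 1)).2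
  refine ⟨φ, hφ0, hφ1, ?_, ?_, ?_⟩
  · rwa [hΦ, sub_eq_zero] at hΦ0
  · have h1 : barHom φ ≫ f2 + K ≫ b2 + barDer a ≫ k ∈ barFil H _ 2 := by
      refine add_mem (add_mem (barHom_comp_mem_two hφ1 hf21 hηf2) ?_)
        (barDer_comp_mem_barFil ha2 hk1)
      have := barHtpy_comp_sub_mem hψm hf1 hk1 b2
      rwa [hηb2, comp_zero, sub_zero, ← hK] at this
    have h2 := letterMap_comp_eq_zero h1
    have h3 : f = Q + (barHom φ ≫ f2 + K ≫ b2 + barDer a ≫ k) := by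
      nth_rw 1 [← hQ]
      abel
    rw [h3, Preadditive.comp_add, h2, add_zero, hφ, Category.assoc]
  -- With h = 0 the homotopy is zero, and e = 0 becomes a strict factorisation.
  · intro h0
    have hk' : k = 0 := by rw [hk, h0, comp_zero, neg_zero]
    have hK0 : K = 0 := by rw [hK, hk', barHtpy, zero_comp, mul_zero, zero_mul]
    rw [he0, hK0, hk', zero_comp, comp_zero, zero_add, zero_add] at he
    rw [← hψ]
    exact (sub_eq_zero.1 he.symm)

/-- A morphism of minimal objects with invertible linear part has a right inverse. -/
theorem exists_rightInverse {a : bar H ⟶ tot H} {a' : bar H' ⟶ tot H'}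
    (ha' : HasDegree 1 a') (ha'2 : a' ∈ barFil H' _ 2) (haa' : barDer a' ≫ a' = 0)
    {φ : bar H ⟶ tot H'} (hφ0 : HasDegree 0 φ) (hφ1 : φ ∈ barFil H _ 1)
    (haφ : barDer a ≫ φ = barHom φ ≫ a') {q : tot H' ⟶ tot H} (hq : HasDegree 0 q)
    (h1 : (letterMap H ≫ φ) ≫ q = 𝟙 _) (h2 : q ≫ letterMap H ≫ φ = 𝟙 _) :
    ∃ χ : bar H' ⟶ tot H, HasDegree 0 χ ∧ χ ∈ barFil H' _ 1 ∧ barDer a' ≫ χ = barHom χ ≫ a ∧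
      letterMap H' ≫ χ = q ∧ barHom χ ≫ φ = letterProj H' := by
  -- The identity of H' is lifted along φ. The target is minimal, so m = 0, and h = 0 is admissible
  -- because q inverts the linear part on both sides.
  obtain ⟨χ, hχ0, hχ1, hχ, hχq, hχφ⟩ := exists_lift ha' ha'2 haa' ha' haa' (hasDegree_letterProj H') (letterProj_mem H')
    (by rw [barDer_letterProj, ← barHom_letterProj_self, Category.id_comp]) hφ0 hφ1 haφ rfl
    (letterMap_comp_eq_zero ha'2) hq (hasDegree_zero (-1)) (comp_zero) comp_zero zero_comp h1
    (by rw [h2]; simp)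
  exact ⟨χ, hχ0, hχ1, hχ, by rw [hχq, letterMap_letterProj, Category.id_comp], hχφ rfl⟩

/-- A morphism of minimal objects with invertible linear part is invertible. -/
theorem exists_inverse {a : bar H ⟶ tot H} (ha : HasDegree 1 a) (haa : barDer a ≫ a = 0)
    (ha2 : a ∈ barFil H _ 2) {a' : bar H' ⟶ tot H'}
    (ha' : HasDegree 1 a') (ha'2 : a' ∈ barFil H' _ 2) (haa' : barDer a' ≫ a' = 0)
    {φ : bar H ⟶ tot H'} (hφ0 : HasDegree 0 φ) (hφ1 : φ ∈ barFil H _ 1)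
    (haφ : barDer a ≫ φ = barHom φ ≫ a') {q : tot H' ⟶ tot H} (hq : HasDegree 0 q)
    (h1 : (letterMap H ≫ φ) ≫ q = 𝟙 _) (h2 : q ≫ letterMap H ≫ φ = 𝟙 _) :
    ∃ χ : bar H' ⟶ tot H, HasDegree 0 χ ∧ χ ∈ barFil H' _ 1 ∧ barDer a' ≫ χ = barHom χ ≫ a ∧
      barHom χ ≫ φ = letterProj H' ∧ barHom φ ≫ χ = letterProj H := by
  obtain ⟨χ, hχ0, hχ1, hχ, hχq, hχφ⟩ := exists_rightInverse ha' ha'2 haa' hφ0 hφ1 haφ hq h1 h2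
  obtain ⟨φ', hφ'0, hφ'1, hφ', hφ'q, hφ'χ⟩ := exists_rightInverse ha ha2 haa hχ0 hχ1 hχ
    ((hasDegree_letterMap H).comp hφ0 (zero_add 0)) (by rw [hχq, h2]) (by rw [hχq, h1])
  refine ⟨χ, hχ0, hχ1, hχ, hχφ, ?_⟩
  have e1 := barHom_comp_barHom hχ1 hφ1
  have e2 := barHom_comp_barHom hφ'1 hχ1
  rw [hχφ, ← barHom_letterProj_self] at e1
  rw [hφ'χ, ← barHom_letterProj_self] at e2
  -- A left inverse and a right inverse of χ coincide.
  have e3 : barHom φ' = barHom φ := by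
    rw [← Category.comp_id (barHom φ'), ← e1, ← Category.assoc, e2, Category.id_comp]
  rw [← e3, hφ'χ]

end Lifting

/-! ### Families of operations as maps on the bar construction -/

section Families

variable {C : Type u} [Category.{v} C] [MonoidalCategory C] [HasCoproducts.{0} C] [Preadditive C]
  {A B E : GradedObject ℤ C} {a : ℤ}

open HasGrading

theorem GrHom.tpow_ext {n : ℕ} {r : ℤ} {φ ψ : GrHom (tpow A n) B r}
    (h : ∀ w hn q hq, φ.atWord w hn q hq = ψ.atWord w hn q hq) : φ = ψ := by
  refine GrHom.ext_app fun d q hq => Sigma.hom_ext _ _ fun w => ?_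
  obtain ⟨w, hn, hd⟩ := w
  exact (tpowι_app φ w hn d hd q hq).trans ((h w hn q _).trans (tpowι_app ψ w hn d hd q hq).symm)

/-- The restriction of a graded morphism to a word, with values in the total object. -/
noncomputable def GrHom.totWord {n : ℕ} {r : ℤ} (φ : GrHom (tpow A n) B r) (w : List ℤ)
    (hn : w.length = n) : wordObj A w ⟶ tot B :=
  φ.atWord w hn (w.sum + r) rfl ≫ totι B (w.sum + r)

theorem GrHom.atWord_totι {n : ℕ} {r : ℤ} (φ : GrHom (tpow A n) B r) (w : List ℤ)
    (hn : w.length = n) (q : ℤ) (hq : w.sum + r = q) :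
    φ.atWord w hn q hq ≫ totι B q = φ.totWord w hn := by
  subst hq
  rfl

/-- The projection to a component. -/
noncomputable def totPr (A : GradedObject ℤ C) (q : ℤ) : tot A ⟶ A q :=
  totDesc fun p => if h : p = q then eqToHom (by rw [h]) else 0

theorem totι_totPr (A : GradedObject ℤ C) (q : ℤ) : totι A q ≫ totPr A q = 𝟙 _ := by
  simp [totPr]

theorem totPr_totι (A : GradedObject ℤ C) (q d : ℤ) (h : d + 1 = q) :
    totPr A q ≫ totι A q = proj d := by
  refine tot_ext fun p => ?_
  by_cases hp : p = q
  · subst hp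
    rw [← Category.assoc, totι_totPr, Category.id_comp, totι_proj A p d (by omega)]
  · rw [totι_proj_ne A p d (by omega), ← Category.assoc, totPr, totι_totDesc, dif_neg hp, zero_comp]

theorem GrHom.atWord_eq {n : ℕ} {r : ℤ} (φ : GrHom (tpow A n) B r) (w : List ℤ)
    (hn : w.length = n) (q : ℤ) (hq : w.sum + r = q) :
    φ.atWord w hn q hq = φ.totWord w hn ≫ totPr B q := by
  rw [← φ.atWord_totι w hn q hq, Category.assoc, totι_totPr, Category.comp_id]

theorem GrHom.ext_totWord {n : ℕ} {r : ℤ} {φ ψ : GrHom (tpow A n) B r}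
    (h : ∀ w hn, φ.totWord w hn = ψ.totWord w hn) : φ = ψ :=
  GrHom.tpow_ext fun w hn q hq => by rw [atWord_eq, atWord_eq, h]

/-- The exponent of the sign that relates operations to their shifted versions. -/
def shiftExp : List ℤ → ℤ
  | [] => 0
  | p :: w => w.length * (p - 1) + shiftExp w

theorem shiftExp_append (u v : List ℤ) :
    shiftExp (u ++ v) = shiftExp u + shiftExp v + v.length * wordDeg u := by
  induction u with
  | nil => simp [shiftExp]
  | cons p u ih =>
    rw [List.cons_append, shiftExp, ih, shiftExp, wordDeg_cons, List.length_append]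
    push_cast
    ring

/-- The shifted version `bar A ⟶ tot B` of a family of operations `A^{⊗ n} → B`. -/
noncomputable def hat (φ : ∀ n : ℕ, GrHom (tpow A n) B (a - (n : ℤ))) : bar A ⟶ tot B :=
  barDesc fun w => (shiftExp w).negOnePow • (φ w.length).totWord w rfl

theorem barι_hat (φ : ∀ n : ℕ, GrHom (tpow A n) B (a - (n : ℤ))) (w : List ℤ) :
    barι A w ≫ hat φ = (shiftExp w).negOnePow • (φ w.length).totWord w rfl :=
  barι_barDesc _ w

theorem totWord_length (φ : ∀ n : ℕ, GrHom (tpow A n) B (a - (n : ℤ))) (w : List ℤ) (n : ℕ)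
    (hn : w.length = n) : (φ n).totWord w hn = (φ w.length).totWord w rfl := by
  subst hn
  rfl

theorem totWord_eq (φ : ∀ n : ℕ, GrHom (tpow A n) B (a - (n : ℤ))) (w : List ℤ) (n : ℕ)
    (hn : w.length = n) :
    (φ n).totWord w hn = (shiftExp w).negOnePow • (barι A w ≫ hat φ) := by
  rw [totWord_length, barι_hat, smul_smul, ← Int.negOnePow_add, Int.negOnePow_even _ ⟨_, rfl⟩,
    one_smul]

theorem hat_injective {φ ψ : ∀ n : ℕ, GrHom (tpow A n) B (a - (n : ℤ))} (h : hat φ = hat ψ)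
    (n : ℕ) : φ n = ψ n :=
  GrHom.ext_totWord fun w hn => by rw [totWord_eq, totWord_eq, h]

/-- The shift by the length of a word absorbs the -n in the degree, so all arities acquire the same
degree a - 1. It is 1 for structures (a = 2) and 0 for morphisms (a = 1). -/
theorem hasDegree_hat (φ : ∀ n : ℕ, GrHom (tpow A n) B (a - (n : ℤ))) {r : ℤ} (hr : r + 1 = a) :
    HasDegree r (hat φ) :=
  hasDegree_bar_iff.2 fun w d hd => by
    rw [barι_hat, Linear.units_smul_comp, GrHom.totWord, Category.assoc,
      totι_proj _ _ _ (by unfold wordDeg at hd; omega)]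

theorem GrHom.totWord_zero {n : ℕ} {r : ℤ} (w : List ℤ) (hn : w.length = n) :
    (0 : GrHom (tpow A n) B r).totWord w hn = 0 := by
  have h : (0 : GrHom (tpow A n) B r).atWord w hn (w.sum + r) rfl = 0 := comp_zero
  rw [totWord, h, zero_comp]

theorem hat_mem_barFil (φ : ∀ n : ℕ, GrHom (tpow A n) B (a - (n : ℤ))) (k : ℕ) :
    hat φ ∈ barFil A _ k ↔ ∀ n < k, φ n = 0 := by
  constructor
  · intro h n hn
    refine GrHom.ext_totWord fun w hw => ?_
    rw [totWord_eq, h w (by omega), smul_zero, GrHom.totWord_zero]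
  · intro h w hw
    rw [barι_hat, h _ hw, GrHom.totWord_zero, smul_zero]

/-- A homogeneous morphism `bar A ⟶ tot B` is the shifted version of a family of operations. -/
noncomputable def unhat (f : bar A ⟶ tot B) (a : ℤ) (n : ℕ) : GrHom (tpow A n) B (a - (n : ℤ)) :=
  fun x => tpowDesc fun w _ _ => (shiftExp w).negOnePow • (barι A w ≫ f ≫ totPr B x.1.2)

theorem unhat_atWord (f : bar A ⟶ tot B) (a : ℤ) (n : ℕ) (w : List ℤ) (hn : w.length = n) (q : ℤ)
    (hq : w.sum + (a - (n : ℤ)) = q) : (unhat f a n).atWord w hn q hq =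
      (shiftExp w).negOnePow • (barι A w ≫ f ≫ totPr B q) := by
  unfold GrHom.atWord GrHom.app unhat
  exact tpowι_desc (fun w _ _ => (shiftExp w).negOnePow • (barι A w ≫ f ≫ totPr B q)) w hn rfl

theorem hat_unhat {f : bar A ⟶ tot B} {r : ℤ} (hf : HasDegree r f) (hr : r + 1 = a) :
    hat (unhat f a) = f := by
  refine bar_ext fun w => ?_
  rw [barι_hat, GrHom.totWord, unhat_atWord, Linear.units_smul_comp, smul_smul,
    ← Int.negOnePow_add, Int.negOnePow_even _ ⟨_, rfl⟩, one_smul, Category.assoc, Category.assoc,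
    totPr_totι B _ (wordDeg w + r) (by unfold wordDeg; omega)]
  have := hasDegree_bar_iff.1 hf w _ rfl
  rwa [Category.assoc] at this

/-- The A∞-relations are imposed only for n ≥ 1. In arity 0 both sides vanish because they have
filtration 1. -/
theorem hat_eq_of_pos {φ ψ : ∀ n : ℕ, GrHom (tpow A n) B (a - (n : ℤ))}
    (h : ∀ n, 1 ≤ n → φ n = ψ n) {f : bar A ⟶ tot B} (hf : hat ψ = f)
    (hφ : hat φ ∈ barFil A _ 1) (hf1 : f ∈ barFil A _ 1) : hat φ = f := by
  rw [← hf] at hf1 ⊢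
  rw [hat_mem_barFil] at hφ hf1
  refine congrArg hat (funext fun n => ?_)
  rcases Nat.eq_zero_or_pos n with rfl | hn
  · rw [hφ 0 zero_lt_one, hf1 0 zero_lt_one]
  · exact h n hn

theorem letterMap_hat (φ : ∀ n : ℕ, GrHom (tpow A n) B (a - (n : ℤ))) (p q : ℤ)
    (h : p + (a - (1 : ℕ)) = q) :
    totι A p ≫ letterMap A ≫ hat φ = (φ 1).unary.app p q h ≫ totι B q := by
  rw [← Category.assoc, totι_letterMap, Category.assoc, barι_hat, GrHom.unary_app, Category.assoc,
    GrHom.atWord_totι, totWord_length]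
  simp [shiftExp]

theorem isIdentity_iff (φ : ∀ n : ℕ, GrHom (tpow A n) A (1 - (n : ℤ))) (h : φ 0 = 0) :
    IsIdentity φ ↔ hat φ = letterProj A := by
  constructor
  · rintro ⟨h1, h2⟩
    refine bar_ext fun w => ?_
    match w with
    | [] =>
      rw [barι_letterProj_of_length_ne _ _ (by simp)]
      exact (hat_mem_barFil φ 1).2 (fun n hn => by obtain rfl : n = 0 := by omega
                                                   exact h) [] (by simp)
    | [p] =>
      have e1 := letterMap_hat φ p p (by simp)
      rw [h1, Category.id_comp, ← Category.assoc, totι_letterMap, Category.assoc] at e1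
      rw [barι_one_letterProj, ← e1, Iso.inv_hom_id_assoc]
    | p :: q :: w =>
      rw [barι_letterProj_of_length_ne _ _ (by simp), barι_hat, h2 _ (by simp), GrHom.totWord_zero,
        smul_zero]
  · intro hφ
    constructor
    · intro p
      have e1 := letterMap_hat φ p p (by simp)
      rw [hφ, letterMap_letterProj, Category.comp_id] at e1
      have e2 := e1 =≫ totPr A p
      rwa [Category.assoc, totι_totPr, Category.comp_id, eq_comm] at e2
    · intro n hn
      refine GrHom.ext_totWord fun w hw => ?_
      rw [totWord_eq, hφ, barι_letterProj_of_length_ne _ _ (by omega), smul_zero,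
        GrHom.totWord_zero]

end Families

/-! ### The bar differential and the sums over insertions -/

section InsertSum

variable {C : Type u} [Category.{v} C] [MonoidalCategory C] [HasCoproducts.{0} C] [Preadditive C]
  {A B E : GradedObject ℤ C} {a : ℤ}

theorem GrHom.totWord_sum {n : ℕ} {r : ℤ} {ι : Type*} (s : Finset ι)
    (φ : ι → GrHom (tpow A n) B r) (w : List ℤ) (hn : w.length = n) :
    (∑ i ∈ s, φ i).totWord w hn = ∑ i ∈ s, (φ i).totWord w hn := by
  have h : (∑ i ∈ s, φ i).app w.sum (w.sum + r) rfl = ∑ i ∈ s, (φ i).app w.sum (w.sum + r) rfl :=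
    Finset.sum_apply _ _ _
  simp only [totWord, atWord]
  rw [h, Preadditive.comp_sum, Preadditive.sum_comp]

theorem GrHom.totWord_smul {n : ℕ} {r : ℤ} (e : ℤˣ) (φ : GrHom (tpow A n) B r) (w : List ℤ)
    (hn : w.length = n) : (e • φ).totWord w hn = e • φ.totWord w hn := by
  have h : (e • φ).app w.sum (w.sum + r) rfl = e • φ.app w.sum (w.sum + r) rfl := rfl
  simp only [totWord, atWord]
  rw [h, Linear.comp_units_smul, Linear.units_smul_comp]

theorem insertWord_eq {k : ℕ} {r : ℤ} (φ : GrHom (tpow A k) A r) (p u w : List ℤ)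
    (hu : u.length = k) : insertWord φ p u w hu = (p.sum * r).negOnePow •
    ((wordSplit A p (u ++ w)).hom ≫
      wordObj A p ◁ ((wordSplit A u w).hom ≫ φ.atWord u hu (u.sum + r) rfl ▷ wordObj A w ≫
        (wordCons A (u.sum + r) w).hom) ≫
      (wordSplit A p ((u.sum + r) :: w)).inv) := by
  rw [insertWord]
  congr 3
  exact congrArg (wordObj A p ◁ ·) (congrArg ((wordSplit A u w).hom ≫ ·) (Category.comp_id _).symm)

theorem insertHom_comp_totWord {k : ℕ} {r s t : ℤ} (φ : GrHom (tpow A k) A r) (j l n : ℕ)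
    (h : j + k + l = n) (ψ : GrHom (tpow A (j + 1 + l)) B s) (ht : r + s = t) {p u v w : List ℤ}
    (hw : p ++ (u ++ v) = w) (hn : w.length = n) (hp : p.length = j) (hu : u.length = k)
    (hv : v.length = l) :
    ((insertHom φ j l n h).comp ψ t ht).totWord w hn =
      eqToHom (by rw [hw]) ≫ insertWord φ p u v hu ≫
        ψ.totWord (p ++ (u.sum + r) :: v) (by simp; omega) := by
  subst hw
  have key : tpowι A (p ++ (u ++ v)) hn rfl ≫ (insertHom φ j l n h).app _ _ rfl =
      insertWord φ p u v hu ≫ tpowι A (p ++ (u.sum + r) :: v) (by simp; omega)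
        (by simp only [List.sum_append, List.sum_cons]; ring) :=
    tpowι_insertHom φ j l n h p u v hp hu hv _ _ rfl rfl
  rw [eqToHom_refl, Category.id_comp, GrHom.totWord, GrHom.atWord,
    GrHom.comp_app _ ψ t ht _ _ _ rfl (by omega), Category.assoc, Category.assoc, reassoc_of% key,
    ← Category.assoc (tpowι _ _ _ _), tpowι_app, GrHom.atWord_totι]

variable [TensorPreservesCoproducts C] [MonoidalPreadditive C]

theorem tensor_barι_letterCons {X : C} {q : ℤ} (f : X ⟶ A q) (v : List ℤ) :
    ((f ≫ totι A q) ⊗ₘ barι A v) ≫ letterCons A =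
      f ▷ wordObj A v ≫ (wordCons A q v).hom ≫ barι A (q :: v) := by
  rw [MonoidalCategory.tensorHom_def', comp_whiskerRight, Category.assoc, Category.assoc,
    totι_letterCons, whisker_exchange_assoc, whiskerLeft_barι_consMap]

theorem barι_barDer (b : bar A ⟶ tot A) (w : List ℤ) : barι A w ≫ barDer b =
    ∑ i ∈ Finset.range (w.length + 1), ∑ k ∈ Finset.range ((w.drop i).length + 1),
      wordSplitOf A (List.take_append_drop i w) ≫ ((barι A (w.take i) ≫ barSign A) ⊗ₘ
        (wordSplitOf A (List.take_append_drop k (w.drop i)) ≫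
          ((barι A ((w.drop i).take k) ≫ b) ⊗ₘ barι A ((w.drop i).drop k)) ≫ letterCons A)) ≫
        barMul A := by
  rw [barDer, mul_assoc, conv_eq, ← Category.assoc, barι_comulPair, Preadditive.sum_comp]
  refine Finset.sum_congr rfl fun i _ => ?_
  rw [letterMap_conv, ← Category.assoc (barι A _), barι_comulPair, Preadditive.sum_comp, tensor_sum,
    Preadditive.comp_sum, Preadditive.sum_comp]
  refine Finset.sum_congr rfl fun k _ => ?_
  simp only [Category.assoc, Category.comp_id]

theorem barDer_hat_term (m : ∀ i : ℕ, GrHom (tpow A i) A (2 - (i : ℤ)))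
    (φ : ∀ i : ℕ, GrHom (tpow A i) B (a - (i : ℤ))) {p u v x w : List ℤ} (hx : u ++ v = x)
    (hw : p ++ x = w) (hw' : p ++ (u ++ v) = w) (k n : ℕ) (hu : u.length = k)
    (hn : (p ++ (u.sum + (2 - (k : ℤ))) :: v).length = n) :
    (wordSplitOf A hw ≫ ((barι A p ≫ barSign A) ⊗ₘ (wordSplitOf A hx ≫
      ((barι A u ≫ hat m) ⊗ₘ barι A v) ≫ letterCons A)) ≫ barMul A) ≫ hat φ =
    (shiftExp w + (p.length * k + v.length : ℤ)).negOnePow • (eqToHom (by rw [hw']) ≫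
      insertWord (m k) p u v hu ≫ (φ n).totWord (p ++ (u.sum + (2 - (k : ℤ))) :: v) hn) := by
  subst hx hw hu
  have e1 : barι A u ≫ hat m = (shiftExp u).negOnePow •
      ((m u.length).atWord u rfl (u.sum + (2 - (u.length : ℤ))) rfl ≫ totι A _) := by
    rw [barι_hat, GrHom.totWord]
  simp only [e1, barι_sign, units_smul_tensor, tensor_units_smul, Linear.units_smul_comp,
    Linear.comp_units_smul, tensor_barι_letterCons]
  obtain ⟨q, hq⟩ : ∃ q, q = u.sum + (2 - (u.length : ℤ)) := ⟨_, rfl⟩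
  rw [insertWord_eq]
  have e2 : ∀ {X : C} (Z : X ⟶ wordObj A (q :: v)),
      (barι A p ⊗ₘ (Z ≫ barι A (q :: v))) ≫ barMul A =
        wordObj A p ◁ Z ≫ (wordSplit A p (q :: v)).inv ≫ barι A (p ++ q :: v) := by
    intro X Z
    rw [← barι_tensor_barι_barMul]
    simp [MonoidalCategory.tensorHom_def']
  have e3 := e2 (wordSplitOf A (rfl : u ++ v = u ++ v) ≫
    (m u.length).atWord u rfl q hq.symm ▷ wordObj A v ≫ (wordCons A q v).hom)
  subst hq
  simp only [Category.assoc] at e3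
  simp only [Linear.units_smul_comp, Linear.comp_units_smul, Category.assoc] 
  rw [reassoc_of% e3, barι_hat, totWord_length φ _ n hn]
  simp only [Linear.comp_units_smul, smul_smul, ← Int.negOnePow_add, wordSplitOf, eqToHom_refl,
    Category.id_comp]
  congr 1
  rw [Int.negOnePow_eq_iff]
  -- The exponents on the two sides differ by exactly -2|p|. The sign of `barSign` on the prefix
  -- together with the twists accounts for both the Koszul sign and the sign jk + l.
  refine ⟨-p.length, ?_⟩
  simp only [shiftExp_append, shiftExp, wordDeg, List.length_append, List.length_cons]
  push_cast
  ring

/-- Two successive cuts of a word choose a subword on which to apply `m`, that is, a triple (j, k,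
l). The signs are matched in `barDer_hat_term`. -/
theorem hat_insertSum (m : ∀ i : ℕ, GrHom (tpow A i) A (2 - (i : ℤ))) (hm : m 0 = 0)
    (φ : ∀ i : ℕ, GrHom (tpow A i) B (a - (i : ℤ))) {a' : ℤ}
    (ha : ∀ n : ℕ, a + 1 - n = a' - (n : ℤ)) :
    hat (fun n => insertSum m φ n (a' - (n : ℤ)) (ha n)) = barDer (hat m) ≫ hat φ := by
  refine bar_ext fun w => ?_
  rw [barι_hat, ← Category.assoc, barι_barDer, Finset.sum_sigma', Preadditive.sum_comp, insertSum,
    GrHom.totWord_sum, Finset.smul_sum]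
  have hm1 : hat m ∈ barFil A _ 1 := (hat_mem_barFil m 1).2 fun n hn => by
    obtain rfl : n = 0 := by omega
    exact hm
  refine Finset.sum_of_injOn (fun x : Triple w.length => (⟨x.j, x.k⟩ : (_ : ℕ) × ℕ)) ?_ ?_ ?_ ?_
  · rintro ⟨⟨j, k, l⟩, h⟩ _ ⟨⟨j', k', l'⟩, h'⟩ _ e
    simp only [Triple.j, Triple.k, Sigma.mk.injEq, heq_eq_eq] at e h h' ⊢
    ext <;> simp only [] <;> omega
  · rintro ⟨⟨j, k, l⟩, h⟩ _
    simp only [Triple.j, Triple.k, Finset.coe_sigma, Set.mem_sigma_iff, Finset.mem_coe,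
      Finset.mem_range, List.length_drop] at h ⊢
    omega
  · rintro ⟨i, k⟩ h1 h2
    simp only [Finset.mem_sigma, Finset.mem_range, List.length_drop] at h1
    -- The cuts not coming from a `Triple` are those with an empty middle word, where m₀ = 0
    -- contributes nothing.
    obtain rfl : k = 0 := by
      by_contra hk
      refine h2 ⟨⟨(⟨i, by omega⟩, ⟨k, by omega⟩, ⟨w.length - i - k, by omega⟩), ?_⟩, ?_, rfl⟩
      · simp only; omega
      · exact Finset.mem_coe.2 (Finset.mem_univ _)
    have : barι A [] ≫ hat m = 0 := hm1 _ (by simp)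
    simp only [List.take_zero, this, MonoidalPreadditive.zero_tensor, zero_comp, comp_zero,
      MonoidalPreadditive.tensor_zero]
  · rintro ⟨⟨j, k, l⟩, h⟩ _
    obtain ⟨j, hj⟩ := j
    obtain ⟨k, hk⟩ := k
    obtain ⟨l, hl⟩ := l
    simp only at h
    have h1 : (w.take j).length = j := by simp; omega
    have h2 : ((w.drop j).take k).length = k := by simp; omega
    have h3 : ((w.drop j).drop k).length = l := by simp; omega
    simp only [Triple.j, Triple.k, Triple.l]
    rw [barDer_hat_term m φ _ _ (by simp) k (j + 1 + l) h2 (by simp; omega), GrHom.totWord_smul,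
      insertHom_comp_totWord (m k) j l w.length h.1 (φ (j + 1 + l)) _
        (p := w.take j) (u := (w.drop j).take k) (v := (w.drop j).drop k) (by simp) rfl h1 h2 h3,
      smul_smul, ← Int.negOnePow_add]
    congr 2
    rw [h1, h3]
    push_cast
    ring

end InsertSum

/-! ### Recursion over compositions of an integer -/

section Compositions

/-- The exponent `∑_α (1 - i_α) ∑_{β < α} i_β` attached to a list. -/
def listSign : List ℕ → ℤ
  | [] => 0
  | n :: l => n * (l.map fun i : ℕ => 1 - (i : ℤ)).sum + listSign l

theorem sum_get_eq_listSign (l : List ℕ) :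
    ∑ α : Fin l.length, (1 - (l.get α : ℤ)) * ((l.take α).sum : ℤ) = listSign l := by
  induction l with
  | nil => rfl
  | cons n l ih =>
    have h : (l.map fun i : ℕ => 1 - (i : ℤ)).sum = ∑ α : Fin l.length, (1 - (l.get α : ℤ)) := by
      conv_lhs => rw [← List.ofFn_get l, List.map_ofFn, List.sum_ofFn]
      rfl
    rw [listSign, ← ih, h, Finset.mul_sum, ← Finset.sum_add_distrib]
    refine (Fin.sum_univ_succ (n := l.length) _).trans ?_
    simp only [Fin.val_zero, List.take_zero, List.sum_nil, Nat.cast_zero, mul_zero, zero_add]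
    refine Finset.sum_congr rfl fun α _ => ?_
    have h1 : (n :: l).get α.succ = l.get α := rfl
    rw [h1, Fin.val_succ, List.take_succ_cons, List.sum_cons, Nat.cast_add]
    ring

theorem blockSign_eq {n : ℕ} (c : Composition n) : blockSign c = listSign c.blocks :=
  sum_get_eq_listSign c.blocks

theorem sum_composition_zero {M : Type*} [AddCommMonoid M] (F : List ℕ → M) :
    ∑ c : Composition 0, F c.blocks = F [] := by
  rw [Fintype.sum_eq_single (Composition.ones 0)]
  · rfl
  · intro c hc
    exact absurd (Composition.ext (by rw [c.blocks_eq_nil.2 rfl]; rfl)) hc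

/-- Removing the first block matches the recursion F = 1 + fF of the geometric series. The index i
stands for a first block of size i + 1, so that it is never empty. -/
theorem sum_composition {M : Type*} [AddCommMonoid M] {n : ℕ} (hn : 0 < n) (F : List ℕ → M) :
    ∑ c : Composition n, F c.blocks =
      ∑ i ∈ Finset.range n, ∑ c : Composition (n - (i + 1)), F ((i + 1) :: c.blocks) := by
  rw [Finset.sum_sigma']
  symm
  refine Finset.sum_bij (fun x hx => (⟨(x.1 + 1) :: x.2.blocks, ?_, ?_⟩ : Composition n))
    (fun _ _ => Finset.mem_univ _) ?_ ?_ (fun _ _ => rfl)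
  · intro i hi
    rcases List.mem_cons.1 hi with rfl | hi
    · exact Nat.succ_pos _
    · exact x.2.blocks_pos hi
  · have := Finset.mem_range.1 (Finset.mem_sigma.1 hx).1
    rw [List.sum_cons, x.2.blocks_sum]
    omega
  · rintro ⟨i, c⟩ _ ⟨i', c'⟩ _ h
    have h' := congrArg Composition.blocks h
    simp only [List.cons.injEq, add_left_inj] at h'
    obtain ⟨rfl, h'⟩ := h'
    rw [Composition.ext h']
  · rintro ⟨bs, h1, h2⟩ _
    cases bs with
    | nil => simp at h2; omega
    | cons b bs =>
      have hb : 0 < b := h1 (by simp)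
      rw [List.sum_cons] at h2
      refine ⟨⟨b - 1, ⟨bs, fun hi => h1 (by simp [hi]), by omega⟩⟩, ?_, ?_⟩
      · simp only [Finset.mem_sigma, Finset.mem_range, Finset.mem_univ, and_true]
        omega
      · refine Composition.ext ?_
        simp only [List.cons.injEq, and_true]
        omega

end Compositions

/-! ### Coalgebra morphisms and the sums over blocks -/

section BlockSum

variable {C : Type u} [Category.{v} C] [MonoidalCategory C] [HasCoproducts.{0} C] [Preadditive C]
  {A B E : GradedObject ℤ C} {a : ℤ}

theorem tensorHom_comp_totWord (f : ∀ i : ℕ, GrHom (tpow A i) B (1 - (i : ℤ))) {n : ℕ}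
    (c : Composition n) {s t : ℤ} (ψ : GrHom (tpow B c.length) E s)
    (ht : (c.length : ℤ) - n + s = t) {L : List (List ℤ)} {w : List ℤ}
    (hw : L.flatten = w) (hn : w.length = n) (hL : L.map List.length = c.blocks) :
    ((tensorHom f c).comp ψ t ht).totWord w hn =
      eqToHom (by rw [hw]) ≫ blockHom f L ≫
        ψ.totWord (L.map fun u => u.sum + (1 - (u.length : ℤ)))
          (by simpa using congrArg List.length hL) := by
  subst hw
  have hl : L.length = c.length := by simpa using congrArg List.length hL
  have key : tpowι A L.flatten hn rfl ≫ (tensorHom f c).app _ _ rfl =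
      blockHom f L ≫ tpowι B (L.map fun u => u.sum + (1 - (u.length : ℤ)))
        (by simpa using congrArg List.length hL) (by
          rw [sum_map_block, hn, hl]) :=
    tpowι_tensorHom f c L hL _ _ rfl rfl
  rw [eqToHom_refl, Category.id_comp, GrHom.totWord, GrHom.atWord,
    GrHom.comp_app _ ψ t ht _ _ _ rfl (by omega), Category.assoc, Category.assoc, reassoc_of% key,
    ← Category.assoc (tpowι _ _ _ _), tpowι_app, GrHom.atWord_totι]

variable [TensorPreservesCoproducts C] [MonoidalPreadditive C]

/-- The summand of `barHom f` that belongs to a decomposition of a word into blocks of given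
lengths. -/
noncomputable def blockBar (f : bar A ⟶ tot B) : List ℕ → ∀ w : List ℤ, (wordObj A w ⟶ bar B)
  | [], w => barι A w ≫ 1
  | i :: l, w => wordSplitOf A (List.take_append_drop i w) ≫
      ((barι A (w.take i) ≫ f) ⊗ₘ blockBar f l (w.drop i)) ≫ letterCons B

/-- Strong induction through F = 1 + fF: the first cut detaches the first block, and cuts with an
empty first block vanish because f kills the empty word. -/
theorem barι_barHom {f : bar A ⟶ tot B} (hf : f ∈ barFil A _ 1) (n : ℕ) :
    ∀ w : List ℤ, w.length = n →
      barι A w ≫ barHom f = ∑ c : Composition n, blockBar f c.blocks w := by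
  induction n using Nat.strong_induction_on with
  | _ n ih =>
    intro w hw
    rcases Nat.eq_zero_or_pos n with rfl | hn
    · obtain rfl := List.length_eq_zero_iff.1 hw
      rw [sum_composition_zero (fun l => blockBar f l []), barι_nil, Category.assoc,
        (isGroupLike_barHom hf).nilMap_comp, blockBar, barι_nil, Category.assoc, nilMap_comp_one]
    · rw [sum_composition hn (fun l => blockBar f l w), barHom_eq hf, Preadditive.comp_add,
        letterMap_conv, ← Category.assoc, barι_comulPair, Finset.sum_range_succ', hw,
        Preadditive.add_comp, Preadditive.sum_comp]
      have h0 : barι A (w.take 0) ≫ f = 0 := hf _ (by simp)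
      have h1 : barι A w ≫ (1 : bar A ⟶ bar B) = 0 := by
        match w, hw with
        | [], hw => exact absurd hw hn.ne
        | p :: w, _ => rw [convOne_eq, ← Category.assoc, barι_cons_barCounit, zero_comp]
      rw [h0, h1, MonoidalPreadditive.zero_tensor, comp_zero, zero_comp, zero_add, add_zero]
      refine Finset.sum_congr rfl fun i hi => ?_
      have hi' := Finset.mem_range.1 hi
      rw [ih (n - (i + 1)) (by omega) (w.drop (i + 1)) (by simp; omega), tensor_sum,
        Preadditive.comp_sum, Preadditive.sum_comp]
      refine Finset.sum_congr rfl fun c _ => ?_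
      rw [blockBar, Category.assoc]

/-- The exponent of the sign in the shifted version of `blockHom`. -/
def blocksExp : List (List ℤ) → ℤ
  | [] => 0
  | u :: L => shiftExp u + u.sum * (L.map fun x => 1 - (x.length : ℤ)).sum + blocksExp L

theorem sum_one_sub_length (L : List (List ℤ)) :
    (L.map fun x => 1 - (x.length : ℤ)).sum = L.length - L.flatten.length := by
  induction L with
  | nil => rfl
  | cons u L ih =>
    rw [List.map_cons, List.sum_cons, ih, List.flatten_cons, List.length_append, List.length_cons]
    push_cast
    ring

/-- Adding a block u in front of L changes the exponent by 2 deg(u) (|flatten L| - |L|), so the sign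
s of the A∞-morphism relations is exactly what the shift produces. -/
theorem even_blocksExp (L : List (List ℤ)) :
    Even (shiftExp L.flatten + listSign (L.map List.length) - (blocksExp L +
      shiftExp (L.map fun u => u.sum + (1 - (u.length : ℤ))))) := by
  induction L with
  | nil => exact ⟨0, rfl⟩
  | cons u L ih =>
    obtain ⟨x, hx⟩ := ih
    refine ⟨x + wordDeg u * (L.flatten.length - L.length), ?_⟩
    rw [List.flatten_cons, shiftExp_append, List.map_cons, listSign, List.map_cons, shiftExp,
      blocksExp, List.map_map]
    have h : (L.map ((fun i : ℕ => 1 - (i : ℤ)) ∘ List.length)).sum =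
      (L.map fun x => 1 - (x.length : ℤ)).sum := rfl
    rw [h, sum_one_sub_length, List.length_map]
    unfold wordDeg
    linear_combination hx

theorem blockBar_hat (f : ∀ i : ℕ, GrHom (tpow A i) B (1 - (i : ℤ))) (L : List (List ℤ)) :
    ∀ {w : List ℤ} (hw : L.flatten = w), blockBar (hat f) (L.map List.length) w =
      (blocksExp L).negOnePow • (eqToHom (by rw [hw]) ≫ blockHom f L ≫
        barι B (L.map fun u => u.sum + (1 - (u.length : ℤ)))) := by
  induction L with
  | nil =>
    rintro _ rfl
    have h : barι A [] ≫ (1 : bar A ⟶ bar B) =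
        (wordNil A).inv ≫ (wordNil B).hom ≫ barι B [] := by
      rw [barι_nil, Category.assoc, nilMap_comp_one, nilMap]
    rw [blocksExp, Int.negOnePow_zero, one_smul, eqToHom_refl, Category.id_comp, blockHom]
    exact h.trans (Category.id_comp _)
  | cons u L ih =>
    rintro w hw
    have aux : ∀ {u' v' : List ℤ} (h' : u' ++ v' = w), u' = u → v' = L.flatten →
        wordSplitOf A h' ≫ ((barι A u' ≫ hat f) ⊗ₘ blockBar (hat f) (L.map List.length) v') ≫
          letterCons B =
        (blocksExp (u :: L)).negOnePow • (eqToHom (by rw [hw]) ≫ blockHom f (u :: L) ≫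
        barι B ((u :: L).map fun u => u.sum + (1 - (u.length : ℤ)))) := by
      rintro u' v' h' rfl rfl
      subst hw
      rw [ih rfl, barι_hat, GrHom.totWord, eqToHom_refl, Category.id_comp, blockHom]
      have e : ∀ {X Y : C} {q : ℤ} {v : List ℤ} (g : X ⟶ B q) (h : Y ⟶ wordObj B v),
          ((g ≫ totι B q) ⊗ₘ (h ≫ barι B v)) ≫ letterCons B =
            (g ⊗ₘ h) ≫ (wordCons B q v).hom ≫ barι B (q :: v) := by
        intro X Y q v g h
        have h1 := tensor_barι_letterCons (A := B) (𝟙 (B q)) v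
        rw [Category.id_comp, id_whiskerRight, Category.id_comp] at h1
        rw [← tensorHom_comp_tensorHom, Category.assoc, h1]
      simp only [units_smul_tensor, tensor_units_smul, Linear.units_smul_comp,
        Linear.comp_units_smul, e, smul_smul, ← Int.negOnePow_add, wordSplitOf, eqToHom_refl,
        Category.id_comp]
      have hs : (blocksExp L + shiftExp u').negOnePow = (blocksExp (u' :: L)).negOnePow *
          (u'.sum * (L.map fun x => 1 - (x.length : ℤ)).sum).negOnePow := by
        rw [← Int.negOnePow_add, Int.negOnePow_eq_iff, blocksExp]
        exact ⟨-(u'.sum * (L.map fun x => 1 - (x.length : ℤ)).sum), by ring⟩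
      rw [hs, ← smul_smul]
      refine congrArg _ (Eq.trans ?_ (Linear.units_smul_comp _ _ _).symm)
      refine congrArg _ (Eq.trans ?_ (Category.assoc _ _ _).symm)
      refine congrArg _ (congrArg _ ?_)
      exact Category.id_comp _
    exact aux _ (by rw [← hw]; simp) (by rw [← hw]; simp)

theorem hat_blockSum (f : ∀ i : ℕ, GrHom (tpow A i) B (1 - (i : ℤ))) (hf : f 0 = 0)
    (φ : ∀ i : ℕ, GrHom (tpow B i) E (a - (i : ℤ))) :
    hat (blockSum f φ) = barHom (hat f) ≫ hat φ := by
  refine bar_ext fun w => ?_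
  have hf1 : hat f ∈ barFil A _ 1 := (hat_mem_barFil f 1).2 fun n hn => by
    obtain rfl : n = 0 := by omega
    exact hf
  rw [barι_hat, ← Category.assoc, barι_barHom hf1 _ w rfl, Preadditive.sum_comp, blockSum,
    GrHom.totWord_sum, Finset.smul_sum]
  refine Finset.sum_congr rfl fun c _ => ?_
  have h1 := w.flatten_splitWrtComposition c
  have h2 := w.map_length_splitWrtComposition c
  have h3 := blockBar_hat f _ h1
  rw [h2] at h3
  rw [GrHom.totWord_smul, tensorHom_comp_totWord f c (φ c.length) _ h1 rfl h2, h3,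
    Linear.units_smul_comp, Category.assoc, Category.assoc, barι_hat,
    totWord_length, Linear.comp_units_smul, Linear.comp_units_smul, smul_smul, smul_smul,
    ← Int.negOnePow_add, ← Int.negOnePow_add]
  congr 1
  rw [Int.negOnePow_eq_iff, blockSign_eq]
  have := even_blocksExp (w.splitWrtComposition c)
  rwa [h1, h2] at this

end BlockSum

/-! ### Maps of total objects from components -/

section TotalMaps

variable {C : Type u} [Category.{v} C] [HasCoproducts.{0} C] {A B E : GradedObject ℤ C}

/-- The morphism of total objects given by morphisms of the components of degree `r`. -/
noncomputable def totMap (r : ℤ) (φ : ∀ p q : ℤ, p + r = q → (A p ⟶ B q)) : tot A ⟶ tot B :=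
  totDesc fun p => φ p (p + r) rfl ≫ totι B (p + r)

theorem totι_totMap {r : ℤ} (φ : ∀ p q : ℤ, p + r = q → (A p ⟶ B q)) (p q : ℤ) (h : p + r = q) :
    totι A p ≫ totMap r φ = φ p q h ≫ totι B q := by
  subst h
  exact totι_totDesc _ _

/-- The morphism of total objects given by morphisms of the components. -/
noncomputable def totMapZero (φ : ∀ p : ℤ, A p ⟶ B p) : tot A ⟶ tot B :=
  totDesc fun p => φ p ≫ totι B p

theorem totι_totMapZero (φ : ∀ p : ℤ, A p ⟶ B p) (p : ℤ) :
    totι A p ≫ totMapZero φ = φ p ≫ totι B p :=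
  totι_totDesc _ _

variable [Preadditive C]

theorem hasDegree_totMap {r : ℤ} (φ : ∀ p q : ℤ, p + r = q → (A p ⟶ B q)) :
    HasDegree r (totMap r φ) :=
  hasDegree_tot_iff.2 fun p d h => by
    rw [totι_totMap φ p _ rfl, Category.assoc, totι_proj _ _ _ (by omega)]

theorem hasDegree_totMapZero (φ : ∀ p : ℤ, A p ⟶ B p) : HasDegree 0 (totMapZero φ) :=
  hasDegree_tot_iff.2 fun p d h => by
    rw [totι_totMapZero, Category.assoc, totι_proj _ _ _ (by omega)]

theorem comp_totι_injective [MonoidalCategory C] {X : C} {q : ℤ} {f g : X ⟶ A q}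
    (h : f ≫ totι A q = g ≫ totι A q) : f = g := by
  have := h =≫ totPr A q
  simpa only [Category.assoc, totι_totPr, Category.comp_id] using this

end TotalMaps

/-! ### A∞-structures and morphisms as bar data -/

section Dictionary

variable {C : Type u} [Category.{v} C] [MonoidalCategory C] [HasCoproducts.{0} C]
  [TensorPreservesCoproducts C] [Preadditive C] [MonoidalPreadditive C]
  {A B E : GradedObject ℤ C} {a : ℤ}

theorem forall_lt_one {P : ℕ → Prop} (h : P 0) : ∀ n < 1, P n := fun n hn => by
  obtain rfl : n = 0 := by omega
  exact h

theorem barDer_comp_mem_one {b : bar A ⟶ tot A} (hb : b ∈ barFil A _ 1) {Y : C} (f : bar A ⟶ Y) :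
    barDer b ≫ f ∈ barFil A _ 1 :=
  comp_mem_barFil (conv_mem_barFil (conv_mem_barFil (mem_barFil_zero _) (comp_mem_barFil hb _)
    (zero_add 1).ge) (mem_barFil_zero _) le_rfl) _

namespace AInfStructure

variable (mA : AInfStructure A)

/-- The corestriction of the codifferential of the bar construction. -/
noncomputable def barOp : bar A ⟶ tot A := hat mA.m

theorem hasDegree_barOp : HasDegree 1 mA.barOp := hasDegree_hat mA.m rfl

theorem barOp_mem : mA.barOp ∈ barFil A _ 1 := (hat_mem_barFil _ 1).2 (forall_lt_one mA.m_zero)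

theorem barDer_barOp : barDer mA.barOp ≫ mA.barOp = 0 := by
  have h := hat_insertSum mA.m mA.m_zero mA.m (a' := 3) (fun n => by ring)
  refine (eq_zero_of_mem_barFil fun n hn => ?_)
  rw [barOp, ← h] at hn ⊢
  rw [hat_mem_barFil]
  intro k _
  rcases Nat.eq_zero_or_pos k with rfl | hk
  · have h1 := barDer_comp_mem_one mA.barOp_mem mA.barOp
    rw [barOp, ← h, hat_mem_barFil] at h1
    exact h1 0 zero_lt_one
  · exact mA.rel k hk

theorem isMinimal_iff : mA.IsMinimal ↔ mA.barOp ∈ barFil A _ 2 := by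
  rw [barOp, hat_mem_barFil, IsMinimal]
  constructor
  · intro h n hn
    rcases Nat.eq_zero_or_pos n with rfl | h1
    · exact mA.m_zero
    · obtain rfl : n = 1 := by omega
      exact h
  · exact fun h => h 1 one_lt_two

/-- The `A_∞`-structure of a codifferential of the bar construction. -/
noncomputable def ofBar (b : bar A ⟶ tot A) (hb : HasDegree 1 b) (hb1 : b ∈ barFil A _ 1)
    (hbb : barDer b ≫ b = 0) : AInfStructure A where
  m := unhat b 2
  m_zero := (hat_mem_barFil _ 1).1 (by rwa [hat_unhat (a := 2) hb rfl]) 0 zero_lt_one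
  rel n hn := by
    have h0 : unhat b 2 0 = 0 :=
      (hat_mem_barFil (unhat b 2) 1).1 (by rwa [hat_unhat (a := 2) hb rfl]) 0 zero_lt_one
    have h := hat_insertSum (unhat b 2) h0 (unhat b 2) (a' := 3) (fun n => by ring)
    rw [hat_unhat (a := 2) hb rfl, hbb] at h
    exact (hat_mem_barFil _ (n + 1)).1 (h ▸ zero_mem _) n n.lt_succ_self

theorem barOp_ofBar {b : bar A ⟶ tot A} (hb : HasDegree 1 b) (hb1 : b ∈ barFil A _ 1)
    (hbb : barDer b ≫ b = 0) : (ofBar b hb hb1 hbb).barOp = b :=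
  hat_unhat hb rfl

theorem totι_letterMap_barOp (p q : ℤ) (h : p + 1 = q) :
    totι A p ≫ letterMap A ≫ mA.barOp = mA.complex.d p q ≫ totι A q := by
  rw [barOp, letterMap_hat mA.m p q (by simpa using h)]
  simp only [complex, dif_pos h]

end AInfStructure

namespace AInfHom

variable {mA : AInfStructure A} {mB : AInfStructure B} {mE : AInfStructure E}

/-- The corestriction of the morphism of bar constructions. -/
noncomputable def barOp (f : AInfHom mA mB) : bar A ⟶ tot B := hat f.f

theorem hasDegree_barOp (f : AInfHom mA mB) : HasDegree 0 f.barOp := hasDegree_hat f.f rfl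

theorem barOp_mem (f : AInfHom mA mB) : f.barOp ∈ barFil A _ 1 :=
  (hat_mem_barFil _ 1).2 (forall_lt_one f.f_zero)

theorem barDer_barOp (f : AInfHom mA mB) :
    barDer mA.barOp ≫ f.barOp = barHom f.barOp ≫ mB.barOp := by
  have h := hat_insertSum mA.m mA.m_zero f.f (a' := 2) (fun n => by ring)
  have h' := hat_blockSum f.f f.f_zero mB.m
  have h1 := barDer_comp_mem_one mA.barOp_mem f.barOp
  have h2 := barHom_comp_mem_one f.barOp_mem mB.barOp_mem
  rw [AInfStructure.barOp, barOp, ← h] at h1 ⊢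
  exact hat_eq_of_pos f.rel h' h1 h2

/-- The `A_∞`-morphism of a morphism of bar constructions. -/
noncomputable def ofBar (f : bar A ⟶ tot B) (hf : HasDegree 0 f) (hf1 : f ∈ barFil A _ 1)
    (h : barDer mA.barOp ≫ f = barHom f ≫ mB.barOp) : AInfHom mA mB where
  f := unhat f 1
  f_zero := (hat_mem_barFil _ 1).1 (by rwa [hat_unhat (a := 1) hf rfl]) 0 zero_lt_one
  rel n _ := by
    have h0 : unhat f 1 0 = 0 :=
      (hat_mem_barFil (unhat f 1) 1).1 (by rwa [hat_unhat (a := 1) hf rfl]) 0 zero_lt_one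
    have h1 := hat_insertSum mA.m mA.m_zero (unhat f 1) (a' := 2) (fun n => by ring)
    have h2 := hat_blockSum (unhat f 1) h0 mB.m
    rw [hat_unhat (a := 1) hf rfl] at h1 h2
    exact hat_injective (h1.trans (h.trans h2.symm)) n

theorem barOp_ofBar {f : bar A ⟶ tot B} (hf : HasDegree 0 f) (hf1 : f ∈ barFil A _ 1)
    (h : barDer mA.barOp ≫ f = barHom f ≫ mB.barOp) : (ofBar f hf hf1 h).barOp = f :=
  hat_unhat hf rfl

theorem totι_letterMap_barOp (f : AInfHom mA mB) (p : ℤ) :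
    totι A p ≫ letterMap A ≫ f.barOp = f.linear.f p ≫ totι B p :=
  letterMap_hat f.f p p (by simp)

theorem isIdentity_compFun (f : AInfHom mA mB) (g : AInfHom mB mA)
    (h : barHom f.barOp ≫ g.barOp = letterProj A) : IsIdentity (f.compFun g) := by
  have h1 : hat (f.compFun g) = letterProj A := (hat_blockSum f.f f.f_zero g.f).trans h
  refine (isIdentity_iff _ ?_).2 h1
  exact (hat_mem_barFil _ 1).1 (h1 ▸ letterProj_mem A) 0 zero_lt_one

end AInfHom

end Dictionary

/-! ### Components of the differential -/

section Differential

variable {C : Type u} [Category.{v} C] [MonoidalCategory C] [HasCoproducts.{0} C] [Preadditive C]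
  {A : GradedObject ℤ C}

/-- The components of the differential of `(A, m₁)`. -/
noncomputable def AInfStructure.d (mA : AInfStructure A) (i j : ℤ) : A i ⟶ A j :=
  mA.complex.d i j

theorem AInfStructure.d_comp_d (mA : AInfStructure A) (i j k : ℤ) : mA.d i j ≫ mA.d j k = 0 :=
  mA.complex.d_comp_d i j k

end Differential

/-! ### Transfer of A∞-structures along homotopy equivalences -/

section TransferStructure

variable {C : Type u} [Category.{v} C] [MonoidalCategory C] [HasCoproducts.{0} C]
  [TensorPreservesCoproducts C] [Preadditive C] [MonoidalPreadditive C]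
  {A V : GradedObject ℤ C}

/-- The differential of `(A, m₁)` as an endomorphism of the total object. -/
noncomputable def AInfStructure.totD (mA : AInfStructure A) : tot A ⟶ tot A :=
  letterMap A ≫ mA.barOp

theorem AInfStructure.totι_totD (mA : AInfStructure A) (p q : ℤ) (h : p + 1 = q) :
    totι A p ≫ mA.totD = mA.d p q ≫ totι A q :=
  mA.totι_letterMap_barOp p q h

theorem AInfStructure.totD_totD (mA : AInfStructure A) : mA.totD ≫ mA.totD = 0 :=
  tot_ext fun p => by
    rw [← Category.assoc, mA.totι_totD p _ rfl, Category.assoc, mA.totι_totD _ _ rfl,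
      ← Category.assoc, mA.d_comp_d, zero_comp, comp_zero]

theorem AInfStructure.exists_transfer (mA : AInfStructure A)
    {d : tot V ⟶ tot V} {g : tot V ⟶ tot A} {p : tot A ⟶ tot V} {h : tot A ⟶ tot A}
    (hd : HasDegree 1 d) (hg : HasDegree 0 g) (hp : HasDegree 0 p) (hh : HasDegree (-1) h)
    (hdd : d ≫ d = 0) (hdg : d ≫ g = g ≫ mA.totD) (hmp : mA.totD ≫ p = p ≫ d)
    (hpg : p ≫ g = 𝟙 _ + mA.totD ≫ h + h ≫ mA.totD) :
    ∃ (mV : AInfStructure V) (f : AInfHom mV mA), mV.totD = d ∧ letterMap V ≫ f.barOp = g ∧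
      mV.barOp = letterProj V ≫ d +
        barHom f.barOp ≫ (mA.barOp - letterProj A ≫ mA.totD) ≫ p := by
  obtain ⟨c, f, hc, hc1, hcc, hcd, hf, hf1, hcf, hfg, hcp⟩ :=
    AInfinity.exists_transfer mA.hasDegree_barOp mA.barOp_mem mA.barDer_barOp rfl mA.totD_totD
      hd hg hp hh hdd hdg hmp hpg
  obtain ⟨mV, rfl⟩ : ∃ mV : AInfStructure V, mV.barOp = c :=
    ⟨_, AInfStructure.barOp_ofBar hc hc1 hcc⟩
  obtain ⟨F, rfl⟩ : ∃ F : AInfHom mV mA, F.barOp = f := ⟨_, AInfHom.barOp_ofBar hf hf1 hcf⟩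
  exact ⟨mV, F, hcd, hfg, hcp⟩

theorem AInfStructure.totMapZero_comp_totMapZero (mA : AInfStructure A) {g : ∀ i, V i ⟶ A i}
    {p : ∀ i, A i ⟶ V i} {h : ∀ i j, A i ⟶ A j} (hpg : ∀ i, p i ≫ g i =
      𝟙 (A i) + mA.d i (i + 1) ≫ h (i + 1) i + h i (i - 1) ≫ mA.d (i - 1) i) :
    totMapZero p ≫ totMapZero g = 𝟙 _ + mA.totD ≫ totMap (-1) (fun i j _ => h i j) +
      totMap (-1) (fun i j _ => h i j) ≫ mA.totD :=
  tot_ext fun i => by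
    rw [← Category.assoc, totι_totMapZero, Category.assoc, totι_totMapZero, ← Category.assoc, hpg]
    simp only [Preadditive.comp_add, Preadditive.add_comp, Category.comp_id, Category.id_comp,
      Category.assoc]
    rw [← Category.assoc (totι A i), mA.totι_totD _ _ rfl, Category.assoc,
      totι_totMap _ (i + 1) i (by ring), ← Category.assoc (totι A i),
      totι_totMap _ i (i - 1) (by ring), Category.assoc,
      mA.totι_totD (i - 1) i (sub_add_cancel i 1)]

theorem AInfStructure.totD_totMapZero (mA : AInfStructure A) {p : ∀ i, A i ⟶ V i}
    {d : ∀ i j, V i ⟶ V j} (h : ∀ i j, mA.d i j ≫ p j = p i ≫ d i j) :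
    mA.totD ≫ totMapZero p = totMapZero p ≫ totMap 1 (fun i j _ => d i j) :=
  tot_ext fun i => by
    rw [← Category.assoc, mA.totι_totD _ _ rfl, Category.assoc, totι_totMapZero,
      ← Category.assoc, h, ← Category.assoc, totι_totMapZero, Category.assoc, Category.assoc,
      totι_totMap _ i _ rfl]

theorem AInfStructure.totMapZero_totD (mA : AInfStructure A) {g : ∀ i, V i ⟶ A i}
    {d : ∀ i j, V i ⟶ V j} (h : ∀ i j, d i j ≫ g j = g i ≫ mA.d i j) :
    totMap 1 (fun i j _ => d i j) ≫ totMapZero g = totMapZero g ≫ mA.totD :=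
  tot_ext fun i => by
    rw [← Category.assoc, totι_totMap _ i _ rfl, Category.assoc, totι_totMapZero,
      ← Category.assoc, h, ← Category.assoc, totι_totMapZero, Category.assoc, Category.assoc,
      mA.totι_totD _ _ rfl]

/-- The transfer of an `A_∞`-structure, in terms of the components of the homotopy data. -/
theorem AInfStructure.exists_transfer_of_components (mA : AInfStructure A)
    (d : ∀ i j, V i ⟶ V j) (g : ∀ i, V i ⟶ A i) (p : ∀ i, A i ⟶ V i) (h : ∀ i j, A i ⟶ A j)
    (hdd : ∀ i j k, d i j ≫ d j k = 0) (hdg : ∀ i j, d i j ≫ g j = g i ≫ mA.d i j)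
    (hmp : ∀ i j, mA.d i j ≫ p j = p i ≫ d i j)
    (hpg : ∀ i, p i ≫ g i =
      𝟙 (A i) + mA.d i (i + 1) ≫ h (i + 1) i + h i (i - 1) ≫ mA.d (i - 1) i) :
    ∃ (mV : AInfStructure V) (f : AInfHom mV mA), mV.totD = totMap 1 (fun i j _ => d i j) ∧
      letterMap V ≫ f.barOp = totMapZero g ∧
      mV.barOp = letterProj V ≫ totMap 1 (fun i j _ => d i j) +
        barHom f.barOp ≫ (mA.barOp - letterProj A ≫ mA.totD) ≫ totMapZero p :=
  mA.exists_transfer (h := totMap (-1) fun i j _ => h i j)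
    (hasDegree_totMap _) (hasDegree_totMapZero _) (hasDegree_totMapZero _) (hasDegree_totMap _)
    (tot_ext fun i => by
      rw [← Category.assoc, totι_totMap _ i _ rfl, Category.assoc, totι_totMap _ _ _ rfl,
        ← Category.assoc, hdd, zero_comp, comp_zero])
    (mA.totMapZero_totD hdg) (mA.totD_totMapZero hmp) (mA.totMapZero_comp_totMapZero hpg)

theorem AInfHom.linear_f_eq {mV : AInfStructure V} {mA : AInfStructure A} (f : AInfHom mV mA)
    {g : ∀ i, V i ⟶ A i} (h : letterMap V ≫ f.barOp = totMapZero g) (i : ℤ) :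
    f.linear.f i = g i := by
  have h1 := f.totι_letterMap_barOp i
  rw [h, totι_totMapZero] at h1
  exact (comp_totι_injective h1).symm

theorem cochainComplex_mk_eq (V : CochainComplex C ℤ) (d : ∀ i j, V.X i ⟶ V.X j) (h1 h2)
    (h : ∀ i j, d i j = V.d i j) : (⟨V.X, d, h1, h2⟩ : CochainComplex C ℤ) = V := by
  obtain rfl : d = V.d := funext fun i => funext fun j => h i j
  rfl

/-- The transfer of an `A_∞`-structure along a homotopy equivalence. -/
theorem AInfStructure.exists_of_homotopyEquiv (mA : AInfStructure A) (V : CochainComplex C ℤ)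
    (e : HomotopyEquiv V mA.complex) :
    ∃ mV : AInfStructure V.X, mV.complex = V ∧ ∃ f : AInfHom mV mA,
      ∀ i : ℤ, f.linear.f i = e.hom.f i := by
  obtain ⟨mV, f, hd, hg, -⟩ := mA.exists_transfer_of_components (V := V.X) (fun i j => V.d i j)
    (fun i => e.hom.f i) (fun i => e.inv.f i) (fun i j => e.homotopyInvHomId.hom i j)
    (fun i j k => V.d_comp_d i j k) (fun i j => (e.hom.comm i j).symm)
    (fun i j => (e.inv.comm i j).symm) (fun i => by
      have h1 := e.homotopyInvHomId.comm i
      rw [dNext_eq _ (show (ComplexShape.up ℤ).Rel i (i + 1) from rfl),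
        prevD_eq _ (show (ComplexShape.up ℤ).Rel (i - 1) i from sub_add_cancel i 1), add_comm,
        ← add_assoc] at h1
      exact h1)
  refine ⟨mV, cochainComplex_mk_eq V _ _ _ fun i j => ?_, f, fun i => f.linear_f_eq hg i⟩
  by_cases h : i + 1 = j
  · have h1 := mV.totι_totD i j h
    rw [hd, totι_totMap _ i j h] at h1
    exact (comp_totι_injective h1).symm
  · exact (mV.complex.shape i j h).trans (V.shape i j h).symm

end TransferStructure

/-! ### The tensor product preserves coproducts -/

section Preservation

open CoproductsFromFiniteFiltered

/-- A coproduct is the filtered colimit of its subcoproducts over finite subsets of the index set.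
Maps out of its image are thus compatible families of maps out of images of finite coproducts, and
these are determined by their components. -/
theorem preservesCoproducts_of_finite_of_filtered {C : Type*} [Category* C] {D : Type*}
    [Category* D] [HasFiniteCoproducts C] (J : Type) [HasCoproductsOfShape J C]
    [HasColimitsOfShape (Finset (Discrete J)) C] (F : C ⥤ D) [PreservesFiniteCoproducts F]
    [PreservesColimitsOfShape (Finset (Discrete J)) F] :
    PreservesColimitsOfShape (Discrete J) F := by
  classical
  have key : ∀ f : J → C, Nonempty (IsColimit (F.mapCocone (Cofan.mk (∐ f) (Sigma.ι f)))) := by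
    intro f
    have hc := isColimitOfPreserves F (isColimitFiniteSubproductsCocone f)
    let P : Finset (Discrete J) → C := fun S => ∐ fun x : S => f x.1.as
    let p : ∀ S, P S ⟶ ∐ f := fun S => Sigma.desc fun s => Sigma.ι f s.1.as
    let e : ∀ {S T : Finset (Discrete J)}, (S ⟶ T) → (P S ⟶ P T) := fun {S T} h =>
      Sigma.desc fun s => Sigma.ι (fun x : T => f x.1.as) ⟨s.1, h.down.down s.2⟩
    have hp : ∀ (S : Finset (Discrete J)) (s : S), Sigma.ι (fun x : S => f x.1.as) s ≫ p S = Sigma.ι f s.1.as :=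
      fun S s => Sigma.ι_desc _ _
    have he : ∀ {S T : Finset (Discrete J)} (h : S ⟶ T) (s : S),
        Sigma.ι (fun x : S => f x.1.as) s ≫ e h =
          Sigma.ι (fun x : T => f x.1.as) ⟨s.1, h.down.down s.2⟩ :=
      fun h s => Sigma.ι_desc _ _
    have hdesc : ∀ {Y : D} (t : ∀ S, F.obj (P S) ⟶ Y),
        (∀ {S T : Finset (Discrete J)} (h : S ⟶ T), F.map (e h) ≫ t T = t S) →
        ∃ d : F.obj (∐ f) ⟶ Y, ∀ S, F.map (p S) ≫ d = t S := fun {Y} t ht =>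
      ⟨hc.desc ⟨Y, { app := t, naturality := fun _ _ h => (ht h).trans (Category.comp_id _).symm }⟩,
        fun S => hc.fac _ S⟩
    have hext : ∀ {Y : D} (d d' : F.obj (∐ f) ⟶ Y),
        (∀ S, F.map (p S) ≫ d = F.map (p S) ≫ d') → d = d' := fun d d' h => hc.hom_ext h
    have hex : ∀ {Y : D} (φ : ∀ j, F.obj (f j) ⟶ Y),
        ∃ d : F.obj (∐ f) ⟶ Y, ∀ j, F.map (Sigma.ι f j) ≫ d = φ j := by
      intro Y φ
      obtain ⟨d, hd⟩ := hdesc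
        (fun S => mapSigmaDesc F (fun x : S => f x.1.as) fun s => φ s.1.as) (fun {S T} h =>
          mapSigma_hom_ext F _ fun s => by
            rw [← Category.assoc, ← F.map_comp, he h, map_ι_mapSigmaDesc, map_ι_mapSigmaDesc])
      refine ⟨d, fun j => ?_⟩
      have h1 := hp {⟨j⟩} ⟨⟨j⟩, Finset.mem_singleton_self _⟩
      have h2 := F.map (Sigma.ι (fun x : ({⟨j⟩} : Finset (Discrete J)) => f x.1.as)
        ⟨⟨j⟩, Finset.mem_singleton_self _⟩) ≫= hd {⟨j⟩}
      rw [← Category.assoc, ← F.map_comp, h1, map_ι_mapSigmaDesc] at h2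
      exact h2
    have hun : ∀ {Y : D} (d d' : F.obj (∐ f) ⟶ Y),
        (∀ j, F.map (Sigma.ι f j) ≫ d = F.map (Sigma.ι f j) ≫ d') → d = d' := by
      intro Y d d' h
      refine hext d d' fun S => mapSigma_hom_ext F _ fun s => ?_
      rw [← Category.assoc, ← Category.assoc, ← F.map_comp, hp, h]
    choose d hd using @hex
    exact ⟨(isColimitMapCoconeCofanMkEquiv F f _).symm (Cofan.IsColimit.mk _
      (fun t => d t.inj) (fun t j => hd _ j) (fun t m hm' => hun _ _ fun j =>
        (hm' j).trans (hd _ j).symm))⟩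
  refine ⟨fun {K} => ?_⟩
  have h1 : PreservesColimit (Discrete.functor (K.obj ∘ Discrete.mk)) F :=
    preservesColimit_of_preserves_colimit_cocone (coproductIsCoproduct _) (key _).some
  exact preservesColimit_of_iso_diagram F Discrete.natIsoFunctor.symm

theorem tensorPreservesCoproducts_of_filtered {C : Type u} [Category.{v} C] [HasFiniteColimits C]
    [HasColimits C] [MonoidalCategory C]
    [∀ X : C, PreservesFiniteColimits (tensorLeft X)]
    [∀ X : C, PreservesFilteredColimits (tensorLeft X)]
    [∀ X : C, PreservesFiniteColimits (tensorRight X)]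
    [∀ X : C, PreservesFilteredColimits (tensorRight X)] : TensorPreservesCoproducts C := by
  -- The words and degrees that index the coproducts live in universe 0, while cocompleteness and
  -- preservation are given in size v.
  have : HasColimitsOfSize.{0, 0} C := hasColimitsOfSizeShrink.{0, 0, v, v} C
  refine ⟨fun J X => ?_, fun J X => ?_⟩
  · have := preservesSmallestFilteredColimits_of_preservesFilteredColimits (tensorLeft X)
    exact preservesCoproducts_of_finite_of_filtered J _
  · have := preservesSmallestFilteredColimits_of_preservesFilteredColimits (tensorRight X)
    exact preservesCoproducts_of_finite_of_filtered J _

end Preservation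

/-! ### Consequences of semisimplicity -/

section Splitting

variable {C : Type u} [Category.{v} C] [Abelian C] [SplitMonoCategory C]

/-- A retraction of the kernel inclusion splits the short exact sequence, hence also the
epimorphism. -/
theorem exists_section {X Y : C} (f : X ⟶ Y) [Epi f] : ∃ s : Y ⟶ X, s ≫ f = 𝟙 Y := by
  have : IsSplitMono (kernel.ι f) := SplitMonoCategory.isSplitMono_of_mono _
  have h : (ShortComplex.mk (kernel.ι f) f (kernel.condition f)).Exact :=
    ShortComplex.exact_of_f_is_kernel _ (kernelIsKernel f)
  exact ⟨_, (ShortComplex.Splitting.ofExactOfRetraction _ h (retraction (kernel.ι f))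
    (IsSplitMono.id _) ‹_›).s_g⟩

/-- Exactness makes the differential an epimorphism onto the kernel of the class map, and that
epimorphism has a section. -/
theorem exists_cycles_lift (K : CochainComplex C ℤ) (i j : ℤ) (h : j + 1 = i) {X : C}
    (z : X ⟶ K.cycles i) (hz : z ≫ K.homologyπ i = 0) :
    ∃ t : X ⟶ K.X j, t ≫ K.toCycles j i = z := by
  have h1 : (ShortComplex.mk _ _ (K.toCycles_comp_homologyπ j i)).Exact :=
    ShortComplex.exact_of_g_is_cokernel _ (K.homologyIsCokernel j i (by simp; omega))
  have h2 := h1.epi_kernelLift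
  obtain ⟨s, hs⟩ := exists_section (kernel.lift _ _ (K.toCycles_comp_homologyπ j i))
  refine ⟨kernel.lift _ z hz ≫ s, ?_⟩
  have h3 := kernel.lift_ι (K.homologyπ i) (K.toCycles j i) (K.toCycles_comp_homologyπ j i)
  rw [← h3, Category.assoc, reassoc_of% hs, kernel.lift_ι]

end Splitting

/-! ### Splitting the complex (A, m₁) onto its homology -/

section HomologyData

variable {C : Type u} [Category.{v} C] [Abelian C] [MonoidalCategory C] [HasCoproducts.{0} C]
  {A : GradedObject ℤ C}

namespace AInfStructure

variable (mA : AInfStructure A)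

/-- The object of cycles. -/
noncomputable def cycles (i : ℤ) : C := mA.complex.cycles i

/-- The inclusion of the cycles. -/
noncomputable def zι (i : ℤ) : mA.cycles i ⟶ A i := mA.cyclesι i

/-- The projection of the cycles to the homology. -/
noncomputable def zπ (i : ℤ) : mA.cycles i ⟶ mA.homology i := mA.cyclesπ i

/-- The differential as a morphism to the cycles. -/
noncomputable def toZ (j i : ℤ) : A j ⟶ mA.cycles i := mA.complex.toCycles j i

theorem toZ_zι (j i : ℤ) : mA.toZ j i ≫ mA.zι i = mA.d j i := mA.complex.toCycles_i j i

theorem toZ_zπ (j i : ℤ) : mA.toZ j i ≫ mA.zπ i = 0 := mA.complex.toCycles_comp_homologyπ j i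

theorem zι_d (i j : ℤ) : mA.zι i ≫ mA.d i j = 0 := mA.complex.iCycles_d i j

theorem exists_lift_zι {X : C} {i j : ℤ} (h : i + 1 = j) (x : X ⟶ A i)
    (hx : x ≫ mA.d i j = 0) : ∃ y, y ≫ mA.zι i = x :=
  ⟨mA.complex.liftCycles x j (by simp; omega) hx, mA.complex.liftCycles_i _ _ _ _⟩

/-- Retractions and sections that split the complex `(A, m₁)`. -/
structure Splitting where
  r : ∀ i, A i ⟶ mA.cycles i
  s : ∀ i, mA.homology i ⟶ mA.cycles i
  t : ∀ i j, mA.cycles i ⟶ A j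
  zι_r : ∀ i, mA.zι i ≫ r i = 𝟙 _
  s_zπ : ∀ i, s i ≫ mA.zπ i = 𝟙 _
  t_toZ : ∀ i j, j + 1 = i → t i j ≫ mA.toZ j i = 𝟙 _ - mA.zπ i ≫ s i

theorem exists_splitting [SplitMonoCategory C] : Nonempty mA.Splitting := by
  have h1 : ∀ i, ∃ r, mA.zι i ≫ r = 𝟙 _ := fun i => by
    have : Mono (mA.zι i) := inferInstanceAs (Mono (mA.complex.iCycles i))
    have : IsSplitMono (mA.zι i) := SplitMonoCategory.isSplitMono_of_mono _
    exact ⟨_, IsSplitMono.id _⟩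
  have h2 : ∀ i, ∃ s, s ≫ mA.zπ i = 𝟙 _ := fun i => by
    have : Epi (mA.zπ i) := inferInstanceAs (Epi (mA.complex.homologyπ i))
    exact exists_section _
  choose r hr using h1
  choose s hs using h2
  have h3 : ∀ i j, ∃ t : mA.cycles i ⟶ A j, j + 1 = i → t ≫ mA.toZ j i = 𝟙 _ - mA.zπ i ≫ s i := by
    intro i j
    by_cases h : j + 1 = i
    · have h0 : (𝟙 _ - mA.zπ i ≫ s i) ≫ mA.zπ i = 0 := by
        rw [Preadditive.sub_comp, Category.assoc, hs, Category.id_comp, Category.comp_id, sub_self]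
      obtain ⟨t, ht⟩ := exists_cycles_lift mA.complex i j h (𝟙 _ - mA.zπ i ≫ s i) h0
      exact ⟨t, fun _ => ht⟩
    · exact ⟨0, fun h' => absurd h' h⟩
  choose t ht using h3
  exact ⟨⟨r, s, t, hr, hs, ht⟩⟩

namespace Splitting

variable {mA} (S : mA.Splitting)

/-- The inclusion of the homology. -/
noncomputable def g (i : ℤ) : mA.homology i ⟶ A i := S.s i ≫ mA.zι i

/-- The projection to the homology. -/
noncomputable def p (i : ℤ) : A i ⟶ mA.homology i := S.r i ≫ mA.zπ i

/-- The contracting homotopy. -/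
noncomputable def h (i j : ℤ) : A i ⟶ A j := -(S.r i ≫ S.t i j ≫ (𝟙 _ - S.r j ≫ mA.zι j))

theorem g_p (i : ℤ) : S.g i ≫ S.p i = 𝟙 _ := by
  rw [g, p, Category.assoc, ← Category.assoc (mA.zι i), S.zι_r, Category.id_comp, S.s_zπ]

theorem g_d (i j : ℤ) : S.g i ≫ mA.d i j = 0 := by
  rw [g, Category.assoc, mA.zι_d, comp_zero]

theorem d_r (i j : ℤ) : mA.d i j ≫ S.r j = mA.toZ i j := by
  rw [← mA.toZ_zι, Category.assoc, S.zι_r, Category.comp_id]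

theorem d_p (i j : ℤ) : mA.d i j ≫ S.p j = 0 := by
  rw [p, ← Category.assoc, S.d_r, mA.toZ_zπ]

/-- With `r` the retraction to the cycles, 1 - rι is a projection onto a complement of the cycles,
and rι splits further into representatives of homology and boundaries. The term dh is minus the
former projection, and hd is minus the boundary part. -/
theorem p_g (i : ℤ) : S.p i ≫ S.g i = 𝟙 (A i) + mA.d i (i + 1) ≫ S.h (i + 1) i +
    S.h i (i - 1) ≫ mA.d (i - 1) i := by
  obtain ⟨N, hN⟩ : ∃ N, N = mA.toZ i (i + 1) ≫ S.t (i + 1) i ≫ (𝟙 _ - S.r i ≫ mA.zι i) := ⟨_, rfl⟩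
  have hNr : N ≫ S.r i = 0 := by
    rw [hN, Category.assoc, Category.assoc, Preadditive.sub_comp, Category.assoc, S.zι_r,
      Category.comp_id, Category.id_comp, sub_self, comp_zero, comp_zero]
  have hNd : N ≫ mA.d i (i + 1) = mA.d i (i + 1) := by
    rw [hN, Category.assoc, Category.assoc, Preadditive.sub_comp, Category.assoc, mA.zι_d,
      comp_zero, sub_zero, Category.id_comp, ← mA.toZ_zι, ← Category.assoc (S.t _ _),
      S.t_toZ (i + 1) i rfl, Preadditive.sub_comp, Preadditive.comp_sub, Category.id_comp,
      Category.assoc, ← Category.assoc (mA.toZ _ _) (mA.zπ _), mA.toZ_zπ, zero_comp, sub_zero]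
  -- Since N d = d, the map N - 1 lands in the cycles, and N r = 0 determines which map to the
  -- cycles it is.
  have hN1 : N = 𝟙 _ - S.r i ≫ mA.zι i := by
    obtain ⟨y, hy⟩ := mA.exists_lift_zι rfl (N - 𝟙 _)
      (by rw [Preadditive.sub_comp, hNd, Category.id_comp, sub_self])
    have h1 := hy =≫ S.r i
    rw [Category.assoc, S.zι_r, Category.comp_id, Preadditive.sub_comp, hNr, Category.id_comp,
      zero_sub] at h1
    rw [h1, Preadditive.neg_comp] at hy
    rw [eq_sub_iff_add_eq, ← sub_eq_zero, add_sub_right_comm, ← hy, neg_add_cancel]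
  have e1 : mA.d i (i + 1) ≫ S.h (i + 1) i = - N := by
    rw [h, Preadditive.comp_neg, ← Category.assoc, S.d_r, hN]
  have e2 : S.h i (i - 1) ≫ mA.d (i - 1) i = - (S.r i ≫ mA.zι i) + S.p i ≫ S.g i := by
    rw [h, Preadditive.neg_comp, Category.assoc, Category.assoc, Preadditive.sub_comp,
      Category.assoc, mA.zι_d, comp_zero, sub_zero, Category.id_comp, ← mA.toZ_zι,
      ← Category.assoc (S.t _ _), S.t_toZ i (i - 1) (sub_add_cancel i 1), Preadditive.sub_comp,
      Preadditive.comp_sub, Category.id_comp, p, g]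
    simp only [Category.assoc]
    abel
  rw [e1, e2, hN1]
  abel

end Splitting

end AInfStructure

end HomologyData

/-! ### Restriction to words with two letters -/

section TwoLetters

variable {C : Type u} [Category.{v} C] [MonoidalCategory C] [HasCoproducts.{0} C]
  [TensorPreservesCoproducts C] [Preadditive C] [MonoidalPreadditive C]
  {A B : GradedObject ℤ C} {Y Z : C} {a : ℤ}

/-- The inclusion of the words with two letters. -/
noncomputable def pairι (A : GradedObject ℤ C) (p q : ℤ) : A p ⊗ A q ⟶ bar A :=
  A p ◁ (wordOne A q).hom ≫ (wordCons A p [q]).hom ≫ barι A [p, q]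

theorem tensor_letterMap_barMul (A : GradedObject ℤ C) (p q : ℤ) :
    ((totι A p ≫ letterMap A) ⊗ₘ (totι A q ≫ letterMap A)) ≫ barMul A = pairι A p q := by
  have h := tensor_barι_letterCons (𝟙 (A p)) [q]
  rw [id_whiskerRight, Category.id_comp, Category.id_comp, letterCons] at h
  rw [pairι, ← h, totι_letterMap A q]
  simp [MonoidalCategory.tensorHom_def, whisker_exchange_assoc, -totι_letterMap]

theorem pairι_split (A : GradedObject ℤ C) (p q : ℤ) :
    (A p ◁ (wordOne A q).hom ≫ (wordCons A p [q]).hom) ≫ (wordSplit A [p] [q]).hom =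
      (wordOne A p).hom ⊗ₘ (wordOne A q).hom := by
  have h : (wordSplit A [p] [q]).hom = (wordCons A p [q]).inv ≫ A p ◁ (wordSplit A [] [q]).hom ≫
      (α_ _ _ _).inv ≫ (wordCons A p []).hom ▷ _ := wordSplit_cons_hom A p [] [q]
  rw [h, wordSplit_nil_hom, wordOne_eq A p]
  simp [MonoidalCategory.tensorHom_def']

theorem pairι_comulPair {M : bar A ⟶ Y} {N : bar A ⟶ Z} (hM : M ∈ barFil A _ 1)
    (hN : N ∈ barFil A _ 1) (p q : ℤ) : pairι A p q ≫ comulPair M N =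
      (totι A p ≫ letterMap A ≫ M) ⊗ₘ (totι A q ≫ letterMap A ≫ N) := by
  have e : barι A [p, q] ≫ comulPair M N =
      (wordSplit A [p] [q]).hom ≫ ((barι A [p] ≫ M) ⊗ₘ (barι A [q] ≫ N)) := by
    have h1 : barι A (List.take 0 [p, q]) ≫ M = 0 := hM _ (by simp)
    have h2 : barι A (List.drop 2 [p, q]) ≫ N = 0 := hN _ (by simp)
    rw [barι_comulPair, Finset.sum_eq_single 1]
    · exact (congrArg (· ≫ _) (Category.id_comp _))
    · intro i hi h
      have hi' := Finset.mem_range.1 hi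
      rw [List.length_cons, List.length_singleton] at hi'
      obtain rfl | rfl : i = 0 ∨ i = 2 := by omega
      · rw [h1, MonoidalPreadditive.zero_tensor, comp_zero]
      · rw [h2, MonoidalPreadditive.tensor_zero, comp_zero]
    · intro h
      exact absurd (Finset.mem_range.2 (by simp)) h
  rw [pairι, ← Category.assoc, Category.assoc, e, ← Category.assoc, pairι_split,
    tensorHom_comp_tensorHom, ← Category.assoc (totι A p), ← Category.assoc (totι A q),
    totι_letterMap, totι_letterMap, Category.assoc, Category.assoc]

theorem pairι_comp_eq_zero {f : bar A ⟶ Y} (hf : f ∈ barFil A _ 3) (p q : ℤ) :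
    pairι A p q ≫ f = 0 := by
  rw [pairι, Category.assoc, Category.assoc, hf _ (by simp), comp_zero, comp_zero]

theorem tensor_comp_pairι {X X' : C} {p q : ℤ} (f : X ⟶ A p) (g : X' ⟶ A q) :
    ((f ≫ totι A p ≫ letterMap A) ⊗ₘ (g ≫ totι A q ≫ letterMap A)) ≫ barMul A =
      (f ⊗ₘ g) ≫ pairι A p q := by
  rw [← tensorHom_comp_tensorHom, Category.assoc, tensor_letterMap_barMul]

theorem pairι_hat (φ : ∀ n : ℕ, GrHom (tpow A n) B (a - (n : ℤ))) (p q t : ℤ)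
    (h : p + q + (a - (2 : ℕ)) = t) : pairι A p q ≫ hat φ =
      (p - 1).negOnePow • ((φ 2).binary p q t h ≫ totι B t) := by
  have key : (φ 2).binary p q t h ≫ totι B t =
      A p ◁ (wordOne A q).hom ≫ (wordCons A p [q]).hom ≫ (φ 2).totWord [p, q] rfl :=
    (Category.assoc _ _ _).trans (congrArg (A p ◁ (wordOne A q).hom ≫ ·)
      (((φ 2).atWord_totι [p, q] rfl t _).trans (Category.id_comp _).symm))
  have hs : shiftExp [p, q] = p - 1 := by simp [shiftExp]
  rw [key, pairι, Category.assoc, Category.assoc, barι_hat, hs, Linear.comp_units_smul,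
    Linear.comp_units_smul]
  rfl

/-- Expand the series as 1 + f + f(F - 1). On two letters the last factor sees only one letter,
where F - 1 is the linear part of f. -/
theorem pairι_barHom {f : bar A ⟶ tot B} (hf : f ∈ barFil A _ 1) (p q : ℤ) (F : ∀ i, A i ⟶ B i)
    (hF : letterMap A ≫ f = totMapZero F) : pairι A p q ≫ barHom f =
      (pairι A p q ≫ f) ≫ letterMap B + (F p ⊗ₘ F q) ≫ pairι B p q := by
  have h1 : barHom f - 1 ∈ barFil A _ 1 := by
    rw [barHom_eq hf, add_sub_cancel_left]
    exact conv_mem_barFil (comp_mem_barFil hf _) (mem_barFil_zero _) le_rfl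
  have h2 : barHom f - 1 - f ≫ letterMap B ∈ barFil A _ 2 := by
    have : barHom f - 1 - f ≫ letterMap B = (f ≫ letterMap B) * (barHom f - 1) := by
      nth_rewrite 1 [barHom_eq hf]
      noncomm_ring
    rw [this]
    exact conv_mem_barFil (comp_mem_barFil hf _) h1 le_rfl
  have h3 : letterMap A ≫ (barHom f - 1) = totMapZero F ≫ letterMap B := by
    have := letterMap_comp_eq_zero h2
    rw [Preadditive.comp_sub, sub_eq_zero] at this
    rw [this, ← Category.assoc, hF]
  have h4 : barHom f = 1 + f ≫ letterMap B + (f ≫ letterMap B) * (barHom f - 1) := by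
    nth_rewrite 1 [barHom_eq hf]
    noncomm_ring
  have h5 : pairι A p q ≫ (1 : bar A ⟶ bar B) = 0 := by
    rw [convOne_eq, pairι, Category.assoc, Category.assoc, ← Category.assoc (barι A _),
      barι_cons_barCounit, zero_comp, comp_zero, comp_zero]
  rw [h4, Preadditive.comp_add, Preadditive.comp_add, h5, zero_add, conv_eq, ← Category.assoc,
    ← Category.assoc, pairι_comulPair (comp_mem_barFil hf _) h1, h3, ← Category.assoc (letterMap A),
    hF, ← Category.assoc, ← Category.assoc, totι_totMapZero, totι_totMapZero, Category.assoc,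
    Category.assoc, Category.assoc, tensor_comp_pairι]

/-- Write both outer factors of S·b·id as 1 plus a term of filtration 1. The product of all three
positive terms has filtration 3 and dies on two letters. -/
theorem pairι_barDer {b : bar A ⟶ tot A} (hb : b ∈ barFil A _ 1) (p q p' q' : ℤ) (d : A p ⟶ A p')
    (d' : A q ⟶ A q') (hd : totι A p ≫ letterMap A ≫ b = d ≫ totι A p')
    (hd' : totι A q ≫ letterMap A ≫ b = d' ≫ totι A q') : pairι A p q ≫ barDer b =
      (pairι A p q ≫ b) ≫ letterMap A + (d ▷ A q) ≫ pairι A p' q +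
        (p - 1).negOnePow • ((A p ◁ d') ≫ pairι A p q') := by
  have hs : barSign A - 1 ∈ barFil A _ 1 := mem_barFil_one.2 (by
    rw [Preadditive.comp_sub, nilMap_comp_one, nilMap, Category.assoc, barι_sign, wordDeg_nil,
      Int.negOnePow_zero, one_smul, sub_self])
  have hi : 𝟙 (bar A) - 1 ∈ barFil A _ 1 := mem_barFil_one.2 (by
    rw [Preadditive.comp_sub, nilMap_comp_one, Category.comp_id, sub_self])
  have hb' := comp_mem_barFil hb (letterMap A)
  have h0 : ∀ r : ℤ, totι A r ≫ letterMap A ≫ (1 : bar A ⟶ bar A) = 0 := fun r => by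
    rw [convOne_eq, ← Category.assoc, totι_letterMap, Category.assoc, ← Category.assoc (barι A _),
      barι_cons_barCounit, zero_comp, comp_zero]
  have hs1 : totι A p ≫ letterMap A ≫ (barSign A - 1) =
      (p - 1).negOnePow • (totι A p ≫ letterMap A) := by
    rw [Preadditive.comp_sub, Preadditive.comp_sub, h0, sub_zero, ← Category.assoc, totι_letterMap,
      Category.assoc, barι_sign, Linear.comp_units_smul]
    simp [wordDeg]
  have hi1 : totι A q ≫ letterMap A ≫ (𝟙 (bar A) - 1) = totι A q ≫ letterMap A := by
    rw [Preadditive.comp_sub, Preadditive.comp_sub, h0, sub_zero, Category.comp_id]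
  have h : barDer b = b ≫ letterMap A + (b ≫ letterMap A) * (𝟙 (bar A) - 1) +
      (barSign A - 1) * (b ≫ letterMap A) +
        (barSign A - 1) * (b ≫ letterMap A) * (𝟙 (bar A) - 1) := by
    rw [barDer]
    noncomm_ring
  rw [h, Preadditive.comp_add, pairι_comp_eq_zero (conv_mem_barFil (conv_mem_barFil hs hb' le_rfl)
    hi le_rfl), add_zero, Preadditive.comp_add, Preadditive.comp_add, conv_eq, conv_eq,
    ← Category.assoc (pairι A p q) (comulPair _ _), pairι_comulPair hb' hi,
    ← Category.assoc (pairι A p q) (comulPair _ _), pairι_comulPair hs hb', hs1, hi1,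
    ← Category.assoc (letterMap A) b, ← Category.assoc (totι A p), ← Category.assoc (totι A q), hd,
    hd', units_smul_tensor, Linear.units_smul_comp, Category.assoc, Category.assoc]
  congr 2
  · rw [Category.assoc]
  · have := tensor_comp_pairι d (𝟙 (A q))
    rwa [Category.id_comp, tensorHom_id] at this
  · have := tensor_comp_pairι (𝟙 (A p)) d'
    rw [Category.id_comp, id_tensorHom] at this
    rw [this]

end TwoLetters

/-! ### The product: Leibniz rule and compatibility with morphisms -/

section Product

variable {C : Type u} [Category.{v} C] [MonoidalCategory C] [HasCoproducts.{0} C]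
  [TensorPreservesCoproducts C] [Preadditive C] [MonoidalPreadditive C]
  {A V : GradedObject ℤ C}

/-- The components of the product of an `A_∞`-structure. -/
noncomputable def AInfStructure.mul (mA : AInfStructure A) (p q t : ℤ) (h : p + q = t) :
    A p ⊗ A q ⟶ A t :=
  (mA.m 2).binary p q t (by simpa using h)

theorem AInfStructure.pairι_barOp (mA : AInfStructure A) (p q t : ℤ) (h : p + q = t) :
    pairι A p q ≫ mA.barOp = (p - 1).negOnePow • (mA.mul p q t h ≫ totι A t) :=
  pairι_hat mA.m p q t (by simpa using h)

theorem negOnePow_smul_self {X Y : C} (n : ℤ) (f : X ⟶ Y) :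
    n.negOnePow • n.negOnePow • f = f := by
  rw [smul_smul, ← Int.negOnePow_add, Int.negOnePow_even _ ⟨_, rfl⟩, one_smul]

/-- The Leibniz rule. -/
theorem AInfStructure.mul_d (mA : AInfStructure A) {p q t p' q' t' : ℤ} (h : p + q = t)
    (hp : p + 1 = p') (hq : q + 1 = q') (ht : t + 1 = t') :
    mA.mul p q t h ≫ mA.d t t' = mA.d p p' ▷ A q ≫ mA.mul p' q t' (by omega) +
      p.negOnePow • (A p ◁ mA.d q q' ≫ mA.mul p q' t' (by omega)) := by
  have h0 := pairι A p q ≫= mA.barDer_barOp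
  have hs : (p' - 1).negOnePow = -(p - 1).negOnePow := by
    rw [← hp, add_sub_right_comm, Int.negOnePow_succ]
  have hs' : p.negOnePow = -(p - 1).negOnePow := by
    rw [← Int.negOnePow_succ, sub_add_cancel]
  rw [← Category.assoc, pairι_barDer mA.barOp_mem p q p' q' _ _ (mA.totι_totD p p' hp)
    (mA.totι_totD q q' hq), Preadditive.add_comp, Preadditive.add_comp, Category.assoc,
    mA.pairι_barOp p q t h, Category.assoc, mA.pairι_barOp p' q t' (by omega),
    Linear.units_smul_comp, Linear.units_smul_comp, Category.assoc, Category.assoc,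
    mA.pairι_barOp p q' t' (by omega), ← AInfStructure.totD, mA.totι_totD t t' ht, hs,
    Linear.comp_units_smul, Linear.comp_units_smul, negOnePow_smul_self, comp_zero] at h0
  refine comp_totι_injective ?_
  have h1 := congrArg ((p - 1).negOnePow • ·) h0
  simp only [smul_add, smul_zero, negOnePow_smul_self, Units.neg_smul, smul_neg] at h1
  rw [hs', Units.neg_smul, Preadditive.add_comp, Preadditive.neg_comp, Linear.units_smul_comp]
  simp only [Category.assoc]
  rw [← sub_eq_zero, ← h1]
  abel

/-- The components of the linear part of an `A_∞`-morphism. -/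
noncomputable def AInfHom.lin {mV : AInfStructure V} {mA : AInfStructure A} (f : AInfHom mV mA)
    (i : ℤ) : V i ⟶ A i :=
  f.linear.f i

theorem AInfHom.letterMap_barOp {mV : AInfStructure V} {mA : AInfStructure A} (f : AInfHom mV mA) :
    letterMap V ≫ f.barOp = totMapZero f.lin :=
  tot_ext fun i => (f.totι_letterMap_barOp i).trans (totι_totMapZero f.lin i).symm

/-- The compatibility of an `A_∞`-morphism from a minimal structure with the products. -/
theorem AInfHom.mul_comp_linear {mV : AInfStructure V} {mA : AInfStructure A} (f : AInfHom mV mA)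
    (hV : mV.barOp ∈ barFil V _ 2) (p q t s : ℤ) (h : p + q = t) (hs : s + 1 = t) :
    ∃ u : V p ⊗ V q ⟶ A s, mV.mul p q t h ≫ f.lin t =
      (f.lin p ⊗ₘ f.lin q) ≫ mA.mul p q t h + u ≫ mA.d s t := by
  have h0 := pairι V p q ≫= f.barDer_barOp
  have hz : ∀ i, totι V i ≫ letterMap V ≫ mV.barOp = (0 : V i ⟶ V i) ≫ totι V i := fun i => by
    rw [letterMap_comp_eq_zero hV, comp_zero, zero_comp]
  have hf2 := pairι_hat f.f p q s (by push_cast; omega)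
  rw [← Category.assoc, pairι_barDer mV.barOp_mem p q p q _ _ (hz p) (hz q), ← Category.assoc,
    pairι_barHom f.barOp_mem p q  _ f.letterMap_barOp, MonoidalPreadditive.zero_whiskerRight,
    MonoidalPreadditive.whiskerLeft_zero, zero_comp, smul_zero, add_zero, add_zero,
    Preadditive.add_comp, Category.assoc (_ ≫ _) (letterMap V), Category.assoc (_ ≫ _) (letterMap A),
    Category.assoc (_ ⊗ₘ _), mV.pairι_barOp p q t h, mA.pairι_barOp p q t h,
    Linear.units_smul_comp, Category.assoc, f.letterMap_barOp, totι_totMapZero, ←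
    AInfStructure.totD, AInfHom.barOp, hf2, Linear.units_smul_comp, Category.assoc,
    mA.totι_totD s t hs, Linear.comp_units_smul, ← smul_add] at h0
  -- The homotopy is f₂. Minimality of the source removes the terms in which its differential meets
  -- f₂.
  refine ⟨(f.f 2).binary p q s (by push_cast; omega), comp_totι_injective ?_⟩
  have h1 := congrArg ((p - 1).negOnePow • ·) h0
  simp only [negOnePow_smul_self] at h1
  rw [Category.assoc, h1, add_comm, Preadditive.add_comp, Category.assoc, Category.assoc]

end Product

/-! ### Quasi-isomorphisms out of minimal structures -/

section Minimal

variable {C : Type u} [Category.{v} C] [Abelian C] [MonoidalCategory C] [HasCoproducts.{0} C]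
  [TensorPreservesCoproducts C] [MonoidalPreadditive C] {A V : GradedObject ℤ C}

theorem AInfStructure.IsMinimal.d_eq_zero {mV : AInfStructure V} (h : mV.IsMinimal) (i j : ℤ) :
    mV.d i j = 0 := by
  by_cases hij : i + 1 = j
  · refine comp_totι_injective ?_
    rw [← mV.totι_totD i j hij, AInfStructure.totD,
      letterMap_comp_eq_zero (mV.isMinimal_iff.1 h), comp_zero, zero_comp]
  · exact mV.complex.shape i j hij

/-- For zero differential, cycles and homology are V itself, and f₁ followed by the class map is the
map induced on homology. -/
theorem AInfHom.isQuasiIso_iff {mV : AInfStructure V} {mA : AInfStructure A} (f : AInfHom mV mA)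
    (hV : mV.IsMinimal) (S : mA.Splitting) :
    f.IsQuasiIso ↔ ∀ i, IsIso (f.lin i ≫ S.p i) := by
  rw [IsQuasiIso, quasiIso_iff]
  refine forall_congr' fun i => ?_
  rw [quasiIsoAt_iff_isIso_homologyMap]
  have : IsIso (mV.complex.iCycles i) := mV.complex.isIso_iCycles i _ rfl (hV.d_eq_zero _ _)
  have : IsIso (mV.complex.homologyπ i) := mV.complex.isIso_homologyπ _ i rfl (hV.d_eq_zero _ _)
  have h1 : HomologicalComplex.cyclesMap f.linear i = mV.complex.iCycles i ≫ f.lin i ≫ S.r i := by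
    have h2 := HomologicalComplex.cyclesMap_i f.linear i =≫ S.r i
    exact (((congrArg (_ ≫ ·) (S.zι_r i)).trans (Category.comp_id _)).symm.trans
      ((Category.assoc _ _ _).symm.trans (h2.trans (Category.assoc _ _ _))))
  have h3 : mV.complex.homologyπ i ≫ HomologicalComplex.homologyMap f.linear i =
      mV.complex.iCycles i ≫ f.lin i ≫ S.p i := by
    rw [HomologicalComplex.homologyπ_naturality, h1]
    exact (Category.assoc _ _ _).trans (congrArg (_ ≫ ·) (Category.assoc _ _ _))
  rw [← isIso_comp_left_iff (mV.complex.homologyπ i), h3]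
  exact isIso_comp_left_iff (mV.complex.iCycles i) _

end Minimal

/-! ### Existence and uniqueness of the minimal model -/

section MinimalModel

variable {C : Type u} [Category.{v} C] [Abelian C] [MonoidalCategory C] [HasCoproducts.{0} C]
  [TensorPreservesCoproducts C] [MonoidalPreadditive C] {A V V' : GradedObject ℤ C}

namespace AInfStructure

variable {mA : AInfStructure A}

theorem zι_mul_d (p q t t' : ℤ) (h : p + q = t) (ht : t + 1 = t') :
    ((mA.zι p ⊗ₘ mA.zι q) ≫ mA.mul p q t h) ≫ mA.d t t' = 0 := by
  rw [Category.assoc, mA.mul_d h rfl rfl ht, Preadditive.comp_add, Linear.comp_units_smul,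
    ← Category.assoc, ← tensorHom_id, tensorHom_comp_tensorHom, mA.zι_d, ← Category.assoc,
    ← id_tensorHom, tensorHom_comp_tensorHom, mA.zι_d, MonoidalPreadditive.zero_tensor,
    MonoidalPreadditive.tensor_zero, zero_comp, zero_comp, smul_zero, add_zero]

theorem tensor_boundary_mul {X X' Y : C} {p q q' t : ℤ} (h : p + q = t) (hq : q' + 1 = q)
    {e : X ⟶ A p} (he : e ≫ mA.d p (p + 1) = 0) (x : X' ⟶ A q') {π : A t ⟶ Y}
    (hπ : mA.d (t - 1) t ≫ π = 0) :
    (e ⊗ₘ (x ≫ mA.d q' q)) ≫ mA.mul p q t h ≫ π = 0 := by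
  have h1 := (e ⊗ₘ x) ≫= (mA.mul_d (t := t - 1) (by omega) rfl hq (sub_add_cancel t 1)) =≫ π
  rw [Category.assoc, hπ, comp_zero, Preadditive.add_comp, Preadditive.comp_add, ← tensorHom_id,
    Category.assoc, tensorHom_comp_tensorHom_assoc, he, MonoidalPreadditive.zero_tensor, zero_comp,
    zero_add, Linear.units_smul_comp, Linear.comp_units_smul, ← id_tensorHom, Category.assoc,
    tensorHom_comp_tensorHom_assoc, Category.comp_id] at h1
  rw [← negOnePow_smul_self p ((e ⊗ₘ (x ≫ mA.d q' q)) ≫ mA.mul p q t h ≫ π), ← h1, comp_zero,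
    smul_zero]

theorem boundary_tensor_mul {X X' Y : C} {p q p' t : ℤ} (h : p + q = t) (hp : p' + 1 = p)
    {e : X' ⟶ A q} (he : e ≫ mA.d q (q + 1) = 0) (x : X ⟶ A p') {π : A t ⟶ Y}
    (hπ : mA.d (t - 1) t ≫ π = 0) :
    ((x ≫ mA.d p' p) ⊗ₘ e) ≫ mA.mul p q t h ≫ π = 0 := by
  have h1 := (x ⊗ₘ e) ≫= (mA.mul_d (t := t - 1) (by omega) hp rfl (sub_add_cancel t 1)) =≫ π
  rw [Category.assoc, hπ, comp_zero, comp_zero, Preadditive.add_comp, Preadditive.comp_add,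
    ← tensorHom_id, Category.assoc, tensorHom_comp_tensorHom_assoc, Linear.units_smul_comp,
    Linear.comp_units_smul, ← id_tensorHom, Category.assoc, tensorHom_comp_tensorHom_assoc, he,
    MonoidalPreadditive.tensor_zero, zero_comp, smul_zero, add_zero, Category.comp_id] at h1
  exact h1.symm

theorem Splitting.zι_eq (S : mA.Splitting) (i : ℤ) :
    mA.zι i = mA.zπ i ≫ S.g i + S.t i (i - 1) ≫ mA.d (i - 1) i := by
  rw [← mA.toZ_zι, ← Category.assoc, S.t_toZ i (i - 1) (sub_add_cancel i 1),
    Preadditive.sub_comp, Category.id_comp, Category.assoc, Splitting.g, add_sub_cancel]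

theorem Splitting.zι_p (S : mA.Splitting) (i : ℤ) : mA.zι i ≫ S.p i = mA.zπ i := by
  rw [Splitting.p, ← Category.assoc, S.zι_r, Category.id_comp]

/-- A cycle differs from the chosen representative of its class by a boundary. By the Leibniz rule a
boundary times a cycle has zero class, so the factors may be replaced one after the other. -/
theorem Splitting.zι_tensor_mul_p (S : mA.Splitting) (p q t : ℤ) (h : p + q = t) :
    (mA.zι p ⊗ₘ mA.zι q) ≫ mA.mul p q t h ≫ S.p t =
      ((mA.zπ p ≫ S.g p) ⊗ₘ (mA.zπ q ≫ S.g q)) ≫ mA.mul p q t h ≫ S.p t := by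
  have hz : (mA.zπ p ≫ S.g p) ≫ mA.d p (p + 1) = 0 := by
    rw [Category.assoc, S.g_d, comp_zero]
  nth_rewrite 1 [S.zι_eq p]
  rw [MonoidalPreadditive.add_tensor, Preadditive.add_comp,
    boundary_tensor_mul h (sub_add_cancel p 1) (mA.zι_d q _) _ (S.d_p _ _), add_zero, S.zι_eq q,
    MonoidalPreadditive.tensor_add, Preadditive.add_comp,
    tensor_boundary_mul h (sub_add_cancel q 1) hz _ (S.d_p _ _), add_zero]

/-- By `AInfHom.mul_comp_linear`, f₁ respects the products up to a boundary. Projecting to homology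
removes the boundary, and f₁ followed by the projection is the identity. -/
theorem inducesProduct_of_lin_eq {mH : AInfStructure mA.homology} (hH : mH.IsMinimal)
    (f : AInfHom mH mA) (S : mA.Splitting) (hf : ∀ i, f.lin i = S.g i) :
    mA.InducesProduct mH := by
  intro p q
  obtain ⟨z, hz⟩ := mA.exists_lift_zι rfl _ (mA.zι_mul_d p q (p + q) _ rfl rfl)
  refine ⟨z, hz, ?_⟩
  obtain ⟨u, hu⟩ := f.mul_comp_linear (mH.isMinimal_iff.1 hH) p q (p + q) (p + q - 1) rfl
    (sub_add_cancel _ 1)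
  have h1 := hu =≫ S.p (p + q)
  rw [Preadditive.add_comp, Category.assoc, Category.assoc, Category.assoc, S.d_p, comp_zero, add_zero,
    hf, hf, hf, S.g_p, Category.comp_id] at h1
  have h2 := hz =≫ S.p (p + q)
  rw [Category.assoc, S.zι_p, Category.assoc, S.zι_tensor_mul_p, ← tensorHom_comp_tensorHom,
    Category.assoc, ← h1] at h2
  exact h2.symm

theorem exists_minimalModel (S : mA.Splitting) : ∃ mH : AInfStructure mA.homology,
    mH.IsMinimal ∧ mA.InducesProduct mH ∧ ∃ f : AInfHom mH mA, f.LiftsIdentity ∧ f.IsQuasiIso := by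
  obtain ⟨mH, f, hd, hg, -⟩ := mA.exists_transfer_of_components (V := mA.homology) (fun _ _ => 0)
    S.g S.p S.h (fun _ _ _ => zero_comp) (fun i j => by rw [zero_comp, S.g_d])
    (fun i j => by rw [S.d_p, comp_zero]) S.p_g
  have hH : mH.IsMinimal := mH.isMinimal_iff.2 (mem_barFil_two mH.barOp_mem (hd.trans
    (tot_ext fun i => by rw [totι_totMap _ i _ rfl, zero_comp, comp_zero])))
  have hf : ∀ i, f.lin i = S.g i := fun i => f.linear_f_eq hg i
  refine ⟨mH, hH, inducesProduct_of_lin_eq hH f S hf, f, fun i => ⟨S.s i, (hf i).symm, S.s_zπ i⟩,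
    (f.isQuasiIso_iff hH S).2 fun i => ?_⟩
  rw [hf, S.g_p]
  infer_instance

end AInfStructure

theorem AInfHom.lin_d {mV : AInfStructure V} {mA : AInfStructure A} (f : AInfHom mV mA)
    (hV : mV.IsMinimal) (i j : ℤ) : f.lin i ≫ mA.d i j = 0 :=
  (f.linear.comm i j).trans ((congrArg (· ≫ _) (hV.d_eq_zero i j)).trans zero_comp)

theorem totMapZero_comp (φ : ∀ i, A i ⟶ V i) (ψ : ∀ i, V i ⟶ V' i) :
    totMapZero φ ≫ totMapZero ψ = totMapZero fun i => φ i ≫ ψ i :=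
  tot_ext fun i => by
    rw [← Category.assoc, totι_totMapZero, Category.assoc, totι_totMapZero, totι_totMapZero,
      Category.assoc]

theorem totMapZero_id : totMapZero (fun i => 𝟙 (A i)) = 𝟙 (tot A) :=
  tot_ext fun i => by rw [totι_totMapZero, Category.id_comp, Category.comp_id]

theorem totMapZero_comp_eq_id {φ : ∀ i, A i ⟶ V i} {ψ : ∀ i, V i ⟶ A i}
    (h : ∀ i, φ i ≫ ψ i = 𝟙 _) : totMapZero φ ≫ totMapZero ψ = 𝟙 _ := by
  rw [totMapZero_comp, ← totMapZero_id]
  exact congrArg totMapZero (funext h)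

/-- Two minimal models are isomorphic. -/
theorem exists_isIsomorphism_of_isQuasiIso {mV : AInfStructure V} {mV' : AInfStructure V'}
    {mA : AInfStructure A} (S : mA.Splitting) (hV : mV.IsMinimal) (hV' : mV'.IsMinimal)
    (f : AInfHom mV mA) (hf : f.IsQuasiIso) (f' : AInfHom mV' mA) (hf' : f'.IsQuasiIso) :
    ∃ φ : AInfHom mV mV', φ.IsIsomorphism := by
  have hθ := (f.isQuasiIso_iff hV S).1 hf
  have hθ' := (f'.isQuasiIso_iff hV' S).1 hf'
  -- The class map is normalised so that the linear part of f' becomes an exact section of it, as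
  -- `exists_lift` requires.
  obtain ⟨p, hp⟩ : ∃ p : ∀ i, A i ⟶ V' i, ∀ i, p i = S.p i ≫ inv (f'.lin i ≫ S.p i) :=
    ⟨_, fun _ => rfl⟩
  obtain ⟨P, hP⟩ : ∃ P, P = totMapZero p := ⟨_, rfl⟩
  obtain ⟨G, hG⟩ : ∃ G, G = totMapZero f'.lin := ⟨_, rfl⟩
  obtain ⟨h, hh⟩ : ∃ h : tot A ⟶ tot A, h = totMap (-1) fun i j _ => S.h i j := ⟨_, rfl⟩
  have hz : ∀ {W : GradedObject ℤ C}, totMap 1 (fun i j _ => (0 : W i ⟶ W j)) = 0 := fun {W} =>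
    tot_ext fun i => by rw [totι_totMap _ i _ rfl, zero_comp, comp_zero]
  have hGd : HasDegree 0 G := hG ▸ hasDegree_totMapZero _
  have hPd : HasDegree 0 P := hP ▸ hasDegree_totMapZero _
  have hhd : HasDegree (-1) h := hh ▸ hasDegree_totMap _
  have hGM : G ≫ mA.totD = 0 := by
    rw [hG, ← mA.totMapZero_totD (d := fun _ _ => 0)
      (fun i j => by rw [f'.lin_d hV', zero_comp]), hz, zero_comp]
  have hMP : mA.totD ≫ P = 0 := by
    rw [hP, mA.totD_totMapZero (d := fun _ _ => 0)
      (fun i j => by rw [hp, ← Category.assoc, S.d_p, zero_comp, comp_zero]), hz, comp_zero]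
  have hGP : G ≫ P = 𝟙 _ := by
    rw [hG, hP]
    exact totMapZero_comp_eq_id fun i => by rw [hp, ← Category.assoc, IsIso.hom_inv_id]
  have hE := mA.totMapZero_comp_totMapZero S.p_g
  rw [← hh] at hE
  have hPG : P ≫ G ≫ totMapZero S.p ≫ totMapZero S.g = totMapZero S.p ≫ totMapZero S.g := by
    rw [hP, hG, ← Category.assoc, totMapZero_comp, ← Category.assoc, totMapZero_comp]
    congr 2
    funext i
    rw [hp, Category.assoc, Category.assoc, IsIso.inv_hom_id, Category.comp_id]
  -- Multiplying the splitting identity on the left by PG and using Gm = 0 gives PG = 1 + mh + hm -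
  -- PGhm. The last term is absorbed by the corrected homotopy h - PGh, which does not affect mh
  -- because mP = 0.
  have key : P ≫ G = 𝟙 _ + mA.totD ≫ (h - P ≫ G ≫ h) + (h - P ≫ G ≫ h) ≫ mA.totD := by
    rw [hE] at hPG
    simp only [Preadditive.comp_add, Category.comp_id] at hPG
    rw [reassoc_of% hGM, zero_comp, comp_zero, add_zero] at hPG
    rw [Preadditive.comp_sub, reassoc_of% hMP, zero_comp, sub_zero, Preadditive.sub_comp,
      Category.assoc, Category.assoc, ← add_sub_assoc, ← hPG, add_sub_cancel_right]
  obtain ⟨φ, hφ0, hφ1, haφ, hφ, -⟩ := exists_lift mV.hasDegree_barOp (mV.isMinimal_iff.1 hV)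
    mV.barDer_barOp mA.hasDegree_barOp mA.barDer_barOp f.hasDegree_barOp f.barOp_mem
    f.barDer_barOp f'.hasDegree_barOp f'.barOp_mem f'.barDer_barOp (f'.letterMap_barOp.trans hG.symm)
    rfl hPd (hhd.sub (hPd.comp (hGd.comp hhd (zero_add _)) (zero_add _))) mA.totD_totD hGM hMP hGP
    key
  rw [f.letterMap_barOp, hP, totMapZero_comp] at hφ
  obtain ⟨χ, hχ0, hχ1, haχ, hχφ, hφχ⟩ := exists_inverse mV.hasDegree_barOp mV.barDer_barOp
    (mV.isMinimal_iff.1 hV) mV'.hasDegree_barOp (mV'.isMinimal_iff.1 hV') mV'.barDer_barOp hφ0 hφ1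
    haφ (hasDegree_totMapZero fun i => (f'.lin i ≫ S.p i) ≫ inv (f.lin i ≫ S.p i))
    (by
      rw [hφ]
      exact totMapZero_comp_eq_id fun i => by
        rw [hp, ← Category.assoc (f.lin i), Category.assoc, IsIso.inv_hom_id_assoc,
          IsIso.hom_inv_id])
    (by
      rw [hφ]
      exact totMapZero_comp_eq_id fun i => by
        rw [hp, ← Category.assoc (f.lin i), Category.assoc, IsIso.inv_hom_id_assoc,
          IsIso.hom_inv_id])
  refine ⟨AInfHom.ofBar φ hφ0 hφ1 haφ, AInfHom.ofBar χ hχ0 hχ1 haχ,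
    AInfHom.isIdentity_compFun _ _ ?_, AInfHom.isIdentity_compFun _ _ ?_⟩
  · rw [AInfHom.barOp_ofBar, AInfHom.barOp_ofBar, hφχ]
  · rw [AInfHom.barOp_ofBar, AInfHom.barOp_ofBar, hχφ]

end MinimalModel

end AInfinity

theorem mainTheorem4 {K : Type*} [Field K] {C : Type u} [Category.{v} C] [Abelian C] [Linear K C]
    [HasColimits C] [AB5 C] [SplitMonoCategory C]
    [MonoidalCategory C] [MonoidalPreadditive C] [MonoidalLinear K C]
    [∀ X : C, PreservesFiniteLimits (tensorLeft X)]
    [∀ X : C, PreservesFiniteColimits (tensorLeft X)]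
    [∀ X : C, PreservesFilteredColimits (tensorLeft X)]
    [∀ X : C, PreservesFiniteLimits (tensorRight X)]
    [∀ X : C, PreservesFiniteColimits (tensorRight X)]
    [∀ X : C, PreservesFilteredColimits (tensorRight X)]
    (A : GradedObject ℤ C) (mA : AInfinity.AInfStructure A) :
    (∀ (V : CochainComplex C ℤ) (g : V ⟶ mA.complex),
      (∃ e : HomotopyEquiv V mA.complex, e.hom = g) →
        ∃ mV : AInfinity.AInfStructure V.X, mV.complex = V ∧
          ∃ f : AInfinity.AInfHom mV mA, ∀ i : ℤ, f.linear.f i = g.f i) ∧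
    (∃ mH : AInfinity.AInfStructure mA.homology, mH.IsMinimal ∧ mA.InducesProduct mH ∧
      ∃ f : AInfinity.AInfHom mH mA, f.LiftsIdentity ∧ f.IsQuasiIso) ∧
    (∀ mH mH' : AInfinity.AInfStructure mA.homology, mH.IsMinimal → mH'.IsMinimal →
      (∃ f : AInfinity.AInfHom mH mA, f.IsQuasiIso) →
      (∃ f' : AInfinity.AInfHom mH' mA, f'.IsQuasiIso) →
        ∃ φ : AInfinity.AInfHom mH mH', φ.IsIsomorphism) := by
  have : AInfinity.TensorPreservesCoproducts C :=
    AInfinity.tensorPreservesCoproducts_of_filtered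
  obtain ⟨S⟩ := mA.exists_splitting
  refine ⟨?_, AInfinity.AInfStructure.exists_minimalModel S, ?_⟩
  · rintro V g ⟨e, rfl⟩
    exact mA.exists_of_homotopyEquiv V e
  · rintro mH mH' hH hH' ⟨f, hf⟩ ⟨f', hf'⟩
    exact AInfinity.exists_isIsomorphism_of_isQuasiIso S hH hH' f hf f' hf'
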